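/- Graphs are finite and may have parallel edges and loops; a loop counts twice in a degree. A circuit is a connected $2$-regular subgraph, and a $k$-cycle is a circuit with $k$ vertices. A circuit double cover of a graph $H$ is a multiset of circuits of $H$ such that every edge of $H$ is contained in exactly two of its members, counted with multiplicity; $\nu(H)$ denotes the number of circuit double covers of $H$. A graph is cyclically $4$-edge-connected if every edge cut that has a circuit on each of its two sides consists of at least $4$ edges (the empty cut of a disconnected graph included). Let $G$ be a cyclically $4$-edge-connected cubic graph with no $4$-cycle, and let $v_0v_1v_2v_3v_4$ be a $5$-cycle of $G$, with vertices in cyclic order and indices modulo $5$. For each $i$ let $u_i$ be the end, other than $v_i$, of the third edge at $v_i$ (the edge not on the $5$-cycle). For $a \neq b$ let $G_{a,b}$ be the cubic graph obtained from $G$ by deleting $v_0,\dots,v_4$ together with all their edges, adding a new edge joining $u_a$ and $u_b$, and adding a new vertex joined by one edge to each of the three vertices $u_c$ with $c \in \{0,1,2,3,4\} \setminus \{a,b\}$. (The new edge may be parallel to an edge of $G$.) The graphs $G_{i,i+1}$ are the five replacements of the $5$-cycle by a cubic vertex and an edge that are non-crossing when the $5$-cycle is drawn as a face. Then \[ \nu(G)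 \;\ge\; \tfrac{5}{2}\, \min_{0 \le i \le 4} \nu(G_{i,i+1}) \qquad\text{and}\qquad \nu(G) \;\ge\; 3.75 \min_{0 \le a < b \le 4} \nu(G_{a,b}). \] -/

import Mathlib

namespace Graph

variable {α β : Type*}

/-- The degree of a vertex of a multigraph: the number of incident edges, loops counted twice. -/
noncomputable def degree (G : Graph α β) (x : α) : ℕ∞ :=
  (G.incidenceSet x).encard + (G.loopSet x).encard

/-- All vertices have degree three. -/
def IsCubic (G : Graph α β) : Prop := ∀ x ∈ G.vertexSet, G.degree x = 3

/-- A nonempty graph in which any two vertices are joined by a walk. -/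
def IsConnected (G : Graph α β) : Prop :=
  G.vertexSet.Nonempty ∧
    ∀ x ∈ G.vertexSet, ∀ y ∈ G.vertexSet, Relation.ReflTransGen G.Adj x y

/-- A circuit is a finite connected 2-regular graph (a loop and a pair of parallel edges
are the circuits of length one and two). -/
def IsCircuit (C : Graph α β) : Prop :=
  C.vertexSet.Finite ∧ C.IsConnected ∧ ∀ x ∈ C.vertexSet, C.degree x = 2

/-- `G` contains a `k`-cycle, i.e. a circuit of length `k`, as a (not necessarily induced)
subgraph. -/
def HasCycleOfLength (G : Graph α β) (k : ℕ) : Prop :=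
  ∃ C : Graph α β, C ≤ G ∧ C.IsCircuit ∧ C.vertexSet.encard = k

/-- The edge cut between the vertex set `X` and the remaining vertices. -/
def edgeCut (G : Graph α β) (X : Set α) : Set β :=
  {e | ∃ x ∈ X, ∃ y ∈ G.vertexSet \ X, G.IsLink e x y}

/-- Every edge cut with a circuit on each of its two sides has at least `k` edges. (The empty
cut is included, so a cubic graph with this property for some `k ≥ 1` is connected.) -/
def CyclicallyEdgeConnected (G : Graph α β) (k : ℕ) : Prop :=
  ∀ X ⊆ G.vertexSet,
    (∃ C, C ≤ G.induce X ∧ C.IsCircuit) →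
    (∃ C, C ≤ G.induce (G.vertexSet \ X) ∧ C.IsCircuit) →
    (k : ℕ∞) ≤ (G.edgeCut X).encard

open Classical in
/-- A multiset of circuits of `G` in which every edge of `G` lies in exactly two members,
counted with multiplicity. -/
def IsCircuitDoubleCover (G : Graph α β) (𝒞 : Multiset (Graph α β)) : Prop :=
  (∀ C ∈ 𝒞, C ≤ G ∧ C.IsCircuit) ∧
    ∀ e ∈ G.edgeSet, 𝒞.countP (fun C => e ∈ C.edgeSet) = 2

/-- `ν(G)`, the number of circuit double covers of a finite graph. -/
noncomputable def numCircuitDoubleCovers (G : Graph α β) : ℕ :=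
  {𝒞 : Multiset (Graph α β) | G.IsCircuitDoubleCover 𝒞}.ncard

/-- A 5-cycle of `G` with a cyclic labelling `vert 0, …, vert 4` of its vertices; indices are
modulo five. `rim i` is the edge of the cycle from `vert i` to `vert (i + 1)`, and `spoke i` is
an edge at `vert i` outside the cycle, with other end `outer i`. In a cubic graph `spoke i` and
`outer i` exist and are determined by the cycle. -/
structure FiveCycle (G : Graph α β) where
  vert : Fin 5 → α
  rim : Fin 5 → β
  spoke : Fin 5 → β
  outer : Fin 5 → α
  vert_injective : Function.Injective vert
  rim_isLink : ∀ i, G.IsLink (rim i) (vert i) (vert (i + 1))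
  spoke_isLink : ∀ i, G.IsLink (spoke i) (vert i) (outer i)
  spoke_ne_rim : ∀ i j, spoke i ≠ rim j

namespace FiveCycle

variable {G : Graph α β}

open Classical in
/-- Sends the vertices of the 5-cycle to the new vertex `none` and fixes all other vertices. -/
noncomputable def collapse (P : G.FiveCycle) (x : α) : Option α :=
  if x ∈ Set.range P.vert then none else some x

/-- The graph obtained from `G` by replacing the 5-cycle by a cubic vertex and an edge. The new
edge `none` joins `outer a` and `outer b` (and takes the place of the spokes `a` and `b`); the
new vertex `none` is attached to the other three spokes; everything outside the 5-cycle is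
kept. -/
noncomputable def replace (P : G.FiveCycle) (a b : Fin 5) : Graph (Option α) (Option β) where
  vertexSet := P.collapse '' G.vertexSet
  IsLink f x y :=
    (∃ e, f = some e ∧
      ((G.deleteEdges (Set.range P.rim ∪ {P.spoke a, P.spoke b})).map P.collapse).IsLink e x y) ∨
    (f = none ∧ s(x, y) = s(P.collapse (P.outer a), P.collapse (P.outer b)))
  isLink_symm := by
    intro f _
    constructor
    rintro x y (⟨e, rfl, h⟩ | ⟨rfl, h⟩)
    · exact Or.inl ⟨e, rfl, h.symm⟩
    · exact Or.inr ⟨rfl, by rw [Sym2.eq_swap, h]⟩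
  eq_or_eq_of_isLink_of_isLink := by
    rintro f x y z w (⟨e, rfl, h⟩ | ⟨rfl, h⟩) (⟨e', he, h'⟩ | ⟨he, h'⟩)
    · obtain rfl := Option.some.inj he
      exact h.left_eq_or_eq h'
    · cases he
    · cases he
    · have hx : x ∈ s(z, w) := by rw [h', ← h]; exact Sym2.mem_mk_left x y
      exact Sym2.mem_iff.1 hx
  left_mem_of_isLink := by
    rintro f x y (⟨e, rfl, h⟩ | ⟨rfl, h⟩)
    · simpa using h.left_mem
    · have hx : x ∈ s(P.collapse (P.outer a), P.collapse (P.outer b)) := by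
        rw [← h]; exact Sym2.mem_mk_left x y
      rcases Sym2.mem_iff.1 hx with rfl | rfl
      · exact ⟨_, (P.spoke_isLink a).right_mem, rfl⟩
      · exact ⟨_, (P.spoke_isLink b).right_mem, rfl⟩

end FiveCycle

end Graph

/-- The ten two-element subsets `{a, b}` of the five spokes, listed with `a < b`. -/
def spokePairs : Finset (Fin 5 × Fin 5) := Finset.univ.filter fun p => p.1 < p.2

theorem spokePairs_nonempty : spokePairs.Nonempty := ⟨(0, 1), by decide⟩

/-! Call two distinct edges at a vertex a corner. In a loopless cubic graph a circuit double cover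
uses every corner exactly once: if `e`, `f`, `g` are the edges at a vertex and `n_ef` members use
both `e` and `f`, then `n_ef + n_eg = n_ef + n_fg = n_eg + n_fg = 2`. A cover therefore amounts to a
rule that continues each corner across each of its edges to a corner at the other end, such that the
closed walks so traced visit no vertex twice. These rules are the involutions of flags in
`circuitTransitions`, and `IsLooplessCubic.numCircuitDoubleCovers_eq` is the resulting count.

Such a rule can be restricted to the flags at the vertices off the 5-cycle. This outer part has ten
loose flags, two sides for each spoke. They are joined in pairs by five paths, because a class of
two involutions that contains one fixed point contains exactly two
(`exists_unique_other_fixedPoint`). A path never returns to its own spoke, since the walks are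
simple. So the paths are the edges of a loopless 2-regular multigraph on the five spokes, which
leaves 22 patterns up to exchanging the sides of spokes. Restricting a rule of `G` or of any
replacement gives an outer part of this same kind, so all eleven counts can be sorted by outer
parts.

Fix an outer part, and let `D` be the set of pairs of paths that do not meet. An extension to a
replacement is determined by a matching of the ten sides, and it must not put two meeting paths on
one walk; this gives an upper bound (`replacementCount`). An extension to `G` chooses one of two
continuations on each of the ten edges at the 5-cycle; explicit good choices give a lower bound
(`pentagonCount`). For every pattern and every `D`, the finite computation
`weighted_replacementCount_le` says that twice the bounds for the five pairs `i, i + 1` plus the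
bounds for the five pairs `i, i + 2` is at most four times the lower bound. Summed over outer parts,
this is `weighted_sum_le`: `2 ∑ ν(G_{i,i+1}) + ∑ ν(G_{i,i+2}) ≤ 4 ν(G)`. With `m₁` and `m₂` the two
minima, it yields `10 m₁ ≤ 4 ν(G)` and `15 m₂ ≤ 4 ν(G)`.

The argument needs `IsProper`: no loops, no chords of the 5-cycle, distinct outer ends of the
spokes. If this fails in a graph without 4-cycle, then some `G_{i,i+1}` has a vertex with exactly
one non-loop edge. No circuit contains that edge, so `ν(G_{i,i+1}) = 0` and both inequalities are
trivial. -/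

/-! ### Classes generated by two maps. -/

/-- The equivalence relation generated by two maps on a type. -/
def Linked {X : Type*} (σ τ : X → X) : X → X → Prop :=
  Relation.EqvGen fun x y => y = σ x ∨ y = τ x

namespace Linked

variable {X : Type*} {σ τ : X → X} {x y z : X}

theorem refl (x : X) : Linked σ τ x x := Relation.EqvGen.refl x

theorem symm (h : Linked σ τ x y) : Linked σ τ y x := Relation.EqvGen.symm _ _ h

theorem trans (h : Linked σ τ x y) (h' : Linked σ τ y z) : Linked σ τ x z :=
  Relation.EqvGen.trans _ _ _ h h'

theorem fst (x : X) : Linked σ τ x (σ x) := Relation.EqvGen.rel _ _ (Or.inl rfl)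

theorem snd (x : X) : Linked σ τ x (τ x) := Relation.EqvGen.rel _ _ (Or.inr rfl)

/-- Maps that identify each point with its two images identify linked points. -/
theorem rel_of_equivalence {r : X → X → Prop} (hr : Equivalence r) (hσ : ∀ x, r x (σ x))
    (hτ : ∀ x, r x (τ x)) (h : Linked σ τ x y) : r x y := by
  induction h with
  | rel a b h => rcases h with rfl | rfl; exacts [hσ a, hτ a]
  | refl a => exact hr.refl a
  | symm a b _ ih => exact hr.symm ih
  | trans a b c _ _ ih ih' => exact hr.trans ih ih'

theorem map_eq {K : Type*} (f : X → K) (hσ : ∀ x, f (σ x) = f x) (hτ : ∀ x, f (τ x) = f x)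
    (h : Linked σ τ x y) : f x = f y :=
  rel_of_equivalence (r := fun a b => f a = f b) ⟨fun _ => rfl, Eq.symm, Eq.trans⟩
    (fun a => (hσ a).symm) (fun a => (hτ a).symm) h

end Linked

/-! ### Flags, transition systems and the circuits they trace. -/

namespace Graph

variable {α β : Type*}

/-- A flag of a multigraph: a vertex with an ordered pair of distinct incident edges. -/
@[ext] structure Flag (G : Graph α β) where
  vtx : α
  edge : β
  other : β
  inc_edge : G.Inc edge vtx
  inc_other : G.Inc other vtx
  edge_ne_other : edge ≠ other

namespace Flag

variable {G : Graph α β}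

/-- Exchange the two edges of a flag. -/
def swap (φ : G.Flag) : G.Flag where
  vtx := φ.vtx
  edge := φ.other
  other := φ.edge
  inc_edge := φ.inc_other
  inc_other := φ.inc_edge
  edge_ne_other := φ.edge_ne_other.symm

@[simp] theorem swap_vtx (φ : G.Flag) : φ.swap.vtx = φ.vtx := rfl
@[simp] theorem swap_edge (φ : G.Flag) : φ.swap.edge = φ.other := rfl
@[simp] theorem swap_swap (φ : G.Flag) : φ.swap.swap = φ := rfl

theorem swap_ne (φ : G.Flag) : φ.swap ≠ φ := fun h =>
  φ.edge_ne_other (congrArg Flag.other h)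

theorem finite (hV : G.vertexSet.Finite) (hE : G.edgeSet.Finite) : Finite G.Flag := by
  have := hV.to_subtype
  have := hE.to_subtype
  refine Finite.of_injective (β := G.vertexSet × G.edgeSet × G.edgeSet)
    (fun φ => (⟨φ.vtx, φ.inc_edge.vertex_mem⟩, ⟨φ.edge, φ.inc_edge.edge_mem⟩,
      ⟨φ.other, φ.inc_other.edge_mem⟩)) fun φ ψ h => ?_
  simp only [Prod.mk.injEq, Subtype.mk.injEq] at h
  exact Flag.ext h.1 h.2.1 h.2.2

end Flag

/-- All vertices have exactly three incident edges, none of which is a loop. -/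
structure IsLooplessCubic (G : Graph α β) : Prop where
  not_isLoopAt : ∀ e x, ¬ G.IsLoopAt e x
  encard_incidenceSet : ∀ x ∈ G.vertexSet, (G.incidenceSet x).encard = 3

/-- A transition system: it continues each flag across its first edge to a flag at the other
end of that edge. -/
structure IsTransition (G : Graph α β) (σ : G.Flag → G.Flag) : Prop where
  involutive : ∀ φ, σ (σ φ) = φ
  edge_eq : ∀ φ, (σ φ).edge = φ.edge
  vtx_ne : ∀ φ, (σ φ).vtx ≠ φ.vtx

/-- The closed walks traced by a transition system visit each vertex at most once. -/
def IsSimpleTransition (G : Graph α β) (σ : G.Flag → G.Flag) : Prop :=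
  ∀ φ ψ, Linked σ Flag.swap φ ψ → φ.vtx = ψ.vtx → ψ = φ ∨ ψ = φ.swap

/-- The transition systems whose closed walks are circuits. -/
def circuitTransitions (G : Graph α β) : Set (G.Flag → G.Flag) :=
  {σ | G.IsTransition σ ∧ G.IsSimpleTransition σ}

section

variable {G : Graph α β} {σ : G.Flag → G.Flag}

theorem IsTransition.isLink (h : G.IsTransition σ) (φ : G.Flag) :
    G.IsLink φ.edge φ.vtx (σ φ).vtx := by
  obtain ⟨y, hy⟩ := φ.inc_edge
  have h1 := (σ φ).inc_edge
  rw [h.edge_eq] at h1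
  rcases h1.eq_or_eq_of_isLink hy with h2 | h2
  · exact absurd h2 (h.vtx_ne φ)
  · rwa [h2]

/-- The subgraph traced by the closed walk through a flag. -/
def tracedGraph (h : G.IsTransition σ) (φ : G.Flag) : Graph α β where
  vertexSet := {x | ∃ ψ, Linked σ Flag.swap φ ψ ∧ ψ.vtx = x}
  IsLink e x y := G.IsLink e x y ∧ ∃ ψ, Linked σ Flag.swap φ ψ ∧ ψ.edge = e
  isLink_symm := fun e _ => ⟨fun x y hxy => ⟨hxy.1.symm, hxy.2⟩⟩
  eq_or_eq_of_isLink_of_isLink := fun e x y v w h h' => h.1.left_eq_or_eq h'.1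
  left_mem_of_isLink := by
    rintro e x y ⟨hxy, ψ, hψ, rfl⟩
    have h2 := h.isLink ψ
    rcases hxy.left_eq_or_eq h2 with rfl | rfl
    · exact ⟨ψ, hψ, rfl⟩
    · exact ⟨σ ψ, hψ.trans (Linked.fst ψ), rfl⟩

variable (h : G.IsTransition σ)

theorem tracedGraph_le (φ : G.Flag) : tracedGraph h φ ≤ G := by
  refine ⟨?_, fun e x y hxy => hxy.1⟩
  rintro x ⟨ψ, -, rfl⟩
  exact ψ.inc_edge.vertex_mem

theorem mem_edgeSet_tracedGraph {φ : G.Flag} {e : β} :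
    e ∈ (tracedGraph h φ).edgeSet ↔ ∃ ψ, Linked σ Flag.swap φ ψ ∧ ψ.edge = e := by
  constructor
  · intro he
    obtain ⟨x, y, hxy⟩ := exists_isLink_of_mem_edgeSet he
    exact hxy.2
  · rintro ⟨ψ, hψ, rfl⟩
    exact IsLink.edge_mem (G := tracedGraph h φ) ⟨h.isLink ψ, ψ, hψ, rfl⟩

theorem tracedGraph_congr {φ ψ : G.Flag} (hl : Linked σ Flag.swap φ ψ) :
    tracedGraph h φ = tracedGraph h ψ := by
  have key : ∀ χ, Linked σ Flag.swap φ χ ↔ Linked σ Flag.swap ψ χ :=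
    fun χ => ⟨fun h => hl.symm.trans h, fun h => hl.trans h⟩
  refine Graph.ext ?_ fun e x y => ?_
  · ext x
    simp [tracedGraph, key]
  · simp [tracedGraph, key]

theorem exists_flag_of_mem_tracedGraph {φ : G.Flag} {e : β} {x : α}
    (he : e ∈ (tracedGraph h φ).edgeSet) (hx : G.Inc e x) :
    ∃ ψ, Linked σ Flag.swap φ ψ ∧ ψ.vtx = x ∧ ψ.edge = e := by
  obtain ⟨ψ, hψ, rfl⟩ := (mem_edgeSet_tracedGraph h).1 he
  rcases hx.eq_or_eq_of_isLink (h.isLink ψ) with rfl | rfl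
  · exact ⟨ψ, hψ, rfl, rfl⟩
  · exact ⟨σ ψ, hψ.trans (Linked.fst ψ), rfl, h.edge_eq ψ⟩

theorem edge_mem_tracedGraph {φ ψ : G.Flag} (hl : Linked σ Flag.swap φ ψ) :
    ψ.edge ∈ (tracedGraph h φ).edgeSet := (mem_edgeSet_tracedGraph h).2 ⟨ψ, hl, rfl⟩

theorem other_mem_tracedGraph {φ ψ : G.Flag} (hl : Linked σ Flag.swap φ ψ) :
    ψ.other ∈ (tracedGraph h φ).edgeSet :=
  (mem_edgeSet_tracedGraph h).2 ⟨ψ.swap, hl.trans (Linked.snd ψ), rfl⟩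

variable (hs : G.IsSimpleTransition σ)
include hs

/-- A simple walk passes a vertex through only one corner. If both edges of `ψ` are traced, the
flags of the walk on these edges at `ψ.vtx` form that one corner, which is `ψ`. -/
theorem linked_of_mem_tracedGraph {φ ψ : G.Flag} (h1 : ψ.edge ∈ (tracedGraph h φ).edgeSet)
    (h2 : ψ.other ∈ (tracedGraph h φ).edgeSet) : Linked σ Flag.swap φ ψ := by
  obtain ⟨χ, hχ, hv, he⟩ := exists_flag_of_mem_tracedGraph h h1 ψ.inc_edge
  obtain ⟨χ', hχ', hv', he'⟩ := exists_flag_of_mem_tracedGraph h h2 ψ.inc_other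
  rcases hs χ χ' (hχ.symm.trans hχ') (hv.trans hv'.symm) with h3 | h3
  · exact absurd (by rw [← he, ← he', h3]) ψ.edge_ne_other
  · have : χ = ψ := Flag.ext hv he (by rw [← he', h3]; rfl)
    rwa [← this]

theorem incidenceSet_tracedGraph {φ ψ : G.Flag} (hl : Linked σ Flag.swap φ ψ) :
    (tracedGraph h φ).incidenceSet ψ.vtx = {ψ.edge, ψ.other} := by
  ext e
  constructor
  · intro he
    obtain ⟨χ, hχ, hv, rfl⟩ := exists_flag_of_mem_tracedGraph h he.edge_mem
      (he.mono (tracedGraph_le h φ))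
    rcases hs ψ χ (hl.symm.trans hχ) hv.symm with rfl | rfl <;> simp
  · rintro (rfl | rfl)
    · exact ((tracedGraph_le h φ).inc_congr (edge_mem_tracedGraph h hl)).2 ψ.inc_edge
    · exact ((tracedGraph_le h φ).inc_congr (other_mem_tracedGraph h hl)).2 ψ.inc_other

theorem isCircuit_tracedGraph (hV : G.vertexSet.Finite) (hG : G.IsLooplessCubic) (φ : G.Flag) :
    (tracedGraph h φ).IsCircuit := by
  refine ⟨hV.subset (tracedGraph_le h φ).vertexSet_mono, ⟨⟨_, φ, Linked.refl φ, rfl⟩, ?_⟩, ?_⟩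
  · have key : ∀ χ ψ, Linked σ Flag.swap χ ψ → Linked σ Flag.swap φ χ →
        Relation.ReflTransGen (tracedGraph h φ).Adj χ.vtx ψ.vtx := by
      intro χ ψ hl hχ
      have hsym : Std.Symm (tracedGraph h φ).Adj := inferInstance
      -- Adjacency is wanted inside the traced graph, so the relation also records that both flags
      -- belong to the walk of `φ`.
      refine (Linked.rel_of_equivalence (σ := σ) (τ := Flag.swap) (r := fun χ ψ =>
        (Linked σ Flag.swap φ χ ↔ Linked σ Flag.swap φ ψ) ∧ (Linked σ Flag.swap φ χ →
          Relation.ReflTransGen (tracedGraph h φ).Adj χ.vtx ψ.vtx))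
        ⟨fun _ => ⟨Iff.rfl, fun _ => .refl⟩, ?_, ?_⟩ ?_ ?_ hl).2 hχ
      · exact fun hab => ⟨hab.1.symm, fun hb => Std.Symm.symm _ _ (hab.2 (hab.1.2 hb))⟩
      · exact fun hab hbc => ⟨hab.1.trans hbc.1, fun ha => (hab.2 ha).trans (hbc.2 (hab.1.1 ha))⟩
      · exact fun a => ⟨⟨fun ha => ha.trans (Linked.fst a), fun ha => ha.trans (Linked.fst a).symm⟩,
          fun ha => Relation.ReflTransGen.single ⟨a.edge, h.isLink a, a, ha, rfl⟩⟩
      · exact fun a => ⟨⟨fun ha => ha.trans (Linked.snd a), fun ha => ha.trans (Linked.snd a).symm⟩,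
          fun ha => .refl⟩
    rintro x ⟨χ, hχ, rfl⟩ y ⟨ψ, hψ, rfl⟩
    exact key χ ψ (hχ.symm.trans hψ) hχ
  · rintro x ⟨ψ, hψ, rfl⟩
    have hloop : (tracedGraph h φ).loopSet ψ.vtx = ∅ := by
      ext e
      simp only [mem_loopSet, Set.mem_empty_iff_false, iff_false]
      exact fun he => hG.not_isLoopAt _ _ (he.mono (tracedGraph_le h φ))
    rw [degree, hloop, incidenceSet_tracedGraph h hs hψ, Set.encard_pair ψ.edge_ne_other]
    simp

end

/-! ### Circuit double covers of loopless cubic graphs as transition systems. -/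

section

variable {G : Graph α β}

theorem IsLooplessCubic.exists_edges (hG : G.IsLooplessCubic) {x : α} (hx : x ∈ G.vertexSet) :
    ∃ a b c, a ≠ b ∧ a ≠ c ∧ b ≠ c ∧ G.incidenceSet x = {a, b, c} :=
  Set.encard_eq_three.1 (hG.encard_incidenceSet x hx)

theorem IsLooplessCubic.exists_third (hG : G.IsLooplessCubic) (φ : G.Flag) :
    ∃ g, g ≠ φ.edge ∧ g ≠ φ.other ∧ G.incidenceSet φ.vtx = {φ.edge, φ.other, g} := by
  obtain ⟨a, b, c, hab, hac, hbc, hi⟩ := hG.exists_edges φ.inc_edge.vertex_mem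
  have h1 : φ.edge ∈ ({a, b, c} : Set β) := hi ▸ φ.inc_edge
  have h2 : φ.other ∈ ({a, b, c} : Set β) := hi ▸ φ.inc_other
  have h3 := φ.edge_ne_other
  rw [hi]
  simp only [Set.mem_insert_iff, Set.mem_singleton_iff] at h1 h2
  rcases h1 with h1 | h1 | h1 <;> rcases h2 with h2 | h2 | h2 <;> rw [h1, h2] at h3 ⊢
  · exact absurd rfl h3
  · exact ⟨c, hac.symm, hbc.symm, rfl⟩
  · exact ⟨b, hab.symm, hbc, by ext; simp; tauto⟩
  · exact ⟨c, hbc.symm, hac.symm, by ext; simp; tauto⟩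
  · exact absurd rfl h3
  · exact ⟨a, hab, hac, by ext; simp; tauto⟩
  · exact ⟨b, hbc, hab.symm, by ext; simp; tauto⟩
  · exact ⟨a, hac, hab, by ext; simp; tauto⟩
  · exact absurd rfl h3

open Classical in
/-- The circuits traced by a transition system. -/
noncomputable def tracedCover [Fintype G.Flag] {σ : G.Flag → G.Flag} (h : G.IsTransition σ) :
    Finset (Graph α β) := Finset.univ.image (tracedGraph h)

theorem mem_tracedCover [Fintype G.Flag] {σ : G.Flag → G.Flag} (h : G.IsTransition σ)
    {C : Graph α β} : C ∈ tracedCover h ↔ ∃ φ, tracedGraph h φ = C := by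
  simp [tracedCover]

/-- At an end of an edge `e`, exactly two corners contain `e`. The walks through them are different
by simplicity, and every traced circuit containing `e` uses one of the two corners. -/
theorem isCircuitDoubleCover_tracedCover [Fintype G.Flag] (hV : G.vertexSet.Finite)
    (hG : G.IsLooplessCubic) {σ : G.Flag → G.Flag} (h : G.IsTransition σ)
    (hs : G.IsSimpleTransition σ) : G.IsCircuitDoubleCover (tracedCover h).val := by
  classical
  refine ⟨fun C hC => ?_, fun e he => ?_⟩
  · obtain ⟨φ, rfl⟩ := (mem_tracedCover h).1 hC
    exact ⟨tracedGraph_le h φ, isCircuit_tracedGraph h hs hV hG φ⟩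
  · obtain ⟨x, y, hxy⟩ := exists_isLink_of_mem_edgeSet he
    obtain ⟨f, hfe, hf⟩ : ∃ f, f ≠ e ∧ G.Inc f x := by
      obtain ⟨a, b, c, hab, hac, hbc, hi⟩ := hG.exists_edges hxy.left_mem
      have ha : G.Inc a x := by rw [← mem_incidenceSet, hi]; simp
      have hb : G.Inc b x := by rw [← mem_incidenceSet, hi]; simp
      rcases eq_or_ne a e with rfl | hne
      · exact ⟨b, hab.symm, hb⟩
      · exact ⟨a, hne, ha⟩
    let φ : G.Flag := ⟨x, e, f, hxy.inc_left, hf, hfe.symm⟩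
    obtain ⟨g, hge, hgf, hi⟩ := hG.exists_third φ
    have hg : G.Inc g x := by
      have : g ∈ G.incidenceSet φ.vtx := by rw [hi]; simp
      exact this
    let ψ : G.Flag := ⟨x, e, g, hxy.inc_left, hg, hge.symm⟩
    have hne : tracedGraph h φ ≠ tracedGraph h ψ := by
      intro heq
      have hl : Linked σ Flag.swap φ ψ := by
        refine linked_of_mem_tracedGraph h hs ?_ ?_
        · change φ.edge ∈ _
          exact edge_mem_tracedGraph h (Linked.refl φ)
        · rw [heq]; exact other_mem_tracedGraph h (Linked.refl ψ)
      rcases hs φ ψ hl rfl with h1 | h1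
      · exact hgf (congrArg Flag.other h1)
      · exact hge (congrArg Flag.other h1)
    have hfil : (tracedCover h).filter (fun C => e ∈ C.edgeSet) =
        {tracedGraph h φ, tracedGraph h ψ} := by
      ext C
      simp only [Finset.mem_filter, mem_tracedCover, Finset.mem_insert, Finset.mem_singleton]
      constructor
      · rintro ⟨⟨χ, rfl⟩, he⟩
        obtain ⟨χ', hl, hv, he'⟩ := exists_flag_of_mem_tracedGraph h he hxy.inc_left
        rw [tracedGraph_congr h hl]
        have ho : χ'.other ∈ G.incidenceSet φ.vtx := by
          have := χ'.inc_other
          rw [hv] at this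
          exact this
        rw [hi] at ho
        rcases ho with ho | ho | ho
        · exact absurd (he'.trans ho.symm) χ'.edge_ne_other
        · left; congr 1; exact Flag.ext hv he' ho
        · right; congr 1; exact Flag.ext hv he' ho
      · rintro (rfl | rfl)
        · exact ⟨⟨_, rfl⟩, edge_mem_tracedGraph h (Linked.refl φ)⟩
        · exact ⟨⟨_, rfl⟩, edge_mem_tracedGraph h (Linked.refl ψ)⟩
    rw [Multiset.countP_eq_card_filter, ← Finset.filter_val, Finset.card_val]
    convert Finset.card_pair hne

/-- The traced circuit through a corner has only one corner at the other end of an edge, so the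
circuits determine how flags are continued. -/
theorem IsTransition.eq_of_tracedCover_eq [Fintype G.Flag] {σ σ' : G.Flag → G.Flag}
    (h : G.IsTransition σ) (h' : G.IsTransition σ')
    (hs' : G.IsSimpleTransition σ') (heq : tracedCover h = tracedCover h') : σ = σ' := by
  funext φ
  obtain ⟨χ, hχ⟩ : ∃ χ, tracedGraph h' χ = tracedGraph h φ := by
    rw [← mem_tracedCover, ← heq, mem_tracedCover]
    exact ⟨φ, rfl⟩
  have hl : Linked σ Flag.swap φ (σ φ) := Linked.fst φ
  have h1 : Linked σ' Flag.swap χ φ := by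
    refine linked_of_mem_tracedGraph h' hs' ?_ ?_ <;> rw [hχ]
    exacts [edge_mem_tracedGraph h (Linked.refl φ), other_mem_tracedGraph h (Linked.refl φ)]
  have h2 : Linked σ' Flag.swap χ (σ φ) := by
    refine linked_of_mem_tracedGraph h' hs' ?_ ?_ <;> rw [hχ]
    exacts [edge_mem_tracedGraph h hl, other_mem_tracedGraph h hl]
  have hv : (σ φ).vtx = (σ' φ).vtx := (h.isLink φ).right_unique (h'.isLink φ)
  rcases hs' _ _ (h2.symm.trans (h1.trans (Linked.fst φ))) hv with h3 | h3
  · exact h3.symm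
  · have h4 := congrArg Flag.edge h3
    rw [h'.edge_eq, Flag.swap_edge] at h4
    exact absurd ((h.edge_eq φ).trans h4) (σ φ).edge_ne_other

/-- Every circuit double cover of a loopless cubic graph is traced by a transition system. -/
theorem IsCircuitDoubleCover.exists_transition [Fintype G.Flag] (hG : G.IsLooplessCubic)
    {𝒞 : Multiset (Graph α β)} (h𝒞 : G.IsCircuitDoubleCover 𝒞) :
    ∃ (σ : G.Flag → G.Flag) (h : G.IsTransition σ), G.IsSimpleTransition σ ∧
      (tracedCover h).val = 𝒞 := by
  classical
  have hinc : ∀ C ∈ 𝒞, ∀ x ∈ C.vertexSet, ∃ a b, a ≠ b ∧ C.incidenceSet x = {a, b} := by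
    intro C hC x hx
    have hloop : C.loopSet x = ∅ := by
      ext e
      simp only [mem_loopSet, Set.mem_empty_iff_false, iff_false]
      exact fun he => hG.not_isLoopAt _ _ (he.mono (h𝒞.1 C hC).1)
    have hd := (h𝒞.1 C hC).2.2.2 x hx
    rw [degree, hloop] at hd
    simpa using Set.encard_eq_two.1 (by simpa using hd)
  have hpair : ∀ C ∈ 𝒞, ∀ φ : G.Flag, φ.edge ∈ C.edgeSet → φ.other ∈ C.edgeSet →
      C.incidenceSet φ.vtx = {φ.edge, φ.other} := by
    intro C hC φ h1 h2
    have i1 : C.Inc φ.edge φ.vtx := ((h𝒞.1 C hC).1.inc_congr h1).2 φ.inc_edge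
    have i2 : C.Inc φ.other φ.vtx := ((h𝒞.1 C hC).1.inc_congr h2).2 φ.inc_other
    obtain ⟨a, b, hab, hi⟩ := hinc C hC φ.vtx i1.vertex_mem
    rw [← mem_incidenceSet, hi] at i1 i2
    have h3 := φ.edge_ne_other
    rw [hi]
    simp only [Set.mem_insert_iff, Set.mem_singleton_iff] at i1 i2
    rcases i1 with i1 | i1 <;> rcases i2 with i2 | i2 <;> rw [i1, i2] at h3 ⊢
    · exact absurd rfl h3
    · exact Set.pair_comm _ _
    · exact absurd rfl h3
  -- A member of `𝒞` containing one edge at the vertex contains exactly one of the other two. Hence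
  -- the numbers of members through the three corners have pairwise sums 2, and each of them is 1.
  have hcount : ∀ φ : G.Flag,
      𝒞.countP (fun C => φ.edge ∈ C.edgeSet ∧ φ.other ∈ C.edgeSet) = 1 := by
    intro φ
    obtain ⟨g, hge, hgf, hi⟩ := hG.exists_third φ
    have hg : G.Inc g φ.vtx := by
      rw [← mem_incidenceSet, hi]; simp
    let ψ : G.Flag := ⟨φ.vtx, φ.edge, g, φ.inc_edge, hg, hge.symm⟩
    have split : ∀ a b c : β, (∀ C ∈ 𝒞, a ∈ C.edgeSet → (b ∉ C.edgeSet ↔ c ∈ C.edgeSet)) →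
        a ∈ G.edgeSet → 𝒞.countP (fun C => a ∈ C.edgeSet ∧ b ∈ C.edgeSet) +
          𝒞.countP (fun C => a ∈ C.edgeSet ∧ c ∈ C.edgeSet) = 2 := by
      intro a b c habc ha
      rw [← h𝒞.2 a ha, Multiset.countP_eq_countP_filter_add 𝒞 (fun C => a ∈ C.edgeSet)
          (fun C => b ∈ C.edgeSet),
        Multiset.countP_filter, Multiset.countP_filter]
      congr 1
      refine Multiset.countP_congr rfl fun C hC => ?_
      exact propext ⟨fun h => ⟨h.1, (habc C hC h.1).2 h.2⟩, fun h => ⟨h.1, (habc C hC h.1).1 h.2⟩⟩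
    have two : ∀ C ∈ 𝒞, ∀ χ : G.Flag, χ.vtx = φ.vtx → ∀ c, c ≠ χ.edge → c ≠ χ.other →
        G.incidenceSet φ.vtx = {χ.edge, χ.other, c} →
        χ.edge ∈ C.edgeSet → (χ.other ∉ C.edgeSet ↔ c ∈ C.edgeSet) := by
      intro C hC χ hv c hc hc' hi he
      have i1 : C.Inc χ.edge χ.vtx := ((h𝒞.1 C hC).1.inc_congr he).2 χ.inc_edge
      constructor
      · intro ho
        obtain ⟨a, b, hab, hi'⟩ := hinc C hC χ.vtx i1.vertex_mem
        have key : ∀ d, d ∈ C.incidenceSet χ.vtx → d = χ.edge ∨ d = c := by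
          intro d hd
          have : d ∈ G.incidenceSet φ.vtx := by
            rw [← hv]; exact Inc.mono (h𝒞.1 C hC).1 hd
          rw [hi] at this
          rcases this with h | h | h
          · exact Or.inl h
          · exact absurd (h ▸ Inc.edge_mem hd) ho
          · exact Or.inr h
        have ha : a ∈ C.incidenceSet χ.vtx := by rw [hi']; simp
        have hb : b ∈ C.incidenceSet χ.vtx := by rw [hi']; simp
        rcases key a ha with h1 | h1
        · rcases key b hb with h2 | h2
          · exact absurd (h1.trans h2.symm) hab
          · exact h2 ▸ Inc.edge_mem hb
        · exact h1 ▸ Inc.edge_mem ha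
      · intro hcC ho
        have := hpair C hC χ he ho
        have hcx : c ∈ C.incidenceSet χ.vtx := by
          rw [mem_incidenceSet, (h𝒞.1 C hC).1.inc_congr hcC, hv, ← mem_incidenceSet, hi]
          simp
        rw [this] at hcx
        rcases hcx with h | h
        · exact hc h
        · exact hc' h
    have e1 := split φ.edge φ.other g
      (fun C hC => two C hC φ rfl g hge hgf hi) φ.inc_edge.edge_mem
    have e2 := split φ.other φ.edge g
      (fun C hC => two C hC φ.swap rfl g hgf hge (by rw [hi]; ext; simp; tauto))
      φ.inc_other.edge_mem
    have e3 := split g φ.edge φ.other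
      (fun C hC => two C hC ψ.swap rfl φ.other hgf.symm φ.edge_ne_other.symm
        (by rw [hi]; ext; simp [ψ]; tauto)) hg.edge_mem
    have c1 : 𝒞.countP (fun C => φ.other ∈ C.edgeSet ∧ φ.edge ∈ C.edgeSet) =
        𝒞.countP (fun C => φ.edge ∈ C.edgeSet ∧ φ.other ∈ C.edgeSet) :=
      Multiset.countP_congr rfl fun C _ => propext and_comm
    have c2 : 𝒞.countP (fun C => g ∈ C.edgeSet ∧ φ.edge ∈ C.edgeSet) =
        𝒞.countP (fun C => φ.edge ∈ C.edgeSet ∧ g ∈ C.edgeSet) :=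
      Multiset.countP_congr rfl fun C _ => propext and_comm
    have c3 : 𝒞.countP (fun C => g ∈ C.edgeSet ∧ φ.other ∈ C.edgeSet) =
        𝒞.countP (fun C => φ.other ∈ C.edgeSet ∧ g ∈ C.edgeSet) :=
      Multiset.countP_congr rfl fun C _ => propext and_comm
    omega
  have huniq : ∀ φ : G.Flag, ∃ C ∈ 𝒞, (φ.edge ∈ C.edgeSet ∧ φ.other ∈ C.edgeSet) ∧
      ∀ C' ∈ 𝒞, φ.edge ∈ C'.edgeSet → φ.other ∈ C'.edgeSet → C' = C := by
    intro φ
    have h1 := hcount φ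
    rw [Multiset.countP_eq_card_filter, Multiset.card_eq_one] at h1
    obtain ⟨C, hC⟩ := h1
    have hm : ∀ C', C' ∈ 𝒞 ∧ (φ.edge ∈ C'.edgeSet ∧ φ.other ∈ C'.edgeSet) ↔ C' = C := by
      intro C'
      rw [← Multiset.mem_singleton, ← hC, Multiset.mem_filter]
    exact ⟨C, ((hm C).2 rfl).1, ((hm C).2 rfl).2, fun C' h h' h'' => (hm C').1 ⟨h, h', h''⟩⟩
  choose K hK𝒞 hK hKu using huniq
  -- `K φ` is the unique member through the corner `φ`; the continuation of `φ` follows this circuit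
  -- across the first edge.
  have hnext : ∀ φ : G.Flag, ∃ ψ : G.Flag, ψ.vtx ≠ φ.vtx ∧ ψ.edge = φ.edge ∧
      ψ.other ∈ (K φ).edgeSet := by
    intro φ
    obtain ⟨y, hy⟩ := φ.inc_edge
    have hyx : y ≠ φ.vtx := fun hyx => hG.not_isLoopAt φ.edge φ.vtx (by rwa [hyx] at hy)
    have i1 : (K φ).Inc φ.edge y := ((h𝒞.1 _ (hK𝒞 φ)).1.inc_congr (hK φ).1).2 hy.inc_right
    obtain ⟨a, b, hab, hi⟩ := hinc _ (hK𝒞 φ) y i1.vertex_mem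
    have ha : (K φ).Inc a y := by rw [← mem_incidenceSet, hi]; simp
    have hb : (K φ).Inc b y := by rw [← mem_incidenceSet, hi]; simp
    rcases eq_or_ne a φ.edge with h1 | h1
    · exact ⟨⟨y, φ.edge, b, hy.inc_right, hb.mono (h𝒞.1 _ (hK𝒞 φ)).1, h1 ▸ hab⟩, hyx, rfl,
        hb.edge_mem⟩
    · exact ⟨⟨y, φ.edge, a, hy.inc_right, ha.mono (h𝒞.1 _ (hK𝒞 φ)).1, h1.symm⟩, hyx, rfl,
        ha.edge_mem⟩
  choose σ hσv hσe hσo using hnext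
  have hKσ : ∀ φ, K (σ φ) = K φ := fun φ =>
    (hKu (σ φ) (K φ) (hK𝒞 φ) (by rw [hσe]; exact (hK φ).1) (hσo φ)).symm
  have hKs : ∀ φ : G.Flag, K φ.swap = K φ := fun φ =>
    (hKu φ.swap (K φ) (hK𝒞 φ) (hK φ).2 (hK φ).1).symm
  have hflag : ∀ φ ψ : G.Flag, K φ = K ψ → φ.vtx = ψ.vtx → ψ = φ ∨ ψ = φ.swap := by
    intro φ ψ hKK hv
    have h1 := hpair _ (hK𝒞 φ) φ (hK φ).1 (hK φ).2
    have h2 := hpair _ (hK𝒞 ψ) ψ (hK ψ).1 (hK ψ).2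
    rw [← hKK, ← hv, h1] at h2
    have m1 : ψ.edge ∈ ({φ.edge, φ.other} : Set β) := by rw [h2]; simp
    have m2 : ψ.other ∈ ({φ.edge, φ.other} : Set β) := by rw [h2]; simp
    have h3 := ψ.edge_ne_other
    rcases m1 with m1 | m1 <;> rcases m2 with m2 | m2
    · exact absurd (m1.trans m2.symm) h3
    · exact Or.inl (Flag.ext hv.symm m1 m2)
    · exact Or.inr (Flag.ext hv.symm m1 m2)
    · exact absurd (m1.trans m2.symm) h3
  have hT : G.IsTransition σ := by
    refine ⟨fun φ => ?_, hσe, hσv⟩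
    have hv : φ.vtx = (σ (σ φ)).vtx := by
      obtain ⟨y, hy⟩ := φ.inc_edge
      have i1 := (σ φ).inc_edge
      have i2 := (σ (σ φ)).inc_edge
      rw [hσe] at i1
      rw [hσe, hσe] at i2
      have h1 := i1.eq_of_isLink_of_ne_left hy (hσv φ)
      rcases i2.eq_or_eq_of_isLink hy with h | h
      · exact h.symm
      · exact absurd (h.trans h1.symm) (hσv (σ φ))
    rcases hflag φ (σ (σ φ)) (by rw [hKσ, hKσ]) hv with h | h
    · exact h
    · have h4 := congrArg Flag.edge h
      rw [hσe, hσe] at h4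
      exact absurd h4 φ.edge_ne_other
  have hKl : ∀ {φ ψ}, Linked σ Flag.swap φ ψ → K φ = K ψ := fun h =>
    Linked.map_eq K hKσ hKs h
  -- `K` is constant on walks, which gives one inclusion; connectedness of the circuit `K φ` gives
  -- the other.
  have hcl : ∀ φ, tracedGraph hT φ = K φ := by
    intro φ
    have hle := (h𝒞.1 _ (hK𝒞 φ)).1
    have hreach : ∀ y ∈ (K φ).vertexSet, ∃ ψ, Linked σ Flag.swap φ ψ ∧ ψ.vtx = y := by
      intro y hy
      have hx : φ.vtx ∈ (K φ).vertexSet := ((hle.inc_congr (hK φ).1).2 φ.inc_edge).vertex_mem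
      have hr := (h𝒞.1 _ (hK𝒞 φ)).2.2.1.2 _ hx _ hy
      clear hy
      induction hr with
      | refl => exact ⟨φ, Linked.refl φ, rfl⟩
      | @tail b c _ hbc ih =>
        obtain ⟨ψ, hψ, rfl⟩ := ih
        obtain ⟨e, he⟩ := hbc
        have hee : e ∈ (K φ).incidenceSet ψ.vtx := he.inc_left
        have hcross : ∀ χ : G.Flag, Linked σ Flag.swap φ χ → χ.vtx = ψ.vtx → χ.edge = e →
            ∃ ψ, Linked σ Flag.swap φ ψ ∧ ψ.vtx = c := by
          intro χ hχ hv he'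
          refine ⟨σ χ, hχ.trans (Linked.fst χ), ?_⟩
          have := hT.isLink χ
          rw [hv, he'] at this
          exact this.right_unique (he.mono hle)
        rw [hKl hψ, hpair _ (hK𝒞 ψ) ψ (hK ψ).1 (hK ψ).2] at hee
        rcases hee with h | h
        · exact hcross ψ hψ rfl h.symm
        · exact hcross ψ.swap (hψ.trans (Linked.snd ψ)) rfl h.symm
    refine Compatible.ext (?_) (?_) (Compatible.of_le_le (tracedGraph_le hT φ) hle)
    · ext y
      refine ⟨?_, hreach y⟩
      rintro ⟨ψ, hψ, rfl⟩
      rw [hKl hψ]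
      exact (((h𝒞.1 _ (hK𝒞 ψ)).1.inc_congr (hK ψ).1).2 ψ.inc_edge).vertex_mem
    · ext e
      rw [mem_edgeSet_tracedGraph]
      constructor
      · rintro ⟨ψ, hψ, rfl⟩
        rw [hKl hψ]
        exact (hK ψ).1
      · intro he
        obtain ⟨x, y, hxy⟩ := exists_isLink_of_mem_edgeSet he
        obtain ⟨ψ, hψ, rfl⟩ := hreach x hxy.left_mem
        have hee : e ∈ (K φ).incidenceSet ψ.vtx := hxy.inc_left
        rw [hKl hψ, hpair _ (hK𝒞 ψ) ψ (hK ψ).1 (hK ψ).2] at hee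
        rcases hee with h | h
        · exact ⟨ψ, hψ, h.symm⟩
        · exact ⟨ψ.swap, hψ.trans (Linked.snd ψ), h.symm⟩
  have hex : ∀ C ∈ 𝒞, ∃ φ, K φ = C := by
    intro C hC
    obtain ⟨x, hx⟩ := (h𝒞.1 C hC).2.2.1.1
    obtain ⟨a, b, hab, hi⟩ := hinc C hC x hx
    have ha : C.Inc a x := by rw [← mem_incidenceSet, hi]; simp
    have hb : C.Inc b x := by rw [← mem_incidenceSet, hi]; simp
    have hle := (h𝒞.1 C hC).1
    exact ⟨⟨x, a, b, ha.mono hle, hb.mono hle, hab⟩, (hKu _ C hC ha.edge_mem hb.edge_mem).symm⟩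
  -- A repeated circuit would use each of its corners twice, against `hcount`. So `𝒞` agrees with
  -- the duplicate-free `tracedCover` as soon as the members agree.
  have hnodup : 𝒞.Nodup := by
    rw [Multiset.nodup_iff_count_le_one]
    intro C
    by_cases hC : C ∈ 𝒞
    · obtain ⟨φ, rfl⟩ := hex C hC
      rw [← hcount φ, Multiset.count, Multiset.countP_eq_card_filter,
        Multiset.countP_eq_card_filter]
      refine Multiset.card_le_card (Multiset.monotone_filter_right _ ?_)
      rintro C' rfl
      exact hK φ
    · rw [Multiset.count_eq_zero_of_notMem hC]
      exact Nat.zero_le 1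
  refine ⟨σ, hT, fun φ ψ hl hv => hflag φ ψ (hKl hl) hv, ?_⟩
  refine (Multiset.Nodup.ext (Finset.nodup _) hnodup).2 fun C => ?_
  rw [Finset.mem_val, mem_tracedCover]
  constructor
  · rintro ⟨φ, rfl⟩
    rw [hcl]
    exact hK𝒞 φ
  · intro hC
    obtain ⟨φ, rfl⟩ := hex C hC
    exact ⟨φ, hcl φ⟩

/-- Circuit double covers of a finite loopless cubic graph correspond to the transition systems
whose closed walks are circuits. -/
theorem IsLooplessCubic.numCircuitDoubleCovers_eq (hV : G.vertexSet.Finite)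
    (hE : G.edgeSet.Finite) (hG : G.IsLooplessCubic) :
    G.numCircuitDoubleCovers = G.circuitTransitions.ncard := by
  have := Flag.finite hV hE
  have := Fintype.ofFinite G.Flag
  symm
  refine Set.ncard_congr (fun σ hσ => (tracedCover hσ.1).val) ?_ ?_ ?_
  · exact fun σ hσ => isCircuitDoubleCover_tracedCover hV hG hσ.1 hσ.2
  · exact fun σ σ' hσ hσ' h => hσ.1.eq_of_tracedCover_eq hσ'.1 hσ'.2 (Finset.val_inj.1 h)
  · intro 𝒞 h𝒞
    obtain ⟨σ, h, hs, heq⟩ := IsCircuitDoubleCover.exists_transition hG h𝒞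
    exact ⟨σ, ⟨h, hs⟩, heq⟩

/-- A graph with a vertex at which exactly one edge is not a loop has no circuit double cover. -/
theorem numCircuitDoubleCovers_eq_zero_of_loops {f : β} {x : α} (hf : G.IsNonloopAt f x)
    (hi : ∀ e, G.Inc e x → e = f ∨ G.IsLoopAt e x) : G.numCircuitDoubleCovers = 0 := by
  classical
  rw [numCircuitDoubleCovers]
  have : {𝒞 : Multiset (Graph α β) | G.IsCircuitDoubleCover 𝒞} = ∅ := by
    rw [Set.eq_empty_iff_forall_notMem]
    intro 𝒞 h𝒞
    have hpos : 0 < 𝒞.countP (fun C => f ∈ C.edgeSet) := by rw [h𝒞.2 f hf.edge_mem]; norm_num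
    obtain ⟨C, hC, hfC⟩ := Multiset.countP_pos.1 hpos
    have hle := (h𝒞.1 C hC).1
    have hfx : C.Inc f x := (hle.inc_congr hfC).2 hf.inc
    have hd := (h𝒞.1 C hC).2.2.2 x hfx.vertex_mem
    have hinc : C.incidenceSet x = insert f (C.loopSet x) := by
      ext e
      constructor
      · intro he
        rcases hi e (Inc.mono hle he) with h | h
        · exact Or.inl h
        · exact Or.inr ((hle.isLoopAt_congr (Inc.edge_mem he)).2 h)
      · rintro (rfl | h)
        · exact hfx
        · exact IsLoopAt.inc h
    have hfl : f ∉ C.loopSet x := fun h => hf.not_isLoopAt x (IsLoopAt.mono hle h)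
    -- A circuit through `f` would have the odd degree `1 + 2L` at `x`, where `L` is the number of
    -- its loops there.
    rw [degree, hinc, Set.encard_insert_of_notMem hfl] at hd
    generalize (C.loopSet x).encard = L at hd
    cases L with
    | top => exact absurd hd (by simp)
    | coe n =>
      norm_cast at hd
      omega
  rw [this, Set.ncard_empty]

end

end Graph

/-! ### Fixed points in the orbits of two involutions. -/

/-- Two involutions `σ` and `τ` of a finite type, `τ` without fixed points: a class of linked
points that contains a fixed point of `σ` contains exactly one other. -/
theorem exists_unique_other_fixedPoint {X : Type*} [Finite X] {σ τ : X → X}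
    (hσ : ∀ x, σ (σ x) = x) (hτ : ∀ x, τ (τ x) = x) (hfp : ∀ x, τ x ≠ x) {f : X} (hf : σ f = f) :
    ∃ g, g ≠ f ∧ σ g = g ∧ Linked σ τ f g ∧ ∀ h, Linked σ τ f h → σ h = h → h = f ∨ h = g := by
  -- Dihedral action: the class of `f` is the cycle of the rotation `ρ` through `f`, of length `m`.
  -- On exponents, `σ` acts as `n ↦ -n` and `τ` as `n ↦ -n - 1` modulo `m`. If `m = 2k`, then `σ`
  -- fixes exactly the exponents `0` and `k`; if `m = 2k + 1`, then `τ` would fix the exponent `k`.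
  set ρ : X → X := fun x => σ (τ x) with hρ
  have hinj : Function.Injective ρ := fun x y h => by
    have := congrArg (fun z => τ (σ z)) h
    simpa [hρ, hσ, hτ] using this
  have hinjn : ∀ n, Function.Injective ρ^[n] := fun n => hinj.iterate n
  have hper : f ∈ Function.periodicPts ρ := hinj.mem_periodicPts f
  set m := Function.minimalPeriod ρ f with hm
  have hmpos : 0 < m := Function.minimalPeriod_pos_of_mem_periodicPts hper
  have hmf : ρ^[m] f = f := Function.iterate_minimalPeriod
  have hrefl : ∀ n x, ρ^[n] (σ (ρ^[n] x)) = σ x := by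
    intro n
    induction n with
    | zero => intro x; rfl
    | succ n ih =>
      intro x
      rw [Function.iterate_succ_apply, Function.iterate_succ_apply' ρ n x]
      have : ρ (σ (ρ (ρ^[n] x))) = σ (ρ^[n] x) := by simp [hρ, hσ, hτ]
      rw [this, ih]
  have hdvd : ∀ n, ρ^[n] f = f ↔ m ∣ n := fun n => by
    rw [hm, ← Function.isPeriodicPt_iff_minimalPeriod_dvd]
    rfl
  have hσS : ∀ n, ∃ k, σ (ρ^[n] f) = ρ^[k] f := by
    intro n
    -- A natural number congruent to `-n` modulo `m`.
    refine ⟨m * n - n, hinjn n ?_⟩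
    rw [hrefl, hf, ← Function.iterate_add_apply, eq_comm, hdvd]
    have : n ≤ m * n := Nat.le_mul_of_pos_left n hmpos
    rw [Nat.add_sub_cancel' this]
    exact dvd_mul_right m n
  have hτσ : ∀ x, τ x = σ (ρ x) := fun x => by simp [hρ, hσ]
  have hS : ∀ h, Linked σ τ f h → ∃ n, h = ρ^[n] f := by
    intro h hl
    have closedσ : ∀ x, (∃ n, x = ρ^[n] f) → ∃ n, σ x = ρ^[n] f := by
      rintro _ ⟨n, rfl⟩
      exact hσS n
    have closedτ : ∀ x, (∃ n, x = ρ^[n] f) → ∃ n, τ x = ρ^[n] f := by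
      rintro _ ⟨n, rfl⟩
      rw [hτσ, ← Function.iterate_succ_apply' ρ n f]
      exact hσS (n + 1)
    refine (Linked.rel_of_equivalence (r := fun x y => (∃ n, x = ρ^[n] f) ↔ ∃ n, y = ρ^[n] f)
      ⟨fun _ => Iff.rfl, Iff.symm, Iff.trans⟩ (fun x => ⟨closedσ x, fun hx => ?_⟩)
      (fun x => ⟨closedτ x, fun hx => ?_⟩) hl).1 ⟨0, rfl⟩
    · simpa [hσ] using closedσ _ hx
    · simpa [hτ] using closedτ _ hx
  have hlink : ∀ n, Linked σ τ f (ρ^[n] f) := by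
    intro n
    induction n with
    | zero => exact Linked.refl f
    | succ n ih =>
      rw [Function.iterate_succ_apply']
      exact ih.trans ((Linked.snd _).trans (Linked.fst _))
  obtain ⟨k, hk | hk⟩ := Nat.even_or_odd' m
  · refine ⟨ρ^[k] f, ?_, ?_, hlink k, ?_⟩
    · rw [Ne, hdvd]
      exact fun hd => absurd (Nat.le_of_dvd (by omega) hd) (by omega)
    · apply hinjn k
      rw [hrefl, hf, ← Function.iterate_add_apply, eq_comm, hdvd, hk, two_mul]
    · intro h hl hfix
      obtain ⟨n, rfl⟩ := hS h hl
      have h1 := hrefl n f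
      rw [hfix, hf, ← Function.iterate_add_apply, hdvd] at h1
      have h2 : k ∣ n := by
        rw [hk, ← two_mul] at h1
        exact Nat.dvd_of_mul_dvd_mul_left two_pos h1
      obtain ⟨c, rfl⟩ := h2
      obtain ⟨d, rfl | rfl⟩ := Nat.even_or_odd' c
      · left
        rw [hdvd, hk]
        exact ⟨d, by ring⟩
      · right
        rw [show k * (2 * d + 1) = k + m * d by rw [hk]; ring, Function.iterate_add_apply,
          (hdvd (m * d)).2 (dvd_mul_right m d)]
  · exfalso
    refine hfp (ρ^[k] f) ?_
    rw [hτσ, ← Function.iterate_succ_apply' ρ k f]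
    apply hinjn (k + 1)
    rw [hrefl, hf, ← Function.iterate_add_apply, eq_comm, hdvd, hk]
    exact ⟨1, by omega⟩

/-! ### Matchings of the ten spoke sides -/

/-- All ways to split a list into pairs satisfying `r`, with `n` bounding the number of pairs. -/
def matchings {T : Type*} [DecidableEq T] (r : T → T → Bool) : ℕ → List T → List (List (T × T))
  | 0, _ => [[]]
  | _ + 1, [] => [[]]
  | n + 1, x :: xs =>
    (xs.filter (r x)).flatMap fun y => (matchings r n (xs.erase y)).map fun m => (x, y) :: m

/-- Induction on the list: the head is paired with its partner and both are removed. A pair is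
listed only in the order in which its first element is met, hence the disjunction. -/
theorem exists_mem_matchings {T : Type*} [DecidableEq T] (r : T → T → Bool) (p : T → T)
    (hp : ∀ x, p (p x) = x) (n : ℕ) (l : List T) (hn : l.Nodup) (hlen : l.length ≤ 2 * n)
    (hl : ∀ x ∈ l, p x ∈ l ∧ p x ≠ x ∧ r x (p x) = true) :
    ∃ m ∈ matchings r n l, (∀ xy ∈ m, p xy.1 = xy.2) ∧
      ∀ x ∈ l, (x, p x) ∈ m ∨ (p x, x) ∈ m := by
  induction n generalizing l with
  | zero =>
    obtain rfl : l = [] := List.length_eq_zero_iff.1 (by omega)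
    exact ⟨[], by simp [matchings], by simp, by simp⟩
  | succ n ih =>
    cases l with
    | nil => exact ⟨[], by simp [matchings], by simp, by simp⟩
    | cons x xs =>
      obtain ⟨hpx, hpx', hr⟩ := hl x List.mem_cons_self
      have hpxs : p x ∈ xs := (List.mem_cons.1 hpx).resolve_left hpx'
      have hnx := List.nodup_cons.1 hn
      obtain ⟨m, hm, h1, h2⟩ := ih (xs.erase (p x)) (hnx.2.erase _) (by
          rw [List.length_erase_of_mem hpxs]
          simp only [List.length_cons] at hlen
          omega) (by
          intro y hy
          have hy' := (hnx.2.mem_erase_iff).1 hy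
          obtain ⟨a, b, c⟩ := hl y (List.mem_cons_of_mem x hy'.2)
          refine ⟨(hnx.2.mem_erase_iff).2 ⟨fun h => ?_, ?_⟩, b, c⟩
          · have : y = x := by rw [← hp y, h, hp]
            exact hnx.1 (this ▸ hy'.2)
          · refine (List.mem_cons.1 a).resolve_left fun h => ?_
            exact hy'.1 (by rw [← h, hp]))
      refine ⟨(x, p x) :: m, ?_, ?_, ?_⟩
      · simp only [matchings, List.mem_flatMap, List.mem_filter, List.mem_map]
        exact ⟨p x, ⟨hpxs, hr⟩, m, hm, rfl⟩
      · intro xy hxy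
        rcases List.mem_cons.1 hxy with rfl | hxy
        · rfl
        · exact h1 xy hxy
      · intro y hy
        rcases List.mem_cons.1 hy with rfl | hy
        · exact Or.inl List.mem_cons_self
        · by_cases hyp : y = p x
          · right
            rw [hyp, hp]
            exact List.mem_cons_self
          · rcases h2 y ((hnx.2.mem_erase_iff).2 ⟨hyp, hy⟩) with h | h
            · exact Or.inl (List.mem_cons_of_mem _ h)
            · exact Or.inr (List.mem_cons_of_mem _ h)

/-! ### Finite data: path patterns, replacements and transition codes. -/

/-- The two sides of the five spokes. -/
abbrev Side := Fin 5 × Bool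

/-- All sides of spokes. -/
def sides : List Side :=
  [(0, false), (0, true), (1, false), (1, true), (2, false), (2, true), (3, false), (3, true),
    (4, false), (4, true)]

theorem nodup_sides : sides.Nodup := by decide

theorem mem_sides : ∀ s : Side, s ∈ sides := by decide

/-- A labelling of the sides by the five paths that end there, written as a list. -/
def pathAt (l : List ℕ) (s : Side) : ℕ := l.getD (2 * s.1.val + s.2.toNat) 0

/-- Exchange the two sides of the spokes `i` with `n.testBit i`. -/
def flipSide (n : ℕ) (s : Side) : Side := (s.1, s.2 ^^ n.testBit s.1.val)

/-- The name of the pair of paths `a`, `b`. -/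
def pairCode (a b : ℕ) : ℕ := if a < b then 5 * a + b else 5 * b + a

/-- The names of the pairs of paths. -/
def pairCodes : List ℕ := [1, 2, 3, 4, 7, 8, 9, 13, 14, 19]

/-- The pairs of paths that have no spoke in common. -/
def spokeDisjointPairs (l : List ℕ) : List ℕ :=
  pairCodes.filter fun c =>
    ([0, 1, 2, 3, 4] : List (Fin 5)).all fun i => c != pairCode (pathAt l (i, false)) (pathAt l (i, true))

/-- The ways in which five paths can join the sides of the spokes, up to exchanging the two sides
of spokes, each with transition codes of the 5-cycle that are compatible with them. -/
def pathPatterns : List (List ℕ × List ℕ) := [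
  -- The twelve Hamiltonian cycles on the five spokes, with consecutive paths numbered cyclically.
  -- The ten bits of a code stand for the continuations on the spokes (bits 0 to 4) and on the rim
  -- edges (bits 5 to 9). Not all admissible codes are listed, only enough of them for the
  -- inequality.
  ([4, 0, 0, 1, 1, 2, 2, 3, 3, 4], [0, 255, 479, 639, 831, 927]),
  ([4, 0, 0, 1, 1, 2, 3, 4, 2, 3], [24, 191, 607, 896]),
  ([4, 0, 0, 1, 2, 3, 1, 2, 3, 4], [12, 319, 448, 607]),
  ([4, 0, 0, 1, 3, 4, 1, 2, 2, 3], [511, 664, 704, 924]),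
  ([4, 0, 0, 1, 2, 3, 3, 4, 1, 2], [579, 627, 832, 959]),
  ([4, 0, 0, 1, 3, 4, 2, 3, 1, 2], [28, 320, 639, 640]),
  ([4, 0, 1, 2, 0, 1, 2, 3, 3, 4], [6, 224, 319, 671]),
  ([4, 0, 1, 2, 0, 1, 3, 4, 2, 3], [647, 703, 864, 902]),
  ([4, 0, 2, 3, 0, 1, 1, 2, 3, 4], [352, 462, 767, 819]),
  ([4, 0, 2, 3, 0, 1, 3, 4, 1, 2], [882, 937, 980, 992]),
  ([4, 0, 1, 2, 2, 3, 0, 1, 3, 4], [305, 416, 825, 991]),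
  ([4, 0, 2, 3, 1, 2, 0, 1, 3, 4], [14, 160, 320, 831]),
  -- The ten patterns in which the paths 0 and 1 join the same two spokes and the paths 2, 3, 4 form
  -- a triangle on the others.
  ([0, 1, 0, 1, 4, 2, 2, 3, 3, 4], [478, 577, 578, 925, 926]),
  ([0, 1, 4, 2, 0, 1, 2, 3, 3, 4], [379, 382, 737, 740, 920, 925]),
  ([0, 1, 4, 2, 2, 3, 0, 1, 3, 4], [230, 239, 855, 862, 929, 936]),
  ([0, 1, 4, 2, 2, 3, 3, 4, 0, 1], [254, 289, 304, 463, 478]),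
  ([4, 2, 0, 1, 0, 1, 2, 3, 3, 4], [162, 164, 829, 923, 925]),
  ([4, 2, 0, 1, 2, 3, 0, 1, 3, 4], [482, 488, 727, 733, 817, 827]),
  ([4, 2, 0, 1, 2, 3, 3, 4, 0, 1], [460, 478, 687, 701, 866, 880]),
  ([4, 2, 2, 3, 0, 1, 0, 1, 3, 4], [324, 328, 635, 823, 827]),
  ([4, 2, 2, 3, 0, 1, 3, 4, 0, 1], [431, 443, 611, 631, 964, 976]),
  ([4, 2, 2, 3, 3, 4, 0, 1, 0, 1], [247, 623, 631, 648, 656])]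

/-- Sides of spokes that are joined when a vertex and an edge joining the spokes `a`, `b` replace
the 5-cycle lie on different spokes, and both or none of them lies on `a` or `b`. -/
def replacementRel (a b : Fin 5) (s s' : Side) : Bool :=
  s.1 != s'.1 && ((s.1 == a || s.1 == b) == (s'.1 == a || s'.1 == b))

/-- The possible matchings of sides by a vertex and an edge joining the spokes `a`, `b`. -/
def replacementMatchings (a b : Fin 5) : List (List (Side × Side)) :=
  matchings (replacementRel a b) 5 sides

/-- The ordered pairs of different paths that a matching of the sides joins. -/
def joinedPaths (l : List ℕ) (m : List (Side × Side)) : List (ℕ × ℕ) :=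
  (m.flatMap fun s => [(pathAt l s.1, pathAt l s.2), (pathAt l s.2, pathAt l s.1)]).filter
    fun p => p.1 != p.2

/-- The pairs of paths that lie on the same closed walk because of at most two joins. -/
def joinedPairs (l : List ℕ) (m : List (Side × Side)) : List ℕ :=
  (joinedPaths l m).flatMap fun p => pairCode p.1 p.2 ::
    ((joinedPaths l m).filter fun p' => p.2 == p'.1 && p.1 != p'.2).map
      fun p' => pairCode p.1 p'.2

/-- The matchings that join only pairs of paths without common spoke. -/
def admissibleMatchings (l : List ℕ) (a b : Fin 5) : List (List (Side × Side)) :=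
  (replacementMatchings a b).filter fun m =>
    (joinedPairs l m).all fun c => (spokeDisjointPairs l).contains c

/-- The number of matchings that join only pairs of paths listed in `D`. -/
def replacementCount (l D : List ℕ) (a b : Fin 5) : ℕ :=
  ((admissibleMatchings l a b).filter fun m =>
    (joinedPairs l m).all fun c => D.contains c).length

/-- The corner of the 5-cycle at vertex `i`: `0` and `1` lie between the spoke and the rim edges
`i - 1` and `i`, and `2` lies between the rim edges. The numbers below 5 name paths. -/
def cornerNode (i : Fin 5) (k : ℕ) : ℕ := 5 + 3 * i.val + k

/-- The corner that the transition code `n` attaches to a side of a spoke. -/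
def spokeCorner (n : ℕ) (s : Side) : ℕ := cornerNode s.1 (s.2 ^^ n.testBit s.1.val).toNat

/-- The two corners at the first end of the rim edge `i`. -/
def rimCorner (s : Side) : ℕ := cornerNode s.1 (1 + s.2.toNat)

/-- The corners at the second end of the rim edge `i` that the transition code `n` attaches to
the corners at its first end. -/
def rimCornerNext (n : ℕ) (s : Side) : ℕ :=
  cornerNode (s.1 + 1) (2 * (s.2 ^^ n.testBit (5 + s.1.val)).toNat)

/-- Merge the labels at two places of a list. -/
def mergeLabels (lab : List ℕ) (xy : ℕ × ℕ) : List ℕ :=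
  lab.map fun z => if z == lab.getD xy.1 0 then lab.getD xy.2 0 else z

/-- Labels of the closed walks through paths and corners of the 5-cycle. -/
def walkLabels (l : List ℕ) (n : ℕ) : List ℕ :=
  (sides.flatMap fun s => [(pathAt l s, spokeCorner n s), (rimCorner s, rimCornerNext n s)]).foldl
    mergeLabels (List.range 20)

/-- The labels are constant on closed walks and distinguish the corners at each vertex. -/
def isWalkLabelling (l : List ℕ) (n : ℕ) (lab : List ℕ) : Bool :=
  (sides.all fun s => lab.getD (pathAt l s) 0 == lab.getD (spokeCorner n s) 0 &&
    lab.getD (rimCorner s) 0 == lab.getD (rimCornerNext n s) 0) &&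
  ([0, 1, 2, 3, 4] : List (Fin 5)).all fun i =>
    lab.getD (cornerNode i 0) 0 != lab.getD (cornerNode i 1) 0 &&
    lab.getD (cornerNode i 0) 0 != lab.getD (cornerNode i 2) 0 &&
    lab.getD (cornerNode i 1) 0 != lab.getD (cornerNode i 2) 0

/-- The pairs of different paths with the same label. -/
def mergedPairs (lab : List ℕ) : List ℕ :=
  ([(0, 1), (0, 2), (0, 3), (0, 4), (1, 2), (1, 3), (1, 4), (2, 3), (2, 4), (3, 4)] :
    List (ℕ × ℕ)).filterMap fun p =>
      if lab.getD p.1 0 == lab.getD p.2 0 then some (pairCode p.1 p.2) else none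

/-- The number of transition codes in `N` that merge only pairs of paths listed in `D`. -/
def pentagonCount (l N D : List ℕ) : ℕ :=
  (N.filter fun n => (mergedPairs (walkLabels l n)).all fun c => D.contains c).length

/-! ### The finite verifications. -/

/-- Exchanging sides of spokes acts transitively on the matchings that induce a given multigraph on
the spokes, so one pattern per multigraph suffices. The first conjunct follows from the second; it
singles out the pattern before the 32 exchanges are tried. -/
theorem matchings_sides_normalForm :
    ((matchings (fun s s' => s.1 != s'.1) 5 sides).all fun m => pathPatterns.any fun lN =>
      (m.all fun s => (pathAt lN.1 (s.1.1, false) == pathAt lN.1 (s.2.1, false)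
        || pathAt lN.1 (s.1.1, false) == pathAt lN.1 (s.2.1, true)
        || pathAt lN.1 (s.1.1, true) == pathAt lN.1 (s.2.1, false)
        || pathAt lN.1 (s.1.1, true) == pathAt lN.1 (s.2.1, true))) &&
      (List.range 32).any fun f =>
        m.all fun s => pathAt lN.1 (flipSide f s.1) == pathAt lN.1 (flipSide f s.2)) = true := by
  decide +kernel

/-- Only these properties of the labels are used later: an invariant of walks that separates the
three corners of a vertex proves the walks simple there, however it was computed. -/
theorem isWalkLabelling_walkLabels :
    (pathPatterns.all fun lN => lN.2.all fun n =>
      n < 1024 && isWalkLabelling lN.1 n (walkLabels lN.1 n)) = true := by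
  decide +kernel

/-- The heart of the proof. A Hamiltonian pattern has five pairs of paths without common spoke and
the other patterns have six, so there are `12 * 2 ^ 5 + 10 * 2 ^ 6` cases. Omitting walks with more
than two joins can only enlarge the left side, and omitting codes can only shrink the right side, so
both omissions are harmless. -/
theorem weighted_replacementCount_le :
    (pathPatterns.all fun lN => (spokeDisjointPairs lN.1).sublists.all fun D =>
      2 * (replacementCount lN.1 D 0 1 + replacementCount lN.1 D 1 2 + replacementCount lN.1 D 2 3
        + replacementCount lN.1 D 3 4 + replacementCount lN.1 D 4 0)
      + (replacementCount lN.1 D 0 2 + replacementCount lN.1 D 1 3 + replacementCount lN.1 D 2 4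
        + replacementCount lN.1 D 3 0 + replacementCount lN.1 D 4 1)
      ≤ 4 * pentagonCount lN.1 lN.2 D) = true := by
  decide +kernel

/-! ### Outer transition systems -/

theorem flipSide_flipSide (n : ℕ) (s : Side) : flipSide n (flipSide n s) = s := by
  simp [flipSide]

theorem pathPatterns_balanced :
    (pathPatterns.all fun lN => sides.all fun s => pathAt lN.1 s < 5 && sides.all fun s' =>
      s == s' || pathAt lN.1 s != pathAt lN.1 s' || sides.all fun s'' =>
        s == s'' || s' == s'' || pathAt lN.1 s != pathAt lN.1 s'') = true := by
  decide +kernel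

theorem pathAt_lt {lN : List ℕ × List ℕ} (h : lN ∈ pathPatterns) (s : Side) :
    pathAt lN.1 s < 5 := by
  have h1 := List.all_eq_true.1 (List.all_eq_true.1 pathPatterns_balanced lN h) s (mem_sides s)
  simp only [Bool.and_eq_true, decide_eq_true_eq] at h1
  exact h1.1

/-- A path has only two ends. This makes equality of path names equivalent to being linked, not
merely a consequence of it. -/
theorem eq_or_eq_of_pathAt_eq {lN : List ℕ × List ℕ} (h : lN ∈ pathPatterns) {s s' s'' : Side}
    (hne : s ≠ s') (h1 : pathAt lN.1 s = pathAt lN.1 s') (h2 : pathAt lN.1 s = pathAt lN.1 s'') :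
    s'' = s ∨ s'' = s' := by
  have h3 := List.all_eq_true.1 (List.all_eq_true.1 pathPatterns_balanced lN h) s (mem_sides s)
  simp only [Bool.and_eq_true] at h3
  have h4 := List.all_eq_true.1 h3.2 s' (mem_sides s')
  simp only [Bool.or_eq_true, beq_iff_eq, bne_iff_ne, hne, false_or, h1, ne_eq, not_true] at h4
  have h5 := List.all_eq_true.1 h4 s'' (mem_sides s'')
  simp only [Bool.or_eq_true, beq_iff_eq, bne_iff_ne] at h5
  rcases h5 with (h5 | h5) | h5
  · exact Or.inl h5.symm
  · exact Or.inr h5.symm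
  · exact absurd (h1.symm.trans h2) h5

theorem pairCode_comm (a b : ℕ) : pairCode a b = pairCode b a := by
  unfold pairCode
  split_ifs <;> omega

theorem pairCode_inj {a b c d : ℕ} (ha : a < 5) (hb : b < 5) (hc : c < 5) (hd : d < 5)
    (h : pairCode a b = pairCode c d) : (a = c ∧ b = d) ∨ (a = d ∧ b = c) := by
  unfold pairCode at h
  split_ifs at h <;> omega

theorem pairCode_mem_pairCodes {a b : ℕ} (ha : a < 5) (hb : b < 5) (hne : a ≠ b) :
    pairCode a b ∈ pairCodes := by
  interval_cases a <;> interval_cases b <;> first | exact absurd rfl hne | decide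

/-- A transition system on flags with five loose spokes: the flags `t s` are its fixed points,
and the walks traced by it visit each vertex at most once. -/
structure OuterSystem {X α : Type*} (τ : X → X) (vt : X → α) (t : Side → X) (σ : X → X) : Prop where
  swap_swap : ∀ x, τ (τ x) = x
  swap_ne : ∀ x, τ x ≠ x
  side_injective : Function.Injective t
  vtx_side : ∀ i, vt (t (i, false)) = vt (t (i, true))
  side_ne_swap : ∀ i, t (i, true) ≠ τ (t (i, false))
  involutive : ∀ x, σ (σ x) = x
  fixed_iff : ∀ x, σ x = x ↔ ∃ s, t s = x
  simple : ∀ x y, Linked σ τ x y → vt x = vt y → y = x ∨ y = τ x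

/-- Two walks meet if they pass through different corners at the same vertex. -/
def Meets {X α : Type*} (τ : X → X) (vt : X → α) (σ : X → X) (x y : X) : Prop :=
  ∃ x' y', Linked σ τ x x' ∧ Linked σ τ y y' ∧ vt x' = vt y' ∧ y' ≠ x' ∧ y' ≠ τ x'

namespace OuterSystem

variable {X α : Type*} [Finite X] {τ : X → X} {vt : X → α} {t : Side → X} {σ : X → X}

/-- The loose flags are the fixed points of `σ`, so each class containing one contains exactly two.
They cannot be the two sides of one spoke: these are different corners at the same vertex, which a
simple walk does not both visit. -/
theorem exists_partner (h : OuterSystem τ vt t σ) :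
    ∃ p : Side → Side, (∀ s, p (p s) = s) ∧ (∀ s, (p s).1 ≠ s.1) ∧
      ∀ s s', Linked σ τ (t s) (t s') ↔ s' = s ∨ s' = p s := by
  have key : ∀ s, ∃ s', s' ≠ s ∧ Linked σ τ (t s) (t s') ∧
      ∀ s'', Linked σ τ (t s) (t s'') → s'' = s ∨ s'' = s' := by
    intro s
    obtain ⟨g, hg, hfix, hl, hu⟩ := exists_unique_other_fixedPoint h.involutive h.swap_swap
      h.swap_ne ((h.fixed_iff (t s)).2 ⟨s, rfl⟩)
    obtain ⟨s', rfl⟩ := (h.fixed_iff g).1 hfix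
    refine ⟨s', fun hs => hg (by rw [hs]), hl, fun s'' hs'' => ?_⟩
    rcases hu _ hs'' ((h.fixed_iff _).2 ⟨s'', rfl⟩) with h1 | h1
    · exact Or.inl (h.side_injective h1)
    · exact Or.inr (h.side_injective h1)
  choose p hp hpl hpu using key
  refine ⟨p, fun s => ?_, fun s hs => ?_, fun s s' => ⟨hpu s s', ?_⟩⟩
  · rcases hpu (p s) s (hpl s).symm with h1 | h1
    · exact absurd h1.symm (hp s)
    · exact h1.symm
  · have hb : (p s).2 = !s.2 := by
      cases h1 : (p s).2 <;> cases h2 : s.2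
      · exact absurd (Prod.ext hs (h1.trans h2.symm)) (hp s)
      · rfl
      · rfl
      · exact absurd (Prod.ext hs (h1.trans h2.symm)) (hp s)
    have hl := hpl s
    obtain ⟨i, k⟩ := s
    have hpe : p (i, k) = (i, !k) := Prod.ext hs hb
    rw [hpe] at hl
    have hl' : Linked σ τ (t (i, false)) (t (i, true)) := by
      cases k
      · exact hl
      · exact hl.symm
    rcases h.simple _ _ hl' (h.vtx_side i) with h1 | h1
    · exact absurd (h.side_injective h1) (by simp)
    · exact h.side_ne_swap i h1
  · rintro (rfl | rfl)
    · exact Linked.refl _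
    · exact hpl s

theorem exists_normalForm (h : OuterSystem τ vt t σ) :
    ∃ f, ∃ lN ∈ pathPatterns, ∀ s s', Linked σ τ (t (flipSide f s)) (t (flipSide f s')) ↔
      pathAt lN.1 s = pathAt lN.1 s' := by
  obtain ⟨p, hp, hp1, hpl⟩ := h.exists_partner
  obtain ⟨m, hm, -, hm2⟩ := exists_mem_matchings (fun s s' : Side => s.1 != s'.1) p hp 5 sides
    nodup_sides (by decide) fun s _ => ⟨mem_sides _, fun hs => hp1 s (by rw [hs]), by
      simpa using (hp1 s).symm⟩
  have h1 := List.all_eq_true.1 matchings_sides_normalForm m hm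
  obtain ⟨lN, hlN, h2⟩ := List.any_eq_true.1 h1
  rw [Bool.and_eq_true] at h2
  obtain ⟨f, -, h3⟩ := List.any_eq_true.1 h2.2
  have hpe : ∀ s, pathAt lN.1 (flipSide f s) = pathAt lN.1 (flipSide f (p s)) := by
    intro s
    rcases hm2 s (mem_sides s) with h4 | h4
    · exact beq_iff_eq.1 (List.all_eq_true.1 h3 _ h4)
    · exact (beq_iff_eq.1 (List.all_eq_true.1 h3 _ h4)).symm
  refine ⟨f, lN, hlN, fun s s' => ?_⟩
  rw [hpl]
  constructor
  · rintro (h4 | h4)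
    · rw [← flipSide_flipSide f s', h4, flipSide_flipSide]
    · have := hpe (flipSide f s)
      rwa [flipSide_flipSide, ← h4, flipSide_flipSide] at this
  · intro h4
    have h5 := hpe (flipSide f s)
    rw [flipSide_flipSide] at h5
    have hne : s ≠ flipSide f (p (flipSide f s)) := by
      intro h6
      refine hp1 (flipSide f s) ?_
      have := congrArg (flipSide f) h6
      rw [flipSide_flipSide] at this
      rw [← this]
    rcases eq_or_eq_of_pathAt_eq hlN hne h5 h4 with h6 | h6
    · exact Or.inl (by rw [h6])
    · exact Or.inr (by rw [h6, flipSide_flipSide])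

omit [Finite X] in
theorem meets_congr {x x' y y' : X} (hx : Linked σ τ x x') (hy : Linked σ τ y y')
    (h : Meets τ vt σ x y) : Meets τ vt σ x' y' := by
  obtain ⟨a, b, ha, hb, hab⟩ := h
  exact ⟨a, b, hx.symm.trans ha, hy.symm.trans hb, hab⟩

omit [Finite X] in
theorem meets_symm (h : OuterSystem τ vt t σ) {x y : X} (hm : Meets τ vt σ x y) :
    Meets τ vt σ y x := by
  obtain ⟨a, b, ha, hb, hab, h1, h2⟩ := hm
  exact ⟨b, a, hb, ha, hab.symm, h1.symm, fun h3 => h2 (by rw [h3, h.swap_swap])⟩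

omit [Finite X] in
/-- The pairs of paths of an outer system that do not meet. -/
theorem exists_disjointPairs (h : OuterSystem τ vt t σ) {f : ℕ} {lN : List ℕ × List ℕ}
    (hlN : lN ∈ pathPatterns) (hf : ∀ s s', Linked σ τ (t (flipSide f s)) (t (flipSide f s')) ↔
      pathAt lN.1 s = pathAt lN.1 s') :
    ∃ D ∈ (spokeDisjointPairs lN.1).sublists, ∀ s s', pathAt lN.1 s ≠ pathAt lN.1 s' →
      (pairCode (pathAt lN.1 s) (pathAt lN.1 s') ∈ D ↔
        ¬ Meets τ vt σ (t (flipSide f s)) (t (flipSide f s'))) := by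
  classical
  have meets_of_code : ∀ s s' r r', pairCode (pathAt lN.1 s) (pathAt lN.1 s') =
      pairCode (pathAt lN.1 r) (pathAt lN.1 r') →
      Meets τ vt σ (t (flipSide f r)) (t (flipSide f r')) →
      Meets τ vt σ (t (flipSide f s)) (t (flipSide f s')) := by
    intro s s' r r' hc hm
    rcases pairCode_inj (pathAt_lt hlN s) (pathAt_lt hlN s') (pathAt_lt hlN r) (pathAt_lt hlN r') hc
      with ⟨h1, h2⟩ | ⟨h1, h2⟩
    · exact meets_congr ((hf _ _).2 h1.symm) ((hf _ _).2 h2.symm) hm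
    · exact meets_congr ((hf _ _).2 h1.symm) ((hf _ _).2 h2.symm) (h.meets_symm hm)
  refine ⟨(spokeDisjointPairs lN.1).filter fun c => ¬ ∃ s s',
    c = pairCode (pathAt lN.1 s) (pathAt lN.1 s') ∧
      Meets τ vt σ (t (flipSide f s)) (t (flipSide f s')),
    List.mem_sublists.2 List.filter_sublist, fun s s' hne => ?_⟩
  rw [List.mem_filter, decide_eq_true_eq]
  constructor
  · rintro ⟨-, h1⟩ h2
    exact h1 ⟨s, s', rfl, h2⟩
  · intro h1
    refine ⟨?_, ?_⟩
    · rw [spokeDisjointPairs, List.mem_filter]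
      refine ⟨pairCode_mem_pairCodes (pathAt_lt hlN s) (pathAt_lt hlN s') hne,
        List.all_eq_true.2 fun i _ => bne_iff_ne.2 fun hc => h1 ?_⟩
      -- Paths with a common spoke meet at its outer end, where the two sides of the spoke are
      -- different corners.
      refine meets_of_code s s' _ _ hc ⟨_, _, Linked.refl _, Linked.refl _, ?_⟩
      simp only [flipSide]
      cases (f.testBit i.val)
      · exact ⟨h.vtx_side i, fun h2 => absurd (h.side_injective h2) (by simp), h.side_ne_swap i⟩
      · exact ⟨(h.vtx_side i).symm, fun h2 => absurd (h.side_injective h2) (by simp),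
          fun h2 => h.side_ne_swap i (by
            change t (i, false) = τ (t (i, true)) at h2
            rw [h2, h.swap_swap])⟩
    · rintro ⟨r, r', hc, hm⟩
      exact h1 (meets_of_code s s' r r' hc hm)

-- The necessary condition behind the upper bound: if an extension puts two paths on one walk and
-- its walks are simple, the paths do not meet.
omit [Finite X] in
theorem not_meets_of_rel {r : X → X → Prop} (hr : Equivalence r)
    (hl : ∀ x y, Linked σ τ x y → r x y) (hs : ∀ x y, r x y → vt x = vt y → y = x ∨ y = τ x)
    {x y : X} (hxy : r x y) : ¬ Meets τ vt σ x y := by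
  rintro ⟨x', y', hx, hy, hv, h1, h2⟩
  rcases hs x' y' (hr.trans (hr.symm (hl _ _ hx)) (hr.trans hxy (hl _ _ hy))) hv with h3 | h3
  · exact h1 h3
  · exact h2 h3

omit [Finite X] in
/-- The matchings of sides realised by a vertex and an edge are counted by `replacementCount`. -/
theorem ncard_le_replacementCount {f : ℕ} {l D : List ℕ}
    (hf : ∀ s s', Linked σ τ (t (flipSide f s)) (t (flipSide f s')) ↔ pathAt l s = pathAt l s')
    (hDs : D ∈ (spokeDisjointPairs l).sublists)
    (hD : ∀ s s', pathAt l s ≠ pathAt l s' → (pairCode (pathAt l s) (pathAt l s') ∈ D ↔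
        ¬ Meets τ vt σ (t (flipSide f s)) (t (flipSide f s'))))
    (a b : Fin 5) {K : Type*} (S : Set K) (γ : K → Side → Side) (hinj : Set.InjOn γ S)
    (hγ : ∀ k ∈ S, (∀ s, γ k (γ k s) = s) ∧ (∀ s, replacementRel a b s (γ k s) = true) ∧
      ∃ r : X → X → Prop, Equivalence r ∧ (∀ x y, Linked σ τ x y → r x y) ∧
        (∀ s, r (t s) (t (γ k s))) ∧ ∀ x y, r x y → vt x = vt y → y = x ∨ y = τ x) :
    S.ncard ≤ replacementCount l D a b := by
  classical
  have key : ∀ k ∈ S, ∃ m ∈ (admissibleMatchings l a b).filter fun m =>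
      (joinedPairs l m).all fun c => D.contains c,
      (∀ xy ∈ m, flipSide f (γ k (flipSide f xy.1)) = xy.2) ∧
      ∀ x, (x, flipSide f (γ k (flipSide f x))) ∈ m ∨ (flipSide f (γ k (flipSide f x)), x) ∈ m := by
    intro k hk
    obtain ⟨h1, h2, r, hr, hrl, hrt, hrs⟩ := hγ k hk
    have hrel : ∀ x, replacementRel a b x (flipSide f (γ k (flipSide f x))) = true :=
      fun x => h2 (flipSide f x)
    obtain ⟨m, hm, hm1, hm2⟩ := exists_mem_matchings (replacementRel a b)
      (fun x => flipSide f (γ k (flipSide f x)))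
      (fun x => by simp only [flipSide_flipSide, h1]) 5 sides nodup_sides (by decide)
      fun x _ => ⟨mem_sides _, fun hx => by
        have := hrel x
        rw [hx] at this
        simp [replacementRel] at this, hrel x⟩
    have hrm : ∀ xy ∈ m, r (t (flipSide f xy.1)) (t (flipSide f xy.2)) := by
      intro xy hxy
      rw [← hm1 xy hxy, flipSide_flipSide]
      exact hrt _
    have hjoin : ∀ p ∈ joinedPaths l m, ∃ s s', p = (pathAt l s, pathAt l s') ∧ p.1 ≠ p.2 ∧
        r (t (flipSide f s)) (t (flipSide f s')) := by
      intro p hp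
      rw [joinedPaths, List.mem_filter, List.mem_flatMap] at hp
      obtain ⟨⟨xy, hxy, hp⟩, hne⟩ := hp
      simp only [List.mem_cons, List.not_mem_nil, or_false] at hp
      rcases hp with hp | hp
      · exact ⟨xy.1, xy.2, hp, bne_iff_ne.1 hne, hrm xy hxy⟩
      · exact ⟨xy.2, xy.1, hp, bne_iff_ne.1 hne, hr.symm (hrm xy hxy)⟩
    -- Two joins, the second starting on the path where the first one ends, still put both extreme
    -- paths on a single walk by transitivity of `r`.
    have hpairs : ∀ c ∈ joinedPairs l m, c ∈ D := by
      intro c hc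
      rw [joinedPairs, List.mem_flatMap] at hc
      obtain ⟨p, hp, hc⟩ := hc
      obtain ⟨s, s', rfl, hne, hrss⟩ := hjoin p hp
      rcases List.mem_cons.1 hc with rfl | hc
      · exact (hD s s' hne).2 (not_meets_of_rel hr hrl hrs hrss)
      · obtain ⟨p', hp', rfl⟩ := List.mem_map.1 hc
        rw [List.mem_filter, Bool.and_eq_true, beq_iff_eq, bne_iff_ne] at hp'
        obtain ⟨q, q', rfl, -, hrqq⟩ := hjoin p' hp'.1
        exact (hD s q' hp'.2.2).2 (not_meets_of_rel hr hrl hrs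
          (hr.trans hrss (hr.trans (hrl _ _ ((hf s' q).2 hp'.2.1)) hrqq)))
    refine ⟨m, ?_, hm1, fun x => hm2 x (mem_sides x)⟩
    rw [admissibleMatchings, List.mem_filter, List.mem_filter]
    refine ⟨⟨hm, ?_⟩, ?_⟩
    -- `D` is a sublist of the spoke-disjoint pairs, so admissibility is implied by the condition on
    -- `D`.
    · refine List.all_eq_true.2 fun c hc => List.contains_iff_mem.2 ?_
      exact (List.mem_sublists.1 hDs).subset (hpairs c hc)
    · exact List.all_eq_true.2 fun c hc => List.contains_iff_mem.2 (hpairs c hc)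
  choose! M hM hM1 hM2 using key
  -- The list `M k` contains every pair in one of its two orders, so it determines the involution `γ
  -- k`.
  have hMinj : Set.InjOn M S := by
    intro k hk k' hk' heq
    refine hinj hk hk' (funext fun s => ?_)
    have h1 : flipSide f (γ k' (flipSide f (flipSide f s))) =
        flipSide f (γ k (flipSide f (flipSide f s))) := by
      rcases hM2 k hk (flipSide f s) with h | h
      · rw [heq] at h
        exact hM1 k' hk' _ h
      · rw [heq] at h
        have h2 := hM1 k' hk' _ h
        have h3 := (hγ k' hk').1
        have h4 := congrArg (fun z => flipSide f (γ k' (flipSide f z))) h2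
        simp only [flipSide_flipSide, h3] at h4 ⊢
        exact h4.symm
    have h2 := congrArg (flipSide f) h1
    simp only [flipSide_flipSide] at h2
    exact h2.symm
  rw [replacementCount]
  calc S.ncard = (M '' S).ncard := hMinj.ncard_image.symm
    _ ≤ (((admissibleMatchings l a b).filter fun m =>
          (joinedPairs l m).all fun c => D.contains c).toFinset : Set (List (Side × Side))).ncard := by
        refine Set.ncard_le_ncard ?_ (Finset.finite_toSet _)
        rintro _ ⟨k, hk, rfl⟩
        exact List.mem_toFinset.2 (hM k hk)
    _ ≤ _ := by
        rw [Set.ncard_coe_finset]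
        exact List.toFinset_card_le _

end OuterSystem

/-! ### Flags off the 5-cycle and outer parts of transition systems. -/

namespace Graph

namespace FiveCycle

variable {α β : Type*} {G : Graph α β} {P : G.FiveCycle}

/-- The graph is loopless and cubic, and the spokes lead to distinct vertices off the 5-cycle. -/
structure IsProper (P : G.FiveCycle) : Prop where
  cubic : G.IsLooplessCubic
  outer_injective : Function.Injective P.outer
  outer_ne_vert : ∀ i j, P.outer i ≠ P.vert j

theorem fin_five_add_one_ne : ∀ i : Fin 5, i + 1 ≠ i := by decide

theorem rim_injective (P : G.FiveCycle) : Function.Injective P.rim := by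
  intro i j h
  have h1 := P.rim_isLink i
  rw [h] at h1
  rcases h1.eq_and_eq_or_eq_and_eq (P.rim_isLink j) with ⟨h2, -⟩ | ⟨h2, h3⟩
  · exact P.vert_injective h2
  · have h4 := P.vert_injective h2
    have h5 := P.vert_injective h3
    subst h4
    exact absurd h5 ((by decide : ∀ j : Fin 5, j + 1 + 1 ≠ j) j)

theorem inc_rim {i : Fin 5} {x : α} : G.Inc (P.rim i) x ↔ x = P.vert i ∨ x = P.vert (i + 1) := by
  constructor
  · exact fun h => h.eq_or_eq_of_isLink (P.rim_isLink i)
  · rintro (rfl | rfl)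
    exacts [(P.rim_isLink i).inc_left, (P.rim_isLink i).inc_right]

theorem inc_spoke {i : Fin 5} {x : α} : G.Inc (P.spoke i) x ↔ x = P.vert i ∨ x = P.outer i := by
  constructor
  · exact fun h => h.eq_or_eq_of_isLink (P.spoke_isLink i)
  · rintro (rfl | rfl)
    exacts [(P.spoke_isLink i).inc_left, (P.spoke_isLink i).inc_right]

theorem inc_rim_sub_one (P : G.FiveCycle) (i : Fin 5) : G.Inc (P.rim (i - 1)) (P.vert i) :=
  inc_rim.2 (Or.inr (by rw [sub_add_cancel]))

theorem inc_rim_self (P : G.FiveCycle) (i : Fin 5) : G.Inc (P.rim i) (P.vert i) :=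
  inc_rim.2 (Or.inl rfl)

theorem inc_spoke_self (P : G.FiveCycle) (i : Fin 5) : G.Inc (P.spoke i) (P.vert i) :=
  inc_spoke.2 (Or.inl rfl)

theorem rim_sub_one_ne (P : G.FiveCycle) (i : Fin 5) : P.rim (i - 1) ≠ P.rim i := fun h =>
  (by decide : ∀ i : Fin 5, i - 1 ≠ i) i (P.rim_injective h)

theorem incidenceSet_vert_of_encard (P : G.FiveCycle) {i : Fin 5}
    (h : (G.incidenceSet (P.vert i)).encard = 3) :
    G.incidenceSet (P.vert i) = {P.rim (i - 1), P.rim i, P.spoke i} := by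
  symm
  refine Set.Finite.eq_of_subset_of_encard_le (Set.toFinite _) ?_ ?_
  · rintro e (rfl | rfl | rfl)
    exacts [P.inc_rim_sub_one i, P.inc_rim_self i, P.inc_spoke_self i]
  · rw [h, Set.encard_eq_three.2
      ⟨_, _, _, P.rim_sub_one_ne i, (P.spoke_ne_rim _ _).symm, (P.spoke_ne_rim _ _).symm, rfl⟩]

namespace IsProper

variable (hP : P.IsProper)
include hP

theorem spoke_injective : Function.Injective P.spoke := by
  intro i j h
  have h1 : G.Inc (P.spoke j) (P.outer i) := h ▸ inc_spoke.2 (Or.inr rfl)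
  rcases inc_spoke.1 h1 with h2 | h2
  · exact absurd h2 (hP.outer_ne_vert i j)
  · exact hP.outer_injective h2

theorem incidenceSet_vert (i : Fin 5) :
    G.incidenceSet (P.vert i) = {P.rim (i - 1), P.rim i, P.spoke i} :=
  P.incidenceSet_vert_of_encard
    (hP.cubic.encard_incidenceSet _ (P.rim_isLink i).left_mem)

end IsProper

/-- The flags at vertices off the 5-cycle. -/
def OuterFlag (P : G.FiveCycle) : Type _ := {φ : G.Flag // φ.vtx ∉ Set.range P.vert}

namespace OuterFlag

/-- Exchange the two edges of an outer flag. -/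
def swap (x : P.OuterFlag) : P.OuterFlag := ⟨x.1.swap, x.2⟩

theorem finite (hV : G.vertexSet.Finite) (hE : G.edgeSet.Finite) : Finite P.OuterFlag := by
  have := Flag.finite hV hE
  exact Subtype.finite

theorem edge_ne_rim (x : P.OuterFlag) (i : Fin 5) : x.1.edge ≠ P.rim i := by
  intro h
  have h1 := x.1.inc_edge
  rw [h] at h1
  rcases inc_rim.1 h1 with h2 | h2
  · exact x.2 ⟨_, h2.symm⟩
  · exact x.2 ⟨_, h2.symm⟩

theorem vtx_of_edge_eq_spoke {x : P.OuterFlag} {i : Fin 5} (h : x.1.edge = P.spoke i) :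
    x.1.vtx = P.outer i := by
  have h1 := x.1.inc_edge
  rw [h] at h1
  rcases inc_spoke.1 h1 with h2 | h2
  · exact absurd ⟨_, h2.symm⟩ x.2
  · exact h2

end OuterFlag

/-- A labelling of the outer flags whose first edge is a spoke by the sides of the spokes. -/
structure IsSideLabelling (P : G.FiveCycle) (t : Side → P.OuterFlag) : Prop where
  injective : Function.Injective t
  edge_eq : ∀ s, (t s).1.edge = P.spoke s.1
  exists_of_edge : ∀ x i, x.1.edge = P.spoke i → ∃ k, t (i, k) = x

namespace IsSideLabelling

variable {t : Side → P.OuterFlag}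

theorem vtx_eq (ht : P.IsSideLabelling t) (s : Side) : (t s).1.vtx = P.outer s.1 :=
  OuterFlag.vtx_of_edge_eq_spoke (ht.edge_eq s)

end IsSideLabelling

/-- The outer end of a spoke has two further edges, and each gives one flag that starts with the
spoke. Which of them is called `false` is arbitrary. -/
theorem IsProper.exists_isSideLabelling (hP : P.IsProper) :
    ∃ t : Side → P.OuterFlag, P.IsSideLabelling t := by
  have key : ∀ i, ∃ x y : P.OuterFlag, x ≠ y ∧ x.1.edge = P.spoke i ∧ y.1.edge = P.spoke i ∧
      ∀ z : P.OuterFlag, z.1.edge = P.spoke i → z = x ∨ z = y := by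
    intro i
    have hout : P.outer i ∉ Set.range P.vert := by
      rintro ⟨j, hj⟩
      exact hP.outer_ne_vert i j hj.symm
    have hs : G.Inc (P.spoke i) (P.outer i) := inc_spoke.2 (Or.inr rfl)
    obtain ⟨f, hf, hfs⟩ : ∃ f, G.Inc f (P.outer i) ∧ P.spoke i ≠ f := by
      obtain ⟨a, b, c, hab, hac, hbc, hi⟩ := hP.cubic.exists_edges hs.vertex_mem
      have ha : G.Inc a (P.outer i) := by rw [← mem_incidenceSet, hi]; simp
      have hb : G.Inc b (P.outer i) := by rw [← mem_incidenceSet, hi]; simp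
      rcases eq_or_ne (P.spoke i) a with h | h
      · exact ⟨b, hb, h ▸ hab⟩
      · exact ⟨a, ha, h⟩
    obtain ⟨g, hg1, hg2, hi⟩ := hP.cubic.exists_third ⟨P.outer i, P.spoke i, f, hs, hf, hfs⟩
    have hg : G.Inc g (P.outer i) := by
      change g ∈ G.incidenceSet (P.outer i)
      rw [hi]; simp
    refine ⟨⟨⟨P.outer i, P.spoke i, f, hs, hf, hfs⟩, hout⟩,
      ⟨⟨P.outer i, P.spoke i, g, hs, hg, hg1.symm⟩, hout⟩, fun h => ?_, rfl, rfl, fun z hz => ?_⟩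
    · exact hg2 (congrArg (fun x : P.OuterFlag => x.1.other) h).symm
    · have hv := OuterFlag.vtx_of_edge_eq_spoke hz
      have ho : z.1.other ∈ G.incidenceSet (P.outer i) := by
        have := z.1.inc_other
        rwa [hv] at this
      rw [hi] at ho
      rcases ho with h | h | h
      · exact absurd (hz.trans h.symm) z.1.edge_ne_other
      · exact Or.inl (Subtype.ext (Flag.ext hv hz h))
      · exact Or.inr (Subtype.ext (Flag.ext hv hz h))
  choose x y hxy hx hy hz using key
  refine ⟨fun s => cond s.2 (y s.1) (x s.1), ?_, ?_, ?_⟩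
  · rintro ⟨i, k⟩ ⟨j, k'⟩ h
    have hij : i = j := by
      apply hP.spoke_injective
      have h1 := congrArg (fun x : P.OuterFlag => x.1.edge) h
      cases k <;> cases k' <;> simpa [hx, hy] using h1
    subst hij
    cases k <;> cases k'
    · rfl
    · exact absurd h (hxy i)
    · exact absurd h.symm (hxy i)
    · rfl
  · rintro ⟨i, k⟩
    cases k
    exacts [hx i, hy i]
  · intro z i hzi
    rcases hz i z hzi with h | h
    · exact ⟨false, h.symm⟩
    · exact ⟨true, h.symm⟩

/-- The transition systems on outer flags, loose at the spokes, whose walks visit each vertex at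
most once. -/
structure IsOuterTransition (P : G.FiveCycle) (σ : P.OuterFlag → P.OuterFlag) : Prop where
  involutive : ∀ x, σ (σ x) = x
  fixed_iff : ∀ x, σ x = x ↔ x.1.edge ∈ Set.range P.spoke
  edge_eq : ∀ x, (σ x).1.edge = x.1.edge
  vtx_ne : ∀ x, x.1.edge ∉ Set.range P.spoke → (σ x).1.vtx ≠ x.1.vtx
  simple : ∀ x y, Linked σ OuterFlag.swap x y → x.1.vtx = y.1.vtx → y = x ∨ y = x.swap

theorem IsOuterTransition.outerSystem {σ : P.OuterFlag → P.OuterFlag}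
    (hσ : P.IsOuterTransition σ) {t : Side → P.OuterFlag} (ht : P.IsSideLabelling t) :
    OuterSystem OuterFlag.swap (fun x => x.1.vtx) t σ where
  swap_swap _ := rfl
  swap_ne x h := x.1.swap_ne (congrArg Subtype.val h)
  side_injective := ht.injective
  vtx_side i := (ht.vtx_eq (i, false)).trans (ht.vtx_eq (i, true)).symm
  side_ne_swap i h := by
    have h1 := congrArg (fun x : P.OuterFlag => x.1.edge) h
    rw [ht.edge_eq] at h1
    exact (t (i, false)).1.edge_ne_other ((ht.edge_eq _).trans h1)
  involutive := hσ.involutive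
  fixed_iff x := by
    rw [hσ.fixed_iff]
    constructor
    · rintro ⟨i, hi⟩
      obtain ⟨k, hk⟩ := ht.exists_of_edge x i hi.symm
      exact ⟨_, hk⟩
    · rintro ⟨s, rfl⟩
      exact ⟨s.1, (ht.edge_eq s).symm⟩
  simple := hσ.simple

/-- The outer flags are flags of `Γ`, and transitions of `Γ` continue an outer flag along the same
edge to an outer flag unless that edge is a spoke. -/
structure IsOuterEmbedding {α' β' : Type*} {Γ : Graph α' β'} (j : P.OuterFlag → Γ.Flag) : Prop where
  injective : Function.Injective j
  map_swap : ∀ x, j x.swap = (j x).swap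
  map_vtx : ∀ x y, x.1.vtx = y.1.vtx → (j x).vtx = (j y).vtx
  exists_next : ∀ σ, Γ.IsTransition σ → ∀ x : P.OuterFlag, x.1.edge ∉ Set.range P.spoke →
    ∃ y, σ (j x) = j y ∧ y.1.edge = x.1.edge
  not_exists_next : ∀ σ, Γ.IsTransition σ → ∀ x : P.OuterFlag, x.1.edge ∈ Set.range P.spoke →
    ¬ ∃ y, σ (j x) = j y ∧ y.1.edge = x.1.edge

section restriction

variable {α' β' : Type*} {Γ : Graph α' β'} {j : P.OuterFlag → Γ.Flag} {σ : Γ.Flag → Γ.Flag}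

open Classical in
/-- The restriction of a transition system to the outer flags. -/
noncomputable def outerPart (j : P.OuterFlag → Γ.Flag) (σ : Γ.Flag → Γ.Flag) (x : P.OuterFlag) :
    P.OuterFlag :=
  -- The default `x` turns the loose flags into fixed points. Equality of the edges in `G` is
  -- required because, in a replacement, the new edge leads from an outer flag on one spoke to an
  -- outer flag on another.
  if h : ∃ y, σ (j x) = j y ∧ y.1.edge = x.1.edge then h.choose else x

namespace IsOuterEmbedding

theorem outerPart_of_mem (hj : IsOuterEmbedding j) (hσ : Γ.IsTransition σ) {x : P.OuterFlag}
    (hx : x.1.edge ∈ Set.range P.spoke) : outerPart j σ x = x :=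
  dif_neg (hj.not_exists_next σ hσ x hx)

theorem outerPart_of_notMem (hj : IsOuterEmbedding j) (hσ : Γ.IsTransition σ) {x : P.OuterFlag}
    (hx : x.1.edge ∉ Set.range P.spoke) :
    j (outerPart j σ x) = σ (j x) ∧ (outerPart j σ x).1.edge = x.1.edge := by
  have h := hj.exists_next σ hσ x hx
  rw [outerPart, dif_pos h]
  exact ⟨h.choose_spec.1.symm, h.choose_spec.2⟩

theorem linked_map (hj : IsOuterEmbedding j) (hσ : Γ.IsTransition σ) {x y : P.OuterFlag}
    (h : Linked (outerPart j σ) OuterFlag.swap x y) : Linked σ Flag.swap (j x) (j y) := by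
  refine Linked.rel_of_equivalence (r := fun x y => Linked σ Flag.swap (j x) (j y))
    ⟨fun _ => Linked.refl _, Linked.symm, Linked.trans⟩ (fun x => ?_) (fun x => ?_) h
  · by_cases hx : x.1.edge ∈ Set.range P.spoke
    · rw [hj.outerPart_of_mem hσ hx]
      exact Linked.refl _
    · rw [(hj.outerPart_of_notMem hσ hx).1]
      exact Linked.fst _
  · rw [hj.map_swap]
    exact Linked.snd _

/-- Walks of the outer part are pieces of walks of `σ`, so they inherit simplicity. -/
theorem isOuterTransition (hj : IsOuterEmbedding j) (hσ : σ ∈ Γ.circuitTransitions) :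
    P.IsOuterTransition (outerPart j σ) where
  involutive x := by
    by_cases hx : x.1.edge ∈ Set.range P.spoke
    · rw [hj.outerPart_of_mem hσ.1 hx, hj.outerPart_of_mem hσ.1 hx]
    · obtain ⟨h1, h2⟩ := hj.outerPart_of_notMem hσ.1 hx
      have hx' : (outerPart j σ x).1.edge ∉ Set.range P.spoke := by rwa [h2]
      obtain ⟨h3, h4⟩ := hj.outerPart_of_notMem hσ.1 hx'
      apply hj.injective
      rw [h3, h1, hσ.1.involutive]
  fixed_iff x := by
    refine ⟨fun h => ?_, hj.outerPart_of_mem hσ.1⟩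
    by_contra hx
    obtain ⟨h1, h2⟩ := hj.outerPart_of_notMem hσ.1 hx
    rw [h] at h1
    exact hσ.1.vtx_ne (j x) (by rw [← h1])
  edge_eq x := by
    by_cases hx : x.1.edge ∈ Set.range P.spoke
    · rw [hj.outerPart_of_mem hσ.1 hx]
    · exact (hj.outerPart_of_notMem hσ.1 hx).2
  vtx_ne x hx h := by
    have h1 := (hj.outerPart_of_notMem hσ.1 hx).1
    exact hσ.1.vtx_ne (j x) (by rw [← h1]; exact hj.map_vtx _ _ h)
  simple x y h hv := by
    rcases hσ.2 _ _ (hj.linked_map hσ.1 h) (hj.map_vtx _ _ hv) with h1 | h1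
    · exact Or.inl (hj.injective h1)
    · exact Or.inr (hj.injective (h1.trans (hj.map_swap x).symm))

/-- Transition systems are counted by their outer parts. -/
theorem ncard_eq_sum (hj : IsOuterEmbedding j) [Finite Γ.Flag] [Finite P.OuterFlag]
    (O : Finset (P.OuterFlag → P.OuterFlag)) (hO : ∀ ς, ς ∈ O ↔ P.IsOuterTransition ς) :
    Γ.circuitTransitions.ncard =
      ∑ ς ∈ O, {σ ∈ Γ.circuitTransitions | outerPart j σ = ς}.ncard := by
  classical
  have hfin : Γ.circuitTransitions.Finite := Set.toFinite _
  rw [Set.ncard_eq_toFinset_card _ hfin,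
    Finset.card_eq_sum_card_fiberwise (f := outerPart j) (t := O) ?_]
  · refine Finset.sum_congr rfl fun ς _ => ?_
    rw [← Set.ncard_coe_finset]
    congr 1
    ext σ
    simp
  · intro σ hσ
    exact (hO _).2 (hj.isOuterTransition (hfin.mem_toFinset.1 hσ))

end IsOuterEmbedding

end restriction

end FiveCycle

end Graph

/-! ### Gluing an outer part to the 5-cycle: the lower bound for `G`. -/

namespace Graph

namespace FiveCycle

variable {α β : Type*} {G : Graph α β} {P : G.FiveCycle}

/-- The outer flags form part of the flags of the whole graph. -/
theorem IsProper.isOuterEmbedding_val (hP : P.IsProper) :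
    IsOuterEmbedding (P := P) (Γ := G) Subtype.val where
  injective := Subtype.val_injective
  map_swap _ := rfl
  map_vtx _ _ h := h
  exists_next σ hσ x hx := by
    refine ⟨⟨σ x.1, ?_⟩, rfl, hσ.edge_eq x.1⟩
    rintro ⟨i, hi⟩
    have h1 : x.1.edge ∈ G.incidenceSet (P.vert i) := by
      rw [hi]; exact (hσ.isLink x.1).inc_right
    rw [hP.incidenceSet_vert] at h1
    rcases h1 with h1 | h1 | h1
    · exact x.edge_ne_rim _ h1
    · exact x.edge_ne_rim _ h1
    · exact hx ⟨i, h1.symm⟩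
  not_exists_next σ hσ x hx := by
    rintro ⟨y, h1, h2⟩
    obtain ⟨i, hi⟩ := hx
    have h3 := OuterFlag.vtx_of_edge_eq_spoke hi.symm
    have h4 := OuterFlag.vtx_of_edge_eq_spoke (h2.trans hi.symm)
    exact hσ.vtx_ne x.1 (by rw [h1, h3, h4])

/-- The flags of the graph, sorted by their position relative to the 5-cycle. The first edge of
the flags at the 5-cycle is a spoke, the rim edge that leaves the vertex, or the rim edge that
enters it. -/
inductive SortedFlag (P : G.FiveCycle)
  | out (x : P.OuterFlag)
  | spoke (s : Side)
  | rimOut (s : Side)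
  | rimIn (s : Side)

namespace SortedFlag

/-- The flag at a given position. -/
def toFlag : P.SortedFlag → G.Flag
  | out x => x.1
  | spoke (i, false) => ⟨P.vert i, P.spoke i, P.rim (i - 1), P.inc_spoke_self i,
      P.inc_rim_sub_one i, P.spoke_ne_rim _ _⟩
  | spoke (i, true) => ⟨P.vert i, P.spoke i, P.rim i, P.inc_spoke_self i,
      P.inc_rim_self i, P.spoke_ne_rim _ _⟩
  | rimOut (i, false) => ⟨P.vert i, P.rim i, P.spoke i, P.inc_rim_self i,
      P.inc_spoke_self i, (P.spoke_ne_rim _ _).symm⟩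
  | rimOut (i, true) => ⟨P.vert i, P.rim i, P.rim (i - 1), P.inc_rim_self i,
      P.inc_rim_sub_one i, (P.rim_sub_one_ne i).symm⟩
  | rimIn (i, false) => ⟨P.vert i, P.rim (i - 1), P.spoke i, P.inc_rim_sub_one i,
      P.inc_spoke_self i, (P.spoke_ne_rim _ _).symm⟩
  | rimIn (i, true) => ⟨P.vert i, P.rim (i - 1), P.rim i, P.inc_rim_sub_one i,
      P.inc_rim_self i, P.rim_sub_one_ne i⟩

theorem vtx_spoke (s : Side) : (toFlag (spoke s : P.SortedFlag)).vtx = P.vert s.1 := by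
  obtain ⟨i, _ | _⟩ := s <;> rfl

theorem vtx_rimOut (s : Side) : (toFlag (rimOut s : P.SortedFlag)).vtx = P.vert s.1 := by
  obtain ⟨i, _ | _⟩ := s <;> rfl

theorem vtx_rimIn (s : Side) : (toFlag (rimIn s : P.SortedFlag)).vtx = P.vert s.1 := by
  obtain ⟨i, _ | _⟩ := s <;> rfl

theorem edge_spoke (s : Side) : (toFlag (spoke s : P.SortedFlag)).edge = P.spoke s.1 := by
  obtain ⟨i, _ | _⟩ := s <;> rfl

theorem edge_rimOut (s : Side) : (toFlag (rimOut s : P.SortedFlag)).edge = P.rim s.1 := by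
  obtain ⟨i, _ | _⟩ := s <;> rfl

theorem edge_rimIn (s : Side) : (toFlag (rimIn s : P.SortedFlag)).edge = P.rim (s.1 - 1) := by
  obtain ⟨i, _ | _⟩ := s <;> rfl

theorem toFlag_injective : Function.Injective (toFlag (P := P)) := by
  have hv := P.vert_injective
  have hrim : ∀ i, P.rim (i - 1) ≠ P.rim i := P.rim_sub_one_ne
  have hsp := P.spoke_ne_rim
  intro a b h
  have h1 := congrArg Flag.vtx h
  have h2 := congrArg Flag.edge h
  have h3 := congrArg Flag.other h
  have hcase : ∀ c : P.SortedFlag, (∃ x, c = out x) ∨ ∃ i, (toFlag c).vtx = P.vert i := by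
    rintro (x | s | s | s)
    · exact Or.inl ⟨x, rfl⟩
    · exact Or.inr ⟨_, vtx_spoke s⟩
    · exact Or.inr ⟨_, vtx_rimOut s⟩
    · exact Or.inr ⟨_, vtx_rimIn s⟩
  rcases hcase a with ⟨x, rfl⟩ | ⟨i, hi⟩
  · rcases hcase b with ⟨y, rfl⟩ | ⟨i, hi⟩
    · exact congrArg out (Subtype.ext h)
    · exact absurd ⟨i, (h1.trans hi).symm⟩ x.2
  · rcases hcase b with ⟨y, rfl⟩ | ⟨i', hi'⟩
    · exact absurd ⟨i, (h1.symm.trans hi).symm⟩ y.2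
    · rcases a with x | ⟨j, _ | _⟩ | ⟨j, _ | _⟩ | ⟨j, _ | _⟩ <;>
      rcases b with y | ⟨j', _ | _⟩ | ⟨j', _ | _⟩ | ⟨j', _ | _⟩ <;>
      first
      | exact absurd ⟨_, hi.symm⟩ x.2
      | exact absurd ⟨_, hi'.symm⟩ y.2
      | (obtain rfl : j = j' := hv h1
         first
         | rfl
         | exact absurd h2 (hsp _ _)
         | exact absurd h2.symm (hsp _ _)
         | exact absurd h3 (hsp _ _)
         | exact absurd h3.symm (hsp _ _)
         | exact absurd h2 (hrim _)
         | exact absurd h2.symm (hrim _)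
         | exact absurd h3 (hrim _)
         | exact absurd h3.symm (hrim _))

theorem toFlag_surjective (hP : P.IsProper) : Function.Surjective (toFlag (P := P)) := by
  intro φ
  by_cases hφ : φ.vtx ∈ Set.range P.vert
  · obtain ⟨i, hi⟩ := hφ
    have h1 : φ.edge ∈ G.incidenceSet (P.vert i) := hi ▸ φ.inc_edge
    have h2 : φ.other ∈ G.incidenceSet (P.vert i) := hi ▸ φ.inc_other
    have h3 := φ.edge_ne_other
    rw [hP.incidenceSet_vert] at h1 h2
    rcases h1 with h1 | h1 | h1 <;> rcases h2 with h2 | h2 | h2 <;>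
    first
    | exact absurd (h1.trans h2.symm) h3
    | exact ⟨spoke (i, false), Flag.ext hi h1.symm h2.symm⟩
    | exact ⟨spoke (i, true), Flag.ext hi h1.symm h2.symm⟩
    | exact ⟨rimOut (i, false), Flag.ext hi h1.symm h2.symm⟩
    | exact ⟨rimOut (i, true), Flag.ext hi h1.symm h2.symm⟩
    | exact ⟨rimIn (i, false), Flag.ext hi h1.symm h2.symm⟩
    | exact ⟨rimIn (i, true), Flag.ext hi h1.symm h2.symm⟩
  · exact ⟨out ⟨φ, hφ⟩, rfl⟩

/-- Exchange the two edges of a flag. -/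
def swap : P.SortedFlag → P.SortedFlag
  | out x => out x.swap
  | spoke (i, false) => rimIn (i, false)
  | spoke (i, true) => rimOut (i, false)
  | rimOut (i, false) => spoke (i, true)
  | rimOut (i, true) => rimIn (i, true)
  | rimIn (i, false) => spoke (i, false)
  | rimIn (i, true) => rimOut (i, true)

theorem toFlag_swap (a : P.SortedFlag) : toFlag a.swap = (toFlag a).swap := by
  rcases a with x | ⟨i, _ | _⟩ | ⟨i, _ | _⟩ | ⟨i, _ | _⟩ <;> rfl

open Classical in
/-- The transition system with outer part `σ` and transition code `n`, where `t` labels the loose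
flags of the outer part. -/
noncomputable def next (σ : P.OuterFlag → P.OuterFlag) (t : Side → P.OuterFlag) (n : ℕ) :
    P.SortedFlag → P.SortedFlag
  | out x => if h : ∃ s, t s = x then spoke (flipSide n h.choose) else out (σ x)
  | spoke s => out (t (flipSide n s))
  | rimOut s => rimIn (s.1 + 1, s.2 ^^ n.testBit (5 + s.1.val))
  | rimIn s => rimOut (s.1 - 1, s.2 ^^ n.testBit (5 + (s.1 - 1).val))

variable {σ : P.OuterFlag → P.OuterFlag} {t : Side → P.OuterFlag} {n : ℕ}

theorem next_side (ht : Function.Injective t) (s : Side) :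
    next σ t n (out (t s)) = spoke (flipSide n s) := by
  have h : ∃ s', t s' = t s := ⟨s, rfl⟩
  rw [next, dif_pos h, ht h.choose_spec]

theorem next_of_ne {x : P.OuterFlag} (h : ¬ ∃ s, t s = x) : next σ t n (out x) = out (σ x) := by
  rw [next, dif_neg h]

end SortedFlag

end FiveCycle

end Graph

theorem pairCode_mem_mergedPairs {lab : List ℕ} {a b : ℕ} (ha : a < 5) (hb : b < 5) (hne : a ≠ b)
    (h : lab.getD a 0 = lab.getD b 0) : pairCode a b ∈ mergedPairs lab := by
  wlog hab : a < b generalizing a b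
  · rw [pairCode_comm]
    exact this hb ha hne.symm h.symm (by omega)
  refine List.mem_filterMap.2 ⟨(a, b), ?_, ?_⟩
  · interval_cases b <;> interval_cases a <;> simp
  · simp only [h, beq_self_eq_true, if_true]

/-- Makes the length of a filtered list of codes a number of distinct transition systems. -/
theorem nodup_pathPatterns_codes : (pathPatterns.all fun lN => lN.2.Nodup) = true := by
  decide +kernel

/-- Labels of closed walks: the defining properties of `isWalkLabelling`. -/
structure WalkLabelling (l : List ℕ) (n : ℕ) (lab : ℕ → ℕ) : Prop where
  spoke : ∀ s, lab (pathAt l s) = lab (spokeCorner n s)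
  rim : ∀ s, lab (rimCorner s) = lab (rimCornerNext n s)
  corner_injective : ∀ i k k', k < 3 → k' < 3 → lab (cornerNode i k) = lab (cornerNode i k') → k = k'

theorem walkLabelling_of_isWalkLabelling {l : List ℕ} {n : ℕ} {lab : List ℕ}
    (h : isWalkLabelling l n lab = true) : WalkLabelling l n (fun k => lab.getD k 0) := by
  rw [isWalkLabelling, Bool.and_eq_true] at h
  obtain ⟨h1, h2⟩ := h
  refine ⟨fun s => ?_, fun s => ?_, fun i k k' hk hk' hkk => ?_⟩
  · have := List.all_eq_true.1 h1 s (mem_sides s)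
    simp only [Bool.and_eq_true, beq_iff_eq] at this
    exact this.1
  · have := List.all_eq_true.1 h1 s (mem_sides s)
    simp only [Bool.and_eq_true, beq_iff_eq] at this
    exact this.2
  · have := List.all_eq_true.1 h2 i
      ((by decide : ∀ i : Fin 5, i ∈ ([0, 1, 2, 3, 4] : List (Fin 5))) i)
    simp only [Bool.and_eq_true, bne_iff_ne] at this
    obtain ⟨⟨h01, h02⟩, h12⟩ := this
    interval_cases k <;> interval_cases k' <;>
    first
    | rfl
    | exact absurd hkk h01
    | exact absurd hkk h02
    | exact absurd hkk h12
    | exact absurd hkk.symm h01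
    | exact absurd hkk.symm h02
    | exact absurd hkk.symm h12

namespace Graph

namespace FiveCycle

variable {α β : Type*} {G : Graph α β} {P : G.FiveCycle}

theorem IsSideLabelling.comp_flipSide {t : Side → P.OuterFlag} (ht : P.IsSideLabelling t) (f : ℕ) :
    P.IsSideLabelling fun s => t (flipSide f s) where
  injective s s' h := by
    have := congrArg (flipSide f) (ht.injective h)
    simpa only [flipSide_flipSide] using this
  edge_eq s := ht.edge_eq _
  exists_of_edge x i h := by
    obtain ⟨k, hk⟩ := ht.exists_of_edge x i h
    exact ⟨(flipSide f (i, k)).2, by rw [← hk]; exact congrArg t (flipSide_flipSide f (i, k))⟩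

namespace SortedFlag

variable {σ : P.OuterFlag → P.OuterFlag} {t : Side → P.OuterFlag} {n : ℕ}

theorem next_next (hσ : P.IsOuterTransition σ) (ht : P.IsSideLabelling t) (a : P.SortedFlag) :
    next σ t n (next σ t n a) = a := by
  rcases a with x | s | s | s
  · by_cases h : ∃ s, t s = x
    · obtain ⟨s, rfl⟩ := h
      rw [next_side ht.injective, next, flipSide_flipSide]
    · have h' : ¬ ∃ s, t s = σ x := by
        rw [← (hσ.outerSystem ht).fixed_iff] at h ⊢
        rw [hσ.involutive]
        exact fun h' => h h'.symm
      rw [next_of_ne h, next_of_ne h', hσ.involutive]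
  · rw [next, next_side ht.injective, flipSide_flipSide]
  · rw [next, next]
    simp
  · rw [next, next]
    simp

theorem edge_next (hσ : P.IsOuterTransition σ) (ht : P.IsSideLabelling t) (a : P.SortedFlag) :
    (toFlag (next σ t n a)).edge = (toFlag a).edge := by
  rcases a with x | s | s | s
  · by_cases h : ∃ s, t s = x
    · obtain ⟨s, rfl⟩ := h
      rw [next_side ht.injective, edge_spoke]
      exact (ht.edge_eq s).symm
    · rw [next_of_ne h]
      exact hσ.edge_eq x
  · rw [edge_spoke]
    exact ht.edge_eq _
  · rw [next, edge_rimIn, edge_rimOut]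
    simp
  · rw [next, edge_rimOut, edge_rimIn]

theorem vtx_next_ne (hσ : P.IsOuterTransition σ) (ht : P.IsSideLabelling t) (a : P.SortedFlag) :
    (toFlag (next σ t n a)).vtx ≠ (toFlag a).vtx := by
  rcases a with x | s | s | s
  · by_cases h : ∃ s, t s = x
    · obtain ⟨s, rfl⟩ := h
      rw [next_side ht.injective, vtx_spoke]
      exact fun h => (t s).2 ⟨_, h⟩
    · rw [next_of_ne h]
      refine hσ.vtx_ne x ?_
      rwa [← hσ.fixed_iff, (hσ.outerSystem ht).fixed_iff]
  · rw [vtx_spoke, next]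
    exact fun h => (t (flipSide n s)).2 ⟨_, h.symm⟩
  · rw [next, vtx_rimIn, vtx_rimOut]
    exact fun h => fin_five_add_one_ne _ (P.vert_injective h)
  · rw [next, vtx_rimOut, vtx_rimIn]
    exact fun h => (by decide : ∀ i : Fin 5, i - 1 ≠ i) _ (P.vert_injective h)

open Classical in
/-- A label of the closed walk through a flag. -/
noncomputable def walkLabel (σ : P.OuterFlag → P.OuterFlag) (t : Side → P.OuterFlag)
    (l : List ℕ) (lab : ℕ → ℕ) : P.SortedFlag → ℕ ⊕ Set P.OuterFlag
  -- A path takes the label of its name. A walk without loose flags is already a closed walk of the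
  -- whole graph and serves as its own label.
  | out x => if h : ∃ s, Linked σ OuterFlag.swap x (t s) then .inl (lab (pathAt l h.choose))
      else .inr {y | Linked σ OuterFlag.swap x y}
  | spoke s => .inl (lab (cornerNode s.1 s.2.toNat))
  | rimOut s => .inl (lab (cornerNode s.1 (1 + s.2.toNat)))
  | rimIn s => .inl (lab (cornerNode s.1 (2 * s.2.toNat)))

section

variable {l : List ℕ} {lab : ℕ → ℕ}
  (hl : ∀ s s', Linked σ OuterFlag.swap (t s) (t s') ↔ pathAt l s = pathAt l s')
include hl

theorem walkLabel_of_linked {x : P.OuterFlag} {s : Side}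
    (h : Linked σ OuterFlag.swap x (t s)) :
    walkLabel σ t l lab (out x) = .inl (lab (pathAt l s)) := by
  have h' : ∃ s, Linked σ OuterFlag.swap x (t s) := ⟨s, h⟩
  rw [walkLabel, dif_pos h', (hl _ _).1 (h'.choose_spec.symm.trans h)]

theorem walkLabel_congr {x y : P.OuterFlag} (h : Linked σ OuterFlag.swap x y) :
    walkLabel σ t l lab (out x) = walkLabel σ t l lab (out y) := by
  by_cases hx : ∃ s, Linked σ OuterFlag.swap x (t s)
  · obtain ⟨s, hs⟩ := hx
    rw [walkLabel_of_linked hl hs, walkLabel_of_linked hl (h.symm.trans hs)]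
  · have hy : ¬ ∃ s, Linked σ OuterFlag.swap y (t s) := fun ⟨s, hs⟩ => hx ⟨s, h.trans hs⟩
    rw [walkLabel, dif_neg hx, walkLabel, dif_neg hy]
    congr 1
    ext z
    exact ⟨fun hz => h.symm.trans hz, fun hz => h.trans hz⟩

theorem walkLabel_swap (a : P.SortedFlag) :
    walkLabel σ t l lab a.swap = walkLabel σ t l lab a := by
  rcases a with x | ⟨i, _ | _⟩ | ⟨i, _ | _⟩ | ⟨i, _ | _⟩
  · exact (walkLabel_congr hl (Linked.snd x)).symm
  all_goals rfl

theorem walkLabel_next (ht : P.IsSideLabelling t) (hlab : WalkLabelling l n lab)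
    (a : P.SortedFlag) : walkLabel σ t l lab (next σ t n a) = walkLabel σ t l lab a := by
  rcases a with x | s | s | s
  · by_cases h : ∃ s, t s = x
    · obtain ⟨s, rfl⟩ := h
      rw [next_side ht.injective, walkLabel_of_linked hl (Linked.refl _), hlab.spoke]
      rfl
    · rw [next_of_ne h]
      exact (walkLabel_congr hl (Linked.fst x)).symm
  · rw [next, walkLabel_of_linked hl (Linked.refl _), hlab.spoke]
    simp [walkLabel, spokeCorner, flipSide]
  · exact congrArg Sum.inl (hlab.rim s).symm
  · have h1 := hlab.rim (s.1 - 1, s.2 ^^ n.testBit (5 + (s.1 - 1).val))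
    rw [rimCornerNext] at h1
    simp only [sub_add_cancel, Bool.bne_assoc, bne_self_eq_false, Bool.bne_false] at h1
    exact congrArg Sum.inl h1

/-- Flags at the same vertex on walks with the same label have the same pair of edges. -/
theorem eq_or_eq_swap_of_walkLabel_eq (hσ : P.IsOuterTransition σ) (hlab : WalkLabelling l n lab)
    (hm : ∀ s s', lab (pathAt l s) = lab (pathAt l s') → pathAt l s ≠ pathAt l s' →
      ¬ Meets OuterFlag.swap (fun x => x.1.vtx) σ (t s) (t s')) {a b : P.SortedFlag}
    (hab : walkLabel σ t l lab a = walkLabel σ t l lab b) (hv : (toFlag a).vtx = (toFlag b).vtx) :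
    b = a ∨ b = a.swap := by
  -- At a vertex of the 5-cycle the number `k` names the corner, and a corner consists of a flag and
  -- its exchange.
  have hcase : ∀ c : P.SortedFlag, (∃ x, c = out x) ∨ ∃ i k, k < 3 ∧ (toFlag c).vtx = P.vert i ∧
      walkLabel σ t l lab c = .inl (lab (cornerNode i k)) ∧ ∀ d : P.SortedFlag, (d = spoke (i, false)
        ∧ k = 0 ∨ d = rimIn (i, false) ∧ k = 0 ∨ d = spoke (i, true) ∧ k = 1 ∨
        d = rimOut (i, false) ∧ k = 1 ∨ d = rimOut (i, true) ∧ k = 2 ∨ d = rimIn (i, true) ∧ k = 2) ↔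
          d = c ∨ d = c.swap := by
    rintro (x | ⟨i, _ | _⟩ | ⟨i, _ | _⟩ | ⟨i, _ | _⟩)
    · exact Or.inl ⟨x, rfl⟩
    · exact Or.inr ⟨i, 0, by norm_num, rfl, rfl, fun d => by simp [swap]⟩
    · exact Or.inr ⟨i, 1, by norm_num, rfl, rfl, fun d => by simp [swap]⟩
    · exact Or.inr ⟨i, 1, by norm_num, rfl, rfl, fun d => by simp [swap]; tauto⟩
    · exact Or.inr ⟨i, 2, by norm_num, rfl, rfl, fun d => by simp [swap]⟩
    · exact Or.inr ⟨i, 0, by norm_num, rfl, rfl, fun d => by simp [swap]; tauto⟩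
    · exact Or.inr ⟨i, 2, by norm_num, rfl, rfl, fun d => by simp [swap]; tauto⟩
  rcases hcase a with ⟨x, rfl⟩ | ⟨i, k, hk, hi, hlk, hak⟩
  · rcases hcase b with ⟨y, rfl⟩ | ⟨i, k, hk, hi, hlk, hak⟩
    · have hxy : Linked σ OuterFlag.swap x y ∨ ¬ ∃ x' y', Linked σ OuterFlag.swap x x' ∧
          Linked σ OuterFlag.swap y y' ∧ x'.1.vtx = y'.1.vtx ∧ y' ≠ x' ∧ y' ≠ x'.swap := by
        by_cases hx : ∃ s, Linked σ OuterFlag.swap x (t s)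
        · obtain ⟨s, hs⟩ := hx
          by_cases hy : ∃ s, Linked σ OuterFlag.swap y (t s)
          · obtain ⟨s', hs'⟩ := hy
            rw [walkLabel_of_linked hl hs, walkLabel_of_linked hl hs'] at hab
            by_cases hp : pathAt l s = pathAt l s'
            · exact Or.inl (hs.trans (((hl _ _).2 hp).trans hs'.symm))
            · exact Or.inr fun h => hm s s' (Sum.inl_injective hab) hp
                (OuterSystem.meets_congr hs hs' h)
          · rw [walkLabel_of_linked hl hs, walkLabel, dif_neg hy] at hab
            exact absurd hab (by simp)
        · by_cases hy : ∃ s, Linked σ OuterFlag.swap y (t s)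
          · obtain ⟨s', hs'⟩ := hy
            rw [walkLabel_of_linked hl hs', walkLabel, dif_neg hx] at hab
            exact absurd hab (by simp)
          · rw [walkLabel, dif_neg hx, walkLabel, dif_neg hy] at hab
            left
            have : y ∈ {z | Linked σ OuterFlag.swap x z} := by
              rw [Sum.inr_injective hab]
              exact Linked.refl y
            exact this
      have : y = x ∨ y = x.swap := by
        rcases hxy with h | h
        · exact hσ.simple x y h hv
        · by_contra hcon
          rw [not_or] at hcon
          exact h ⟨x, y, Linked.refl x, Linked.refl y, hv, hcon⟩
      rcases this with rfl | rfl
      · exact Or.inl rfl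
      · exact Or.inr rfl
    · exact absurd ⟨i, (hv.trans hi).symm⟩ x.2
  · rcases hcase b with ⟨y, rfl⟩ | ⟨i', k', hk', hi', hlk', hak'⟩
    · exact absurd ⟨i, (hv.symm.trans hi).symm⟩ y.2
    · have hii : i = i' := P.vert_injective (hi.symm.trans (hv.trans hi'))
      subst hii
      rw [hlk, hlk'] at hab
      have hkk := hlab.corner_injective i k k' hk hk' (Sum.inl_injective hab)
      subst hkk
      exact (hak b).1 ((hak' b).2 (Or.inl rfl))

end

end SortedFlag

instance : Nonempty P.SortedFlag := ⟨SortedFlag.spoke (0, false)⟩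

open SortedFlag

/-- The transition system of the whole graph glued from an outer part and a transition code. -/
noncomputable def glue (σ : P.OuterFlag → P.OuterFlag) (t : Side → P.OuterFlag) (n : ℕ) (φ : G.Flag) :
    G.Flag := toFlag (next σ t n (Function.invFun toFlag φ))

variable {σ : P.OuterFlag → P.OuterFlag} {t : Side → P.OuterFlag} {n : ℕ}

theorem invFun_toFlag (a : P.SortedFlag) :
    Function.invFun toFlag (toFlag a) = a :=
  Function.leftInverse_invFun toFlag_injective a

theorem glue_toFlag (a : P.SortedFlag) : glue σ t n (toFlag a) = toFlag (next σ t n a) := by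
  rw [glue, invFun_toFlag]

theorem isTransition_glue (hP : P.IsProper) (hσ : P.IsOuterTransition σ)
    (ht : P.IsSideLabelling t) : G.IsTransition (glue σ t n) where
  involutive φ := by
    obtain ⟨a, rfl⟩ := toFlag_surjective hP φ
    rw [glue_toFlag, glue_toFlag, next_next hσ ht]
  edge_eq φ := by
    obtain ⟨a, rfl⟩ := toFlag_surjective hP φ
    rw [glue_toFlag, edge_next hσ ht]
  vtx_ne φ := by
    obtain ⟨a, rfl⟩ := toFlag_surjective hP φ
    rw [glue_toFlag]
    exact vtx_next_ne hσ ht a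

theorem outerPart_glue (hP : P.IsProper) (hσ : P.IsOuterTransition σ)
    (ht : P.IsSideLabelling t) : outerPart Subtype.val (glue σ t n) = σ := by
  have hj := hP.isOuterEmbedding_val
  have hT := isTransition_glue (n := n) hP hσ ht
  funext x
  by_cases hx : x.1.edge ∈ Set.range P.spoke
  · rw [hj.outerPart_of_mem hT hx, (hσ.fixed_iff x).2 hx]
  · apply Subtype.val_injective
    have h : ¬ ∃ s, t s = x := by
      rwa [← hσ.fixed_iff, (hσ.outerSystem ht).fixed_iff] at hx
    rw [(hj.outerPart_of_notMem hT hx).1]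
    change glue σ t n (toFlag (out x)) = _
    rw [glue_toFlag, next_of_ne h]
    rfl

/-- The bits 0 to 4 are read off from the flags on the spokes and the bits 5 to 9 from those on the
rim edges; below 1024 there are no others. -/
theorem glue_injective {n' : ℕ} (ht : P.IsSideLabelling t) (hn : n < 1024)
    (hn' : n' < 1024) (h : glue σ t n = glue σ t n') : n = n' := by
  have key : ∀ a : P.SortedFlag, next σ t n a = next σ t n' a := fun a => by
    apply toFlag_injective
    rw [← glue_toFlag, ← glue_toFlag, h]
  have h1 : ∀ i : Fin 5, n.testBit i.val = n'.testBit i.val := by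
    intro i
    have := key (SortedFlag.spoke (i, false))
    simp only [next, SortedFlag.out.injEq] at this
    have h2 := congrArg Prod.snd (ht.injective this)
    simpa [flipSide] using h2
  have h2 : ∀ i : Fin 5, n.testBit (5 + i.val) = n'.testBit (5 + i.val) := by
    intro i
    have := key (rimOut (i, false))
    simpa only [next, SortedFlag.rimIn.injEq, Prod.mk.injEq, true_and, Bool.false_bne] using this
  refine Nat.eq_of_testBit_eq fun k => ?_
  by_cases hk : k < 5
  · exact h1 ⟨k, hk⟩
  · by_cases hk' : k < 10
    · have := h2 ⟨k - 5, by omega⟩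
      simpa only [show 5 + (k - 5) = k by omega] using this
    · have hpow : 1024 ≤ 2 ^ k := by
        calc 1024 = 2 ^ 10 := by norm_num
          _ ≤ 2 ^ k := Nat.pow_le_pow_right (by norm_num) (by omega)
      rw [Nat.testBit_lt_two_pow (by omega), Nat.testBit_lt_two_pow (by omega)]

/-- The transition systems of the whole graph with a given outer part: a lower bound. -/
theorem pentagonCount_le_ncard (hP : P.IsProper) [Finite G.Flag] (hσ : P.IsOuterTransition σ)
    (ht : P.IsSideLabelling t) {lN : List ℕ × List ℕ} (hlN : lN ∈ pathPatterns) {D : List ℕ}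
    (hl : ∀ s s', Linked σ OuterFlag.swap (t s) (t s') ↔ pathAt lN.1 s = pathAt lN.1 s')
    (hD : ∀ s s', pathAt lN.1 s ≠ pathAt lN.1 s' →
      (pairCode (pathAt lN.1 s) (pathAt lN.1 s') ∈ D ↔
        ¬ Meets OuterFlag.swap (fun x => x.1.vtx) σ (t s) (t s'))) :
    pentagonCount lN.1 lN.2 D ≤
      {σ' ∈ G.circuitTransitions | outerPart (P := P) Subtype.val σ' = σ}.ncard := by
  classical
  set L := lN.2.filter fun n => (mergedPairs (walkLabels lN.1 n)).all fun c => D.contains c with hL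
  have hnodup : L.Nodup :=
    (of_decide_eq_true (List.all_eq_true.1 nodup_pathPatterns_codes lN hlN)).filter _
  have hgood : ∀ n ∈ L, n < 1024 ∧
      isWalkLabelling lN.1 n (walkLabels lN.1 n) = true := by
    intro n hn
    have h1 := List.all_eq_true.1 (List.all_eq_true.1 isWalkLabelling_walkLabels lN hlN) n
      (List.mem_of_mem_filter hn)
    rwa [Bool.and_eq_true, decide_eq_true_eq] at h1
  have hcard : pentagonCount lN.1 lN.2 D = (L.toFinset : Set ℕ).ncard := by
    rw [Set.ncard_coe_finset, List.toFinset_card_of_nodup hnodup, pentagonCount]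
  rw [hcard]
  refine Set.ncard_le_ncard_of_injOn (glue σ t) ?_ ?_ (Set.toFinite _)
  · intro n hn
    have hn' : n ∈ L := List.mem_toFinset.1 hn
    have hlab := walkLabelling_of_isWalkLabelling (hgood n hn').2
    refine ⟨⟨isTransition_glue hP hσ ht, ?_⟩, outerPart_glue hP hσ ht⟩
    have hm : ∀ s s', (walkLabels lN.1 n).getD (pathAt lN.1 s) 0 =
        (walkLabels lN.1 n).getD (pathAt lN.1 s') 0 → pathAt lN.1 s ≠ pathAt lN.1 s' →
        ¬ Meets OuterFlag.swap (fun x => x.1.vtx) σ (t s) (t s') := by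
      intro s s' h1 h2
      rw [← hD s s' h2]
      have h3 := pairCode_mem_mergedPairs (pathAt_lt hlN s) (pathAt_lt hlN s') h2 h1
      exact List.contains_iff_mem.1 (List.all_eq_true.1 (List.mem_filter.1 hn').2 _ h3)
    intro φ ψ hlink hv
    obtain ⟨a, rfl⟩ := toFlag_surjective hP φ
    obtain ⟨b, rfl⟩ := toFlag_surjective hP ψ
    -- The label is an invariant of the glued walks, so linked flags at one vertex have equal labels
    -- and hence form one corner.
    have hlabel := Linked.map_eq (fun φ => walkLabel σ t lN.1
      (fun k => (walkLabels lN.1 n).getD k 0) (Function.invFun toFlag φ)) (fun φ => by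
        obtain ⟨c, rfl⟩ := toFlag_surjective hP φ
        rw [glue_toFlag, invFun_toFlag, invFun_toFlag, walkLabel_next hl ht hlab]) (fun φ => by
        obtain ⟨c, rfl⟩ := toFlag_surjective hP φ
        rw [← toFlag_swap, invFun_toFlag, invFun_toFlag, walkLabel_swap hl]) hlink
    simp only [invFun_toFlag] at hlabel
    rcases eq_or_eq_swap_of_walkLabel_eq hl hσ hlab hm hlabel hv with rfl | rfl
    · exact Or.inl rfl
    · exact Or.inr (toFlag_swap a)
  · intro n hn n' hn' h
    exact glue_injective ht (hgood n (List.mem_toFinset.1 hn)).1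
      (hgood n' (List.mem_toFinset.1 hn')).1 h

end FiveCycle

end Graph

/-! ### The replacements as graphs. -/

namespace Graph

namespace FiveCycle

variable {α β : Type*} {G : Graph α β} {P : G.FiveCycle} {a b : Fin 5}

theorem collapse_eq_none {x : α} : P.collapse x = none ↔ x ∈ Set.range P.vert := by
  rw [collapse]
  split_ifs with h <;> simp [h]

theorem collapse_of_notMem {x : α} (h : x ∉ Set.range P.vert) : P.collapse x = some x :=
  if_neg h

theorem collapse_vert (i : Fin 5) : P.collapse (P.vert i) = none := if_pos ⟨i, rfl⟩

theorem collapse_eq_some {x y : α} : P.collapse x = some y ↔ x = y ∧ y ∉ Set.range P.vert := by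
  rw [collapse]
  split_ifs with h
  · constructor
    · intro h'; cases h'
    · rintro ⟨rfl, h'⟩; exact absurd h h'
  · constructor
    · rintro h'
      obtain rfl := Option.some.inj h'
      exact ⟨rfl, h⟩
    · rintro ⟨rfl, -⟩; rfl

theorem replace_isLink_some {e : β} {x y : Option α} : (P.replace a b).IsLink (some e) x y ↔
    (e ∉ Set.range P.rim ∧ e ≠ P.spoke a ∧ e ≠ P.spoke b) ∧
      ∃ u v, G.IsLink e u v ∧ P.collapse u = x ∧ P.collapse v = y := by
  change ((∃ e', some e = some e' ∧ _) ∨ (some e = none ∧ _)) ↔ _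
  constructor
  · rintro (⟨e', he, u, v, h, hu, hv⟩ | ⟨h, -⟩)
    · obtain rfl := Option.some.inj he
      have h' := h
      rw [deleteEdges_isLink] at h'
      simp only [Set.mem_union, Set.mem_insert_iff, Set.mem_singleton_iff, not_or] at h'
      exact ⟨h'.2, u, v, h'.1, hu, hv⟩
    · cases h
  · rintro ⟨he, u, v, h, hu, hv⟩
    refine Or.inl ⟨e, rfl, u, v, ?_, hu, hv⟩
    rw [deleteEdges_isLink]
    simp only [Set.mem_union, Set.mem_insert_iff, Set.mem_singleton_iff, not_or]
    exact ⟨h, he⟩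

theorem replace_isLink_none {x y : Option α} : (P.replace a b).IsLink none x y ↔
    s(x, y) = s(P.collapse (P.outer a), P.collapse (P.outer b)) := by
  change ((∃ e', none = some e' ∧ _) ∨ (none = none ∧ _)) ↔ _
  constructor
  · rintro (⟨e', h, -⟩ | ⟨-, h⟩)
    · cases h
    · exact h
  · exact fun h => Or.inr ⟨rfl, h⟩

theorem replace_comm (P : G.FiveCycle) (a b : Fin 5) : P.replace a b = P.replace b a := by
  refine Graph.ext rfl fun f x y => ?_
  cases f with
  | none => rw [replace_isLink_none, replace_isLink_none, Sym2.eq_swap (a := P.collapse (P.outer a))]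
  | some e =>
    rw [replace_isLink_some, replace_isLink_some, and_comm (a := e ≠ P.spoke a)]

theorem finite_vertexSet_replace (hV : G.vertexSet.Finite) : (P.replace a b).vertexSet.Finite :=
  hV.image _

theorem finite_edgeSet_replace (hE : G.edgeSet.Finite) : (P.replace a b).edgeSet.Finite := by
  refine ((hE.image some).insert none).subset fun f hf => ?_
  obtain ⟨x, y, h⟩ := exists_isLink_of_mem_edgeSet hf
  cases f with
  | none => exact Or.inl rfl
  | some e =>
    obtain ⟨-, u, v, h, -⟩ := replace_isLink_some.1 h
    exact Or.inr ⟨e, h.edge_mem, rfl⟩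

theorem replace_inc_some {e : β} {x : Option α} : (P.replace a b).Inc (some e) x ↔
    (e ∉ Set.range P.rim ∧ e ≠ P.spoke a ∧ e ≠ P.spoke b) ∧ ∃ u, G.Inc e u ∧ P.collapse u = x := by
  constructor
  · rintro ⟨y, h⟩
    obtain ⟨he, u, v, huv, hu, -⟩ := replace_isLink_some.1 h
    exact ⟨he, u, ⟨v, huv⟩, hu⟩
  · rintro ⟨he, u, ⟨v, huv⟩, hu⟩
    exact ⟨_, replace_isLink_some.2 ⟨he, u, v, huv, hu, rfl⟩⟩

theorem replace_inc_none {x : Option α} : (P.replace a b).Inc none x ↔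
    x = P.collapse (P.outer a) ∨ x = P.collapse (P.outer b) := by
  constructor
  · rintro ⟨y, h⟩
    rw [replace_isLink_none, Sym2.eq_iff] at h
    rcases h with h | h
    · exact Or.inl h.1
    · exact Or.inr h.1
  · rintro (rfl | rfl)
    · exact ⟨_, replace_isLink_none.2 rfl⟩
    · exact ⟨_, replace_isLink_none.2 Sym2.eq_swap⟩

open Classical in
/-- The edge of the graph `P.replace a b` that takes the place of an edge off the 5-cycle. -/
noncomputable def replacedEdge (P : G.FiveCycle) (a b : Fin 5) (e : β) : Option β :=
  if e = P.spoke a ∨ e = P.spoke b then none else some e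

theorem replacedEdge_eq_some {e e' : β} :
    P.replacedEdge a b e = some e' ↔ e = e' ∧ e' ≠ P.spoke a ∧ e' ≠ P.spoke b := by
  rw [replacedEdge]
  split_ifs with h
  · constructor
    · intro h'; cases h'
    · rintro ⟨rfl, h1, h2⟩
      exact absurd h (by simp [h1, h2])
  · rw [not_or] at h
    constructor
    · intro h'
      obtain rfl := Option.some.inj h'
      exact ⟨rfl, h⟩
    · rintro ⟨rfl, -⟩; rfl

theorem replacedEdge_eq_none {e : β} :
    P.replacedEdge a b e = none ↔ e = P.spoke a ∨ e = P.spoke b := by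
  rw [replacedEdge]
  split_ifs with h <;> simp [h]

theorem eq_outer_of_inc_spoke {i : Fin 5} {x : α} (hx : x ∉ Set.range P.vert)
    (h : G.Inc (P.spoke i) x) : x = P.outer i := by
  rcases inc_spoke.1 h with rfl | h
  · exact absurd ⟨i, rfl⟩ hx
  · exact h

theorem outer_notMem (hout : ∀ i j, P.outer i ≠ P.vert j) (i : Fin 5) : P.outer i ∉ Set.range P.vert := by
  rintro ⟨j, hj⟩
  exact hout i j hj.symm

theorem collapse_outer (hout : ∀ i j, P.outer i ≠ P.vert j) (i : Fin 5) : P.collapse (P.outer i) = some (P.outer i) :=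
  collapse_of_notMem (outer_notMem hout i)

/-- Seen from a vertex off the 5-cycle, the replacement only renames the spokes `a` and `b` to the
new edge. Nothing beyond the absence of chords is assumed, so that degenerate cases are covered too.
-/
theorem incidenceSet_replace_some (hout : ∀ i j, P.outer i ≠ P.vert j) {x : α}
    (hx : x ∉ Set.range P.vert) :
    (P.replace a b).incidenceSet (some x) = P.replacedEdge a b '' G.incidenceSet x := by
  ext f
  rw [mem_incidenceSet]
  constructor
  · intro hf
    cases f with
    | none =>
      rw [replace_inc_none, collapse_outer hout, collapse_outer hout] at hf
      rcases hf with hf | hf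
      · obtain rfl := Option.some.inj hf
        exact ⟨P.spoke a, inc_spoke.2 (Or.inr rfl), replacedEdge_eq_none.2 (Or.inl rfl)⟩
      · obtain rfl := Option.some.inj hf
        exact ⟨P.spoke b, inc_spoke.2 (Or.inr rfl), replacedEdge_eq_none.2 (Or.inr rfl)⟩
    | some e =>
      obtain ⟨he, u, hu, hux⟩ := replace_inc_some.1 hf
      obtain ⟨rfl, -⟩ := collapse_eq_some.1 hux
      exact ⟨e, hu, replacedEdge_eq_some.2 ⟨rfl, he.2⟩⟩
  · rintro ⟨e, he, rfl⟩
    by_cases h : e = P.spoke a ∨ e = P.spoke b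
    · rw [replacedEdge_eq_none.2 h, replace_inc_none, collapse_outer hout, collapse_outer hout]
      rcases h with rfl | rfl
      · exact Or.inl (by rw [eq_outer_of_inc_spoke hx he])
      · exact Or.inr (by rw [eq_outer_of_inc_spoke hx he])
    · rw [not_or] at h
      rw [replacedEdge_eq_some.2 ⟨rfl, h⟩, replace_inc_some]
      refine ⟨⟨?_, h⟩, x, he, collapse_of_notMem hx⟩
      rintro ⟨i, rfl⟩
      rcases inc_rim.1 he with rfl | rfl
      · exact hx ⟨_, rfl⟩
      · exact hx ⟨_, rfl⟩

namespace IsProper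

variable (hP : P.IsProper)
include hP

/-- Only the spokes `a` and `b` are identified, and they have different outer ends. -/
theorem injOn_replacedEdge (hab : a ≠ b) {x : α} (hx : x ∉ Set.range P.vert) :
    Set.InjOn (P.replacedEdge a b) (G.incidenceSet x) := by
  intro e he e' he' h
  cases h1 : P.replacedEdge a b e with
  | some d =>
    have h2 := h.symm.trans h1
    rw [(replacedEdge_eq_some.1 h1).1, (replacedEdge_eq_some.1 h2).1]
  | none =>
    have h2 := replacedEdge_eq_none.1 (h.symm.trans h1)
    have h1 := replacedEdge_eq_none.1 h1
    have hne := fun h => hab (hP.outer_injective h)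
    rcases h1 with rfl | rfl <;> rcases h2 with rfl | rfl
    · rfl
    · exact absurd ((eq_outer_of_inc_spoke hx he).symm.trans
        (eq_outer_of_inc_spoke hx he')) hne
    · exact absurd ((eq_outer_of_inc_spoke hx he').symm.trans
        (eq_outer_of_inc_spoke hx he)) hne
    · rfl

theorem exists_spoke_of_inc_vert {e : β} {i : Fin 5} (he : e ∉ Set.range P.rim)
    (h : G.Inc e (P.vert i)) : e = P.spoke i := by
  have h1 : e ∈ G.incidenceSet (P.vert i) := h
  rw [hP.incidenceSet_vert] at h1
  rcases h1 with h1 | h1 | h1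
  · exact absurd ⟨_, h1.symm⟩ he
  · exact absurd ⟨_, h1.symm⟩ he
  · exact h1

theorem replace_inc_none_vertex {f : Option β} :
    (P.replace a b).Inc f none ↔ ∃ c, c ≠ a ∧ c ≠ b ∧ f = some (P.spoke c) := by
  constructor
  · intro hf
    cases f with
    | none =>
      rw [replace_inc_none, collapse_outer hP.outer_ne_vert, collapse_outer hP.outer_ne_vert] at hf
      rcases hf with hf | hf <;> cases hf
    | some e =>
      obtain ⟨he, u, hu, hux⟩ := replace_inc_some.1 hf
      obtain ⟨c, rfl⟩ := collapse_eq_none.1 hux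
      obtain rfl := hP.exists_spoke_of_inc_vert he.1 hu
      exact ⟨c, fun h => he.2.1 (by rw [h]), fun h => he.2.2 (by rw [h]), rfl⟩
  · rintro ⟨c, hca, hcb, rfl⟩
    rw [replace_inc_some]
    refine ⟨⟨?_, fun h => hca (hP.spoke_injective h), fun h => hcb (hP.spoke_injective h)⟩,
      P.vert c, P.inc_spoke_self c, collapse_vert c⟩
    rintro ⟨i, hi⟩
    exact P.spoke_ne_rim _ _ hi.symm

theorem isLooplessCubic_replace (hab : a ≠ b) : (P.replace a b).IsLooplessCubic where
  not_isLoopAt f x hf := by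
    rw [← isLink_self_iff] at hf
    cases f with
    | none =>
      rw [replace_isLink_none, collapse_outer hP.outer_ne_vert, collapse_outer hP.outer_ne_vert, Sym2.eq_iff] at hf
      have h : P.outer a = P.outer b := by
        rcases hf with ⟨h1, h2⟩ | ⟨h1, h2⟩ <;> exact Option.some.inj (by rw [← h1, ← h2])
      exact hab (hP.outer_injective h)
    | some e =>
      obtain ⟨he, u, v, huv, hu, hv⟩ := replace_isLink_some.1 hf
      cases x with
      | some x =>
        obtain ⟨rfl, -⟩ := collapse_eq_some.1 hu
        obtain ⟨rfl, -⟩ := collapse_eq_some.1 hv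
        exact hP.cubic.not_isLoopAt _ _ huv
      | none =>
        obtain ⟨i, rfl⟩ := collapse_eq_none.1 hu
        obtain ⟨i', rfl⟩ := collapse_eq_none.1 hv
        obtain rfl := hP.exists_spoke_of_inc_vert he.1 huv.inc_left
        exact hP.outer_ne_vert i i' ((P.spoke_isLink i).right_unique huv)
  encard_incidenceSet x hx := by
    obtain ⟨u, hu, rfl⟩ := hx
    by_cases hr : u ∈ Set.range P.vert
    · rw [collapse_eq_none.2 hr]
      have h1 : (P.replace a b).incidenceSet none =
          (fun c => some (P.spoke c)) '' {c | c ≠ a ∧ c ≠ b} := by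
        ext f
        rw [mem_incidenceSet, hP.replace_inc_none_vertex]
        simp only [Set.mem_image, Set.mem_ofPred_eq]
        exact ⟨fun ⟨c, h1, h2, h3⟩ => ⟨c, ⟨h1, h2⟩, h3.symm⟩,
          fun ⟨c, ⟨h1, h2⟩, h3⟩ => ⟨c, h1, h2, h3.symm⟩⟩
      rw [h1, Function.Injective.encard_image
        (fun c c' h => hP.spoke_injective (Option.some.inj h))]
      have h2 : ({c | c ≠ a ∧ c ≠ b} : Set (Fin 5)) =
          ((Finset.univ.filter fun c => c ≠ a ∧ c ≠ b : Finset (Fin 5)) : Set (Fin 5)) := by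
        ext c; simp
      have h3 : (Finset.univ.filter fun c => c ≠ a ∧ c ≠ b : Finset (Fin 5)).card = 3 := by
        clear h1 h2
        revert a b
        decide
      rw [h2, Set.encard_coe_eq_coe_finsetCard, h3]
      rfl
    · rw [collapse_of_notMem hr, incidenceSet_replace_some hP.outer_ne_vert hr,
        (hP.injOn_replacedEdge hab hr).encard_image]
      exact hP.cubic.encard_incidenceSet u hu

/-- An outer flag as a flag of the graph `P.replace a b`. -/
noncomputable def replacedFlag (hab : a ≠ b) (x : P.OuterFlag) : (P.replace a b).Flag where
  vtx := some x.1.vtx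
  edge := P.replacedEdge a b x.1.edge
  other := P.replacedEdge a b x.1.other
  inc_edge := by
    rw [← mem_incidenceSet, incidenceSet_replace_some hP.outer_ne_vert x.2]
    exact ⟨_, x.1.inc_edge, rfl⟩
  inc_other := by
    rw [← mem_incidenceSet, incidenceSet_replace_some hP.outer_ne_vert x.2]
    exact ⟨_, x.1.inc_other, rfl⟩
  edge_ne_other h := x.1.edge_ne_other
    (hP.injOn_replacedEdge hab x.2 x.1.inc_edge x.1.inc_other h)

theorem exists_replacedFlag (hab : a ≠ b) (φ : (P.replace a b).Flag) {v : α}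
    (hφ : φ.vtx = some v) : ∃ x, hP.replacedFlag hab x = φ ∧ x.1.vtx = v := by
  have hv : v ∉ Set.range P.vert := by
    obtain ⟨u, -, hu⟩ := φ.inc_edge.vertex_mem
    exact (collapse_eq_some.1 (hu.trans hφ)).2
  have h1 : φ.edge ∈ (P.replace a b).incidenceSet (some v) := hφ ▸ φ.inc_edge
  have h2 : φ.other ∈ (P.replace a b).incidenceSet (some v) := hφ ▸ φ.inc_other
  rw [incidenceSet_replace_some hP.outer_ne_vert hv] at h1 h2
  obtain ⟨e, he, he'⟩ := h1
  obtain ⟨f, hf, hf'⟩ := h2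
  refine ⟨⟨⟨v, e, f, he, hf, fun h => φ.edge_ne_other ?_⟩, hv⟩, Flag.ext hφ.symm he' hf', rfl⟩
  rw [← he', ← hf', h]

theorem replacedFlag_injective (hab : a ≠ b) : Function.Injective (hP.replacedFlag hab) := by
  intro x y h
  have hv : x.1.vtx = y.1.vtx := Option.some.inj (congrArg Flag.vtx h)
  have hy := y.1.inc_edge
  have hy' := y.1.inc_other
  rw [← hv] at hy hy'
  exact Subtype.ext (Flag.ext hv
    (hP.injOn_replacedEdge hab x.2 x.1.inc_edge hy (congrArg Flag.edge h))
    (hP.injOn_replacedEdge hab x.2 x.1.inc_other hy' (congrArg Flag.other h)))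

theorem isOuterEmbedding_replacedFlag (hab : a ≠ b) :
    IsOuterEmbedding (hP.replacedFlag hab) where
  injective := hP.replacedFlag_injective hab
  map_swap _ := rfl
  map_vtx _ _ h := congrArg some h
  exists_next σ hσ x hx := by
    have hedge : P.replacedEdge a b x.1.edge = some x.1.edge :=
      replacedEdge_eq_some.2 ⟨rfl, fun h => hx ⟨a, h.symm⟩, fun h => hx ⟨b, h.symm⟩⟩
    have hlink := hσ.isLink (hP.replacedFlag hab x)
    change (P.replace a b).IsLink (P.replacedEdge a b x.1.edge) _ _ at hlink
    rw [hedge] at hlink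
    obtain ⟨he, u, v, huv, hu, hv⟩ := replace_isLink_some.1 hlink
    have hvr : v ∉ Set.range P.vert := by
      rintro ⟨i, rfl⟩
      exact hx ⟨i, (hP.exists_spoke_of_inc_vert he.1 huv.inc_right).symm⟩
    rw [collapse_of_notMem hvr] at hv
    obtain ⟨y, hy, -⟩ := hP.exists_replacedFlag hab _ hv.symm
    refine ⟨y, hy.symm, ?_⟩
    have h1 := hσ.edge_eq (hP.replacedFlag hab x)
    rw [← hy] at h1
    exact (replacedEdge_eq_some.1 (h1.trans hedge)).1
  -- Two outer flags that start with the same spoke sit at the same vertex, whereas a transition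
  -- changes the vertex.
  not_exists_next σ hσ x hx := by
    rintro ⟨y, h1, h2⟩
    obtain ⟨i, hi⟩ := hx
    have h3 := OuterFlag.vtx_of_edge_eq_spoke hi.symm
    have h4 := OuterFlag.vtx_of_edge_eq_spoke (h2.trans hi.symm)
    refine hσ.vtx_ne (hP.replacedFlag hab x) ?_
    rw [h1]
    change some y.1.vtx = some x.1.vtx
    rw [h3, h4]

end IsProper

end FiveCycle

end Graph

/-! ### Joining sides by the new edge and the new vertex: the upper bound. -/

namespace Graph

namespace FiveCycle

variable {α β : Type*} {G : Graph α β} {P : G.FiveCycle} {a b : Fin 5}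

namespace IsProper

variable (hP : P.IsProper) (hab : a ≠ b) {σ : (P.replace a b).Flag → (P.replace a b).Flag}
  {t : Side → P.OuterFlag}

/-- The transition system `σ` joins the sides `s` and `s'` by the new edge or across the new
vertex. -/
def Joins (t : Side → P.OuterFlag) (σ : (P.replace a b).Flag → (P.replace a b).Flag)
    (s s' : Side) : Prop :=
  σ (hP.replacedFlag hab (t s)) = hP.replacedFlag hab (t s') ∨
    ((σ (hP.replacedFlag hab (t s))).vtx = none ∧
      σ (σ (hP.replacedFlag hab (t s))).swap = hP.replacedFlag hab (t s'))

theorem Joins.symm (hσ : (P.replace a b).IsTransition σ) {s s' : Side}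
    (h : hP.Joins hab t σ s s') : hP.Joins hab t σ s' s := by
  rcases h with h | ⟨h1, h2⟩
  · exact Or.inl (by rw [← h, hσ.involutive])
  · refine Or.inr ?_
    rw [← h2, hσ.involutive, Flag.swap_swap, hσ.involutive]
    exact ⟨h1, rfl⟩

theorem Joins.unique (ht : P.IsSideLabelling t) {s s' s'' : Side} (h : hP.Joins hab t σ s s')
    (h' : hP.Joins hab t σ s s'') : s' = s'' := by
  apply ht.injective
  apply hP.replacedFlag_injective hab
  rcases h with h | ⟨h1, h2⟩ <;> rcases h' with h' | ⟨h1', h2'⟩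
  · exact h.symm.trans h'
  · rw [h] at h1'
    cases h1'
  · rw [h'] at h1
    cases h1
  · exact h2.symm.trans h2'

theorem Joins.linked {s s' : Side} (h : hP.Joins hab t σ s s') :
    Linked σ Flag.swap (hP.replacedFlag hab (t s)) (hP.replacedFlag hab (t s')) := by
  rcases h with h | ⟨-, h⟩
  · rw [← h]
    exact Linked.fst _
  · rw [← h]
    exact (Linked.fst _).trans ((Linked.snd _).trans (Linked.fst _))

include hP in
theorem replacedEdge_spoke_of_ne {c : Fin 5} (hca : c ≠ a) (hcb : c ≠ b) :
    P.replacedEdge a b (P.spoke c) = some (P.spoke c) :=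
  replacedEdge_eq_some.2
    ⟨rfl, fun h => hca (hP.spoke_injective h), fun h => hcb (hP.spoke_injective h)⟩

theorem exists_side_of_edge_eq_spoke (ht : P.IsSideLabelling t) (φ : (P.replace a b).Flag)
    {c : Fin 5} (hv : φ.vtx ≠ none)
    (he : φ.edge = some (P.spoke c)) : ∃ k, hP.replacedFlag hab (t (c, k)) = φ := by
  obtain ⟨v, hv⟩ := Option.ne_none_iff_exists'.1 hv
  obtain ⟨x, rfl, -⟩ := hP.exists_replacedFlag hab φ hv
  obtain ⟨k, hk⟩ := ht.exists_of_edge x c (replacedEdge_eq_some.1 he).1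
  exact ⟨k, by rw [hk]⟩

/-- A walk on spoke `a` or `b` runs along the new edge to the other of the two. A walk on any other
spoke enters the new vertex and leaves it by a different one of its three spokes. These are the
alternatives allowed by `replacementRel`. -/
theorem exists_joins (hσ : (P.replace a b).IsTransition σ) (ht : P.IsSideLabelling t) (s : Side) :
    ∃ s', replacementRel a b s s' = true ∧ hP.Joins hab t σ s s' := by
  have hedge := hσ.edge_eq (hP.replacedFlag hab (t s))
  have hlink := hσ.isLink (hP.replacedFlag hab (t s))
  change _ = P.replacedEdge a b (t s).1.edge at hedge
  change (P.replace a b).IsLink (P.replacedEdge a b (t s).1.edge) (some (t s).1.vtx) _ at hlink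
  rw [ht.edge_eq] at hedge hlink
  rw [ht.vtx_eq] at hlink
  by_cases hs : s.1 = a ∨ s.1 = b
  · have hnone : P.replacedEdge a b (P.spoke s.1) = none :=
      replacedEdge_eq_none.2 (hs.imp (congrArg P.spoke) (congrArg P.spoke))
    rw [hnone] at hedge hlink
    rw [replace_isLink_none, collapse_outer hP.outer_ne_vert, collapse_outer hP.outer_ne_vert, Sym2.eq_iff] at hlink
    obtain ⟨c, hc, hcs, hv⟩ : ∃ c, (c = a ∨ c = b) ∧ c ≠ s.1 ∧
        (σ (hP.replacedFlag hab (t s))).vtx = some (P.outer c) := by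
      rcases hlink with ⟨h1, h2⟩ | ⟨h1, h2⟩
      · have := hP.outer_injective (Option.some.inj h1)
        exact ⟨b, Or.inr rfl, by rw [this]; exact hab.symm, h2⟩
      · have := hP.outer_injective (Option.some.inj h1)
        exact ⟨a, Or.inl rfl, by rw [this]; exact hab, h2⟩
    obtain ⟨y, hy, hyv⟩ := hP.exists_replacedFlag hab _ hv
    have hye : y.1.edge = P.spoke c := by
      rw [← hy] at hedge
      have key : ∀ d, y.1.edge = P.spoke d → d = c := fun d hd =>
        hP.outer_injective ((OuterFlag.vtx_of_edge_eq_spoke hd).symm.trans hyv)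
      rcases replacedEdge_eq_none.1 hedge with h | h
      · rw [h, key a h]
      · rw [h, key b h]
    obtain ⟨k, hk⟩ := ht.exists_of_edge y c hye
    refine ⟨(c, k), ?_, Or.inl (by rw [hk, hy])⟩
    have h1 : (s.1 == a || s.1 == b) = true := by simpa using hs
    have h2 : (c == a || c == b) = true := by simpa using hc
    simp only [replacementRel, h1, h2, Bool.and_eq_true, bne_iff_ne]
    exact ⟨hcs.symm, rfl⟩
  · rw [not_or] at hs
    rw [hP.replacedEdge_spoke_of_ne hs.1 hs.2] at hedge hlink
    have hnone : ∀ c, ∀ x y, (P.replace a b).IsLink (some (P.spoke c)) x y → x = none ∨ y = none := by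
      intro c x y h
      obtain ⟨-, u, v, huv, rfl, rfl⟩ := replace_isLink_some.1 h
      rcases (P.spoke_isLink c).left_eq_or_eq huv with h | h
      · exact Or.inl (h ▸ collapse_vert c)
      · exact Or.inr (h ▸ collapse_vert c)
    have hv : (σ (hP.replacedFlag hab (t s))).vtx = none :=
      (hnone _ _ _ hlink).resolve_left (by simp)
    set ψ := σ (hP.replacedFlag hab (t s)) with hψ
    have hother := ψ.inc_other
    rw [hv, hP.replace_inc_none_vertex] at hother
    obtain ⟨c, hca, hcb, hc⟩ := hother
    have hcs : s.1 ≠ c := fun h => ψ.edge_ne_other (by rw [hedge, hc, h])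
    have hne : (σ ψ.swap).vtx ≠ none := fun h => hσ.vtx_ne ψ.swap (by rw [h, Flag.swap_vtx, hv])
    obtain ⟨k, hk⟩ := hP.exists_side_of_edge_eq_spoke hab ht (σ ψ.swap) hne
      (by rw [hσ.edge_eq, Flag.swap_edge, hc])
    refine ⟨(c, k), ?_, Or.inr ⟨hv, hk.symm⟩⟩
    have h1 : (s.1 == a || s.1 == b) = false := by simpa using hs
    have h2 : (c == a || c == b) = false := by simpa using ⟨hca, hcb⟩
    simp only [replacementRel, h1, h2, Bool.and_eq_true, bne_iff_ne]
    exact ⟨hcs, rfl⟩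

/-- A transition system is determined by its outer part and the pairs of sides it joins. -/
theorem eq_of_joins_iff (ht : P.IsSideLabelling t)
    {σ' : (P.replace a b).Flag → (P.replace a b).Flag} (hσ : (P.replace a b).IsTransition σ)
    (hσ' : (P.replace a b).IsTransition σ')
    (hout : outerPart (hP.replacedFlag hab) σ = outerPart (hP.replacedFlag hab) σ')
    (hjoin : ∀ s, ∃ s', hP.Joins hab t σ s s' ∧ hP.Joins hab t σ' s s') : σ = σ' := by
  have hj := hP.isOuterEmbedding_replacedFlag hab
  have houter : ∀ x, σ (hP.replacedFlag hab x) = σ' (hP.replacedFlag hab x) := by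
    intro x
    by_cases hx : x.1.edge ∈ Set.range P.spoke
    · obtain ⟨i, hi⟩ := hx
      obtain ⟨k, rfl⟩ := ht.exists_of_edge x i hi.symm
      obtain ⟨s', h, h'⟩ := hjoin (i, k)
      have hv : (σ (hP.replacedFlag hab (t (i, k)))).vtx = (σ' (hP.replacedFlag hab (t (i, k)))).vtx :=
        (hσ.isLink _).right_unique (hσ'.isLink _)
      rcases h with h | ⟨h1, h2⟩ <;> rcases h' with h' | ⟨h1', h2'⟩
      · rw [h, h']
      · rw [h, h1'] at hv
        cases hv
      · rw [h', h1] at hv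
        cases hv
      -- Both systems reach the new vertex along the same edge, and the second edge of the flag
      -- there is the spoke of the common side that is reached next.
      · refine Flag.ext hv (by rw [hσ.edge_eq, hσ'.edge_eq]) ?_
        rw [← Flag.swap_edge, ← hσ.edge_eq, h2, ← h2', hσ'.edge_eq, Flag.swap_edge]
    · rw [← (hj.outerPart_of_notMem hσ hx).1, ← (hj.outerPart_of_notMem hσ' hx).1, hout]
  funext φ
  cases hv : φ.vtx with
  | some v =>
    obtain ⟨x, rfl, -⟩ := hP.exists_replacedFlag hab φ hv
    exact houter x
  | none =>
    have h1 : (σ φ).vtx ≠ none := fun h => hσ.vtx_ne φ (by rw [h, hv])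
    obtain ⟨v, hv'⟩ := Option.ne_none_iff_exists'.1 h1
    obtain ⟨x, hx, -⟩ := hP.exists_replacedFlag hab _ hv'
    have h2 := houter x
    rw [hx, hσ.involutive, ← hx] at h2
    rw [← hx, h2, hσ'.involutive]

/-- The transition systems of `P.replace a b` with a given outer part: an upper bound. -/
theorem ncard_le_replacementCount {ς : P.OuterFlag → P.OuterFlag} (ht : P.IsSideLabelling t)
    {f : ℕ} {l D : List ℕ}
    (hf : ∀ s s', Linked ς OuterFlag.swap (t (flipSide f s)) (t (flipSide f s')) ↔
      pathAt l s = pathAt l s')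
    (hDs : D ∈ (spokeDisjointPairs l).sublists)
    (hD : ∀ s s', pathAt l s ≠ pathAt l s' → (pairCode (pathAt l s) (pathAt l s') ∈ D ↔
      ¬ Meets OuterFlag.swap (fun x => x.1.vtx) ς (t (flipSide f s)) (t (flipSide f s')))) :
    {σ ∈ (P.replace a b).circuitTransitions | outerPart (hP.replacedFlag hab) σ = ς}.ncard ≤
      replacementCount l D a b := by
  have hj := hP.isOuterEmbedding_replacedFlag hab
  have hex : ∀ σ, (P.replace a b).IsTransition σ → ∀ s, ∃ s', replacementRel a b s s' = true ∧
      hP.Joins hab t σ s s' := fun σ hσ s => hP.exists_joins hab hσ ht s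
  choose! γ hγ hγ' using hex
  refine OuterSystem.ncard_le_replacementCount hf hDs hD a b _ γ ?_ ?_
  · rintro σ ⟨hσ, ho⟩ σ' ⟨hσ', ho'⟩ h
    refine hP.eq_of_joins_iff hab ht hσ.1 hσ'.1 (ho.trans ho'.symm) fun s => ⟨γ σ s, hγ' σ hσ.1 s, ?_⟩
    rw [h]
    exact hγ' σ' hσ'.1 s
  · rintro σ ⟨hσ, rfl⟩
    refine ⟨fun s => ?_, hγ σ hσ.1, fun x y => Linked σ Flag.swap (hP.replacedFlag hab x)
      (hP.replacedFlag hab y), ⟨fun _ => Linked.refl _, Linked.symm, Linked.trans⟩,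
      fun x y h => hj.linked_map hσ.1 h, fun s => (hγ' σ hσ.1 s).linked, fun x y h hv => ?_⟩
    · exact Joins.unique hP hab ht (hγ' σ hσ.1 (γ σ s)) ((hγ' σ hσ.1 s).symm hP hab hσ.1)
    · rcases hσ.2 _ _ h (hj.map_vtx _ _ hv) with h1 | h1
      · exact Or.inl (hj.injective h1)
      · exact Or.inr (hj.injective (h1.trans (hj.map_swap x).symm))

include hP in
/-- The weighted count of circuit double covers of the ten replacements. -/
theorem weighted_sum_le (hV : G.vertexSet.Finite) (hE : G.edgeSet.Finite) :
    2 * ∑ i : Fin 5, (P.replace i (i + 1)).numCircuitDoubleCovers +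
      ∑ i : Fin 5, (P.replace i (i + 2)).numCircuitDoubleCovers ≤ 4 * G.numCircuitDoubleCovers := by
  classical
  have hX : Finite P.OuterFlag := OuterFlag.finite hV hE
  have hF : Finite G.Flag := Flag.finite hV hE
  obtain ⟨t, ht⟩ := hP.exists_isSideLabelling
  have hOfin : {ς | P.IsOuterTransition ς}.Finite := Set.toFinite _
  set O := hOfin.toFinset with hOdef
  have hO : ∀ ς, ς ∈ O ↔ P.IsOuterTransition ς := fun ς => hOfin.mem_toFinset
  have hrep : ∀ (a b : Fin 5) (hab : a ≠ b), (P.replace a b).numCircuitDoubleCovers =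
      ∑ ς ∈ O, {σ ∈ (P.replace a b).circuitTransitions |
        outerPart (hP.replacedFlag hab) σ = ς}.ncard := by
    intro a b hab
    have hFab : Finite (P.replace a b).Flag :=
      Flag.finite (finite_vertexSet_replace hV) (finite_edgeSet_replace hE)
    rw [(hP.isLooplessCubic_replace hab).numCircuitDoubleCovers_eq
      (finite_vertexSet_replace hV) (finite_edgeSet_replace hE),
      (hP.isOuterEmbedding_replacedFlag hab).ncard_eq_sum O hO]
  rw [hP.cubic.numCircuitDoubleCovers_eq hV hE, hP.isOuterEmbedding_val.ncard_eq_sum O hO]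
  have h1 : ∀ i : Fin 5, i ≠ i + 1 := by decide
  have h2 : ∀ i : Fin 5, i ≠ i + 2 := by decide
  simp_rw [fun i : Fin 5 => hrep i (i + 1) (h1 i), fun i : Fin 5 => hrep i (i + 2) (h2 i)]
  -- After exchanging the sums it suffices to compare extensions of a single outer part.
  rw [Finset.sum_comm, Finset.sum_comm (s := Finset.univ) (t := O), Finset.mul_sum, Finset.mul_sum,
    ← Finset.sum_add_distrib]
  refine Finset.sum_le_sum fun ς hς => ?_
  have hς' := (hO ς).1 hς
  have hsys := hς'.outerSystem ht
  -- One pattern and one `D` serve all ten upper bounds and the lower bound. The exchange `f` is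
  -- absorbed into the side labelling for the latter.
  obtain ⟨f, lN, hlN, hf⟩ := hsys.exists_normalForm
  obtain ⟨D, hDs, hD⟩ := hsys.exists_disjointPairs hlN hf
  have hup : ∀ (a b : Fin 5) (hab : a ≠ b), {σ ∈ (P.replace a b).circuitTransitions |
      outerPart (hP.replacedFlag hab) σ = ς}.ncard ≤ replacementCount lN.1 D a b :=
    fun a b hab => hP.ncard_le_replacementCount hab ht hf hDs hD
  have hlow := pentagonCount_le_ncard hP hς' (ht.comp_flipSide f) hlN hf hD
  have hmain := of_decide_eq_true (List.all_eq_true.1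
    (List.all_eq_true.1 weighted_replacementCount_le lN hlN) D hDs)
  have hs1 := Finset.sum_le_sum fun (i : Fin 5) (_ : i ∈ Finset.univ) => hup i (i + 1) (h1 i)
  have hs2 := Finset.sum_le_sum fun (i : Fin 5) (_ : i ∈ Finset.univ) => hup i (i + 2) (h2 i)
  have e1 : ∑ i : Fin 5, replacementCount lN.1 D i (i + 1) =
      replacementCount lN.1 D 0 1 + replacementCount lN.1 D 1 2 + replacementCount lN.1 D 2 3
        + replacementCount lN.1 D 3 4 + replacementCount lN.1 D 4 0 := by
    rw [Fin.sum_univ_five]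
    rfl
  have e2 : ∑ i : Fin 5, replacementCount lN.1 D i (i + 2) =
      replacementCount lN.1 D 0 2 + replacementCount lN.1 D 1 3 + replacementCount lN.1 D 2 4
        + replacementCount lN.1 D 3 0 + replacementCount lN.1 D 4 1 := by
    rw [Fin.sum_univ_five]
    rfl
  omega

end IsProper

end FiveCycle

end Graph

/-! ### Degenerate 5-cycles. -/

namespace Graph

variable {α β : Type*} {G : Graph α β}

/-- Four distinct vertices, cyclically joined by edges, form a 4-cycle. -/
theorem hasCycleOfLength_four {w : Fin 4 → α} {e : Fin 4 → β} (hw : Function.Injective w)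
    (he : ∀ i, G.IsLink (e i) (w i) (w (i + 1))) : G.HasCycleOfLength 4 := by
  have hinj : ∀ i j, e i = e j → i = j := by
    intro i j h
    have h1 := he i
    rw [h] at h1
    rcases h1.eq_and_eq_or_eq_and_eq (he j) with ⟨h2, -⟩ | ⟨h2, h3⟩
    · exact hw h2
    · have h4 := hw h2
      have h5 := hw h3
      rw [h4] at h5
      exact absurd h5 ((by decide : ∀ j : Fin 4, j + 1 + 1 ≠ j) j)
  let C : Graph α β :=
    { vertexSet := Set.range w
      IsLink := fun f x y => G.IsLink f x y ∧ f ∈ Set.range e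
      isLink_symm := fun f _ => ⟨fun x y h => ⟨h.1.symm, h.2⟩⟩
      eq_or_eq_of_isLink_of_isLink := fun f x y z u h h' => h.1.left_eq_or_eq h'.1
      left_mem_of_isLink := by
        rintro f x y ⟨h, i, rfl⟩
        rcases h.left_eq_or_eq (he i) with rfl | rfl
        exacts [⟨_, rfl⟩, ⟨_, rfl⟩] }
  have hCle : C ≤ G := by
    refine ⟨?_, fun f x y h => h.1⟩
    rintro x ⟨i, rfl⟩
    exact (he i).left_mem
  have hlink : ∀ i, C.IsLink (e i) (w i) (w (i + 1)) := fun i => ⟨he i, i, rfl⟩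
  refine ⟨C, hCle, ⟨Set.finite_range w, ⟨⟨w 0, 0, rfl⟩, ?_⟩, ?_⟩, ?_⟩
  · have hstep : ∀ i, Relation.ReflTransGen C.Adj (w i) (w (i + 1)) := fun i =>
      Relation.ReflTransGen.single ⟨e i, hlink i⟩
    have h0 : ∀ i, Relation.ReflTransGen C.Adj (w 0) (w i) := by
      have h1 := hstep 0
      have h2 := h1.trans (hstep 1)
      have h3 := h2.trans (hstep 2)
      intro i
      fin_cases i
      exacts [.refl, h1, h2, h3]
    rintro _ ⟨i, rfl⟩ _ ⟨j, rfl⟩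
    exact Relation.ReflTransGen.trans (Std.Symm.symm _ _ (h0 i)) (h0 j)
  · rintro _ ⟨i, rfl⟩
    have hinc : C.incidenceSet (w i) = {e i, e (i - 1)} := by
      ext f
      constructor
      · rintro ⟨y, h, j, rfl⟩
        rcases h.left_eq_or_eq (he j) with h1 | h1
        · exact Or.inl (by rw [hw h1])
        · exact Or.inr (by rw [hw h1, add_sub_cancel_right]; rfl)
      · rintro (rfl | rfl)
        · exact (hlink i).inc_left
        · have := (hlink (i - 1)).inc_right
          rwa [sub_add_cancel] at this
    have hloop : C.loopSet (w i) = ∅ := by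
      rw [Set.eq_empty_iff_forall_notMem]
      rintro f ⟨h, j, rfl⟩
      have hne : w j ≠ w (j + 1) := fun h1 =>
        (by decide : ∀ j : Fin 4, j ≠ j + 1) j (hw h1)
      rcases h.eq_and_eq_or_eq_and_eq (he j) with ⟨h1, h2⟩ | ⟨h1, h2⟩
      · exact hne (h1.symm.trans h2)
      · exact hne (h2.symm.trans h1)
    have hne : e i ≠ e (i - 1) := fun h =>
      (by decide : ∀ j : Fin 4, j ≠ j - 1) i (hinj _ _ h)
    rw [degree, hinc, hloop, Set.encard_pair hne]
    simp
  · change (Set.range w).encard = _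
    rw [← Set.image_univ, hw.encard_image]
    simp

/-- A vertex of degree three with a loop has exactly one edge that is not a loop. -/
theorem exists_nonloop_of_degree_eq_three {e : β} {x : α} (hd : G.degree x = 3)
    (he : G.IsLoopAt e x) :
    ∃ f, G.IsNonloopAt f x ∧ ∀ e, G.Inc e x → e = f ∨ G.IsLoopAt e x := by
  have hsplit : (G.incidenceSet x).encard =
      (G.incidenceSet x \ G.loopSet x).encard + (G.loopSet x).encard :=
    (Set.encard_sdiff_add_encard_of_subset (G.loopSet_subset_incidenceSet x)).symm
  have hpos : 1 ≤ (G.loopSet x).encard := Set.one_le_encard_iff_nonempty.2 ⟨e, he⟩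
  rw [degree, hsplit] at hd
  have hone : (G.incidenceSet x \ G.loopSet x).encard = 1 := by
    generalize (G.incidenceSet x \ G.loopSet x).encard = N at hd
    generalize (G.loopSet x).encard = L at hd hpos
    cases N with
    | top => exact absurd hd (by simp)
    | coe n =>
      cases L with
      | top => exact absurd hd (by simp)
      | coe m =>
        norm_cast at hd hpos ⊢
        omega
  obtain ⟨f, hf⟩ := Set.encard_eq_one.1 hone
  have hfm : f ∈ G.incidenceSet x \ G.loopSet x := by rw [hf]; rfl
  refine ⟨f, isNonloopAt_iff_inc_not_isLoopAt.2 hfm, fun e he => ?_⟩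
  by_cases h : G.IsLoopAt e x
  · exact Or.inr h
  · left
    have : e ∈ G.incidenceSet x \ G.loopSet x := ⟨he, h⟩
    rwa [hf] at this

namespace FiveCycle

variable {P : G.FiveCycle}

/-- The two rim edges and the spoke already exhaust the degree three, which leaves no room for a
loop. -/
theorem encard_incidenceSet_vert (hcubic : G.IsCubic) (i : Fin 5) :
    (G.incidenceSet (P.vert i)).encard = 3 ∧ G.loopSet (P.vert i) = ∅ := by
  have hd := hcubic (P.vert i) (P.rim_isLink i).left_mem
  have hsub : ({P.rim (i - 1), P.rim i, P.spoke i} : Set β) ⊆ G.incidenceSet (P.vert i) := by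
    rintro e (rfl | rfl | rfl)
    exacts [P.inc_rim_sub_one i, P.inc_rim_self i, P.inc_spoke_self i]
  have h3 : (3 : ℕ∞) ≤ (G.incidenceSet (P.vert i)).encard := by
    rw [← Set.encard_eq_three.2
      ⟨_, _, _, P.rim_sub_one_ne i, (P.spoke_ne_rim _ _).symm, (P.spoke_ne_rim _ _).symm, rfl⟩]
    exact Set.encard_le_encard hsub
  rw [degree] at hd
  rw [← Set.encard_eq_zero]
  generalize (G.incidenceSet (P.vert i)).encard = N at hd h3
  generalize (G.loopSet (P.vert i)).encard = L at hd
  cases N with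
  | top => exact absurd hd (by simp)
  | coe n =>
    cases L with
    | top => exact absurd hd (by simp)
    | coe m =>
      norm_cast at hd h3 ⊢
      omega

theorem spoke_eq_of_inc (hcubic : G.IsCubic) {i j : Fin 5} (h : G.Inc (P.spoke i) (P.vert j)) :
    P.spoke i = P.spoke j := by
  have h1 : P.spoke i ∈ G.incidenceSet (P.vert j) := h
  rw [P.incidenceSet_vert_of_encard (encard_incidenceSet_vert hcubic j).1] at h1
  rcases h1 with h1 | h1 | h1
  · exact absurd h1 (P.spoke_ne_rim _ _)
  · exact absurd h1 (P.spoke_ne_rim _ _)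
  · exact h1

theorem outer_ne_vert_self (hcubic : G.IsCubic) (i : Fin 5) : P.outer i ≠ P.vert i := by
  intro h
  have h1 := P.spoke_isLink i
  rw [h] at h1
  have h2 : P.spoke i ∈ G.loopSet (P.vert i) := h1
  rw [(encard_incidenceSet_vert hcubic i).2] at h2
  exact h2

/-- The only edge at `vert j` off the rim is its spoke, so a chord is the spoke of both its ends. -/
theorem outer_eq_vert_symm (hcubic : G.IsCubic) {i j : Fin 5} (h : P.outer i = P.vert j) :
    P.spoke i = P.spoke j ∧ P.outer j = P.vert i := by
  have h1 : P.spoke i = P.spoke j := spoke_eq_of_inc hcubic (inc_spoke.2 (Or.inr h.symm))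
  refine ⟨h1, ?_⟩
  have h2 := P.spoke_isLink j
  have h3 := P.spoke_isLink i
  rw [← h1] at h2
  rw [h] at h3
  exact h2.right_unique h3.symm

/-- Such a chord and the three rim edges on the longer side would form a 4-cycle. -/
theorem outer_ne_vert_add_two (h4 : ¬ G.HasCycleOfLength 4) (i : Fin 5) :
    P.outer i ≠ P.vert (i + 2) := by
  intro h
  refine h4 (hasCycleOfLength_four (w := ![P.vert i, P.vert (i + 2), P.vert (i + 3), P.vert (i + 4)])
    (e := ![P.spoke i, P.rim (i + 2), P.rim (i + 3), P.rim (i + 4)]) ?_ ?_)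
  · have h1 : (![P.vert i, P.vert (i + 2), P.vert (i + 3), P.vert (i + 4)] : Fin 4 → α) =
        P.vert ∘ ![i, i + 2, i + 3, i + 4] := by
      funext k; fin_cases k <;> rfl
    rw [h1]
    exact P.vert_injective.comp
      ((by decide : ∀ i : Fin 5, Function.Injective ![i, i + 2, i + 3, i + 4]) i)
  · have e1 := P.rim_isLink (i + 2)
    have e2 := P.rim_isLink (i + 3)
    have e3 := P.rim_isLink (i + 4)
    rw [(by decide : ∀ i : Fin 5, i + 2 + 1 = i + 3) i] at e1
    rw [(by decide : ∀ i : Fin 5, i + 3 + 1 = i + 4) i] at e2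
    rw [(by decide : ∀ i : Fin 5, i + 4 + 1 = i) i] at e3
    intro k
    fin_cases k
    exacts [h ▸ P.spoke_isLink i, e1, e2, e3]

/-- Two rim edges and the two spokes would form a 4-cycle. -/
theorem outer_ne_outer_add_two (h4 : ¬ G.HasCycleOfLength 4)
    (hout : ∀ i j, P.outer i ≠ P.vert j) (i : Fin 5) : P.outer i ≠ P.outer (i + 2) := by
  intro h
  refine h4 (hasCycleOfLength_four (w := ![P.vert i, P.vert (i + 1), P.vert (i + 2), P.outer i])
    (e := ![P.rim i, P.rim (i + 1), P.spoke (i + 2), P.spoke i]) ?_ ?_)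
  · have hv : ∀ {a b : Fin 5}, a ≠ b → P.vert a ≠ P.vert b := fun hab =>
      P.vert_injective.ne_iff.2 hab
    have h01 : P.vert i ≠ P.vert (i + 1) := hv ((by decide : ∀ i : Fin 5, i ≠ i + 1) i)
    have h02 : P.vert i ≠ P.vert (i + 2) := hv ((by decide : ∀ i : Fin 5, i ≠ i + 2) i)
    have h12 : P.vert (i + 1) ≠ P.vert (i + 2) :=
      hv ((by decide : ∀ i : Fin 5, i + 1 ≠ i + 2) i)
    intro k k' hkk
    fin_cases k <;> fin_cases k' <;>
    first
    | rfl
    | exact absurd hkk h01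
    | exact absurd hkk h02
    | exact absurd hkk h12
    | exact absurd hkk.symm h01
    | exact absurd hkk.symm h02
    | exact absurd hkk.symm h12
    | exact absurd hkk (hout _ _)
    | exact absurd hkk.symm (hout _ _)
  · have e1 := P.rim_isLink (i + 1)
    rw [(by decide : ∀ i : Fin 5, i + 1 + 1 = i + 2) i] at e1
    intro k
    fin_cases k
    exacts [P.rim_isLink i, e1, h ▸ P.spoke_isLink (i + 2), (P.spoke_isLink i).symm]

theorem fin_five_cases : ∀ i j : Fin 5, j = i ∨ j = i + 1 ∨ i = j + 1 ∨ j = i + 2 ∨ i = j + 2 := by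
  decide

theorem chord_adjacent (hcubic : G.IsCubic) (h4 : ¬ G.HasCycleOfLength 4) {i j : Fin 5}
    (h : P.outer i = P.vert j) : j = i + 1 ∨ i = j + 1 := by
  rcases fin_five_cases i j with rfl | h1 | h1 | rfl | rfl
  · exact absurd h (outer_ne_vert_self hcubic _)
  · exact Or.inl h1
  · exact Or.inr h1
  · exact absurd h (outer_ne_vert_add_two h4 _)
  · exact absurd (outer_eq_vert_symm hcubic h).2 (outer_ne_vert_add_two h4 _)

/-- If a spoke is parallel to a rim edge, then one of the replacements has no circuit double
cover. -/
theorem numCircuitDoubleCovers_replace_of_chord (hcubic : G.IsCubic)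
    (h4 : ¬ G.HasCycleOfLength 4) {i : Fin 5} (h : P.outer i = P.vert (i + 1)) :
    (P.replace (i + 2) (i + 2 + 1)).numCircuitDoubleCovers = 0 := by
  obtain ⟨hs, h'⟩ := outer_eq_vert_symm hcubic h
  have hshift : i + 2 + 1 = i + 3 := (by decide : ∀ i : Fin 5, i + 2 + 1 = i + 3) i
  rw [hshift]
  have hv := P.vert_injective
  have out2 : ∀ k, P.outer (i + 2) = P.vert k → k = i + 3 := by
    intro k hk
    rcases chord_adjacent hcubic h4 hk with h1 | h1
    · rw [h1]; exact (by decide : ∀ i : Fin 5, i + 2 + 1 = i + 3) i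
    · have hki : k = i + 1 := (by decide : ∀ i k : Fin 5, i + 2 = k + 1 → k = i + 1) i k h1
      subst hki
      have h2 := hv ((outer_eq_vert_symm hcubic hk).2.symm.trans h')
      exact absurd h2 ((by decide : ∀ i : Fin 5, i + 2 ≠ i) i)
  have out4 : ∀ k, P.outer (i + 4) = P.vert k → k = i + 3 := by
    intro k hk
    rcases chord_adjacent hcubic h4 hk with h1 | h1
    · have hki : k = i := (by decide : ∀ i k : Fin 5, k = i + 4 + 1 → k = i) i k h1
      subst hki
      have h2 := hv ((outer_eq_vert_symm hcubic hk).2.symm.trans h)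
      exact absurd h2 ((by decide : ∀ i : Fin 5, i + 4 ≠ i + 1) k)
    · exact (by decide : ∀ i k : Fin 5, i + 4 = k + 1 → k = i + 3) i k h1
  have out3 : ∀ k, P.outer (i + 3) = P.vert k → k = i + 2 ∨ k = i + 4 := by
    intro k hk
    rcases chord_adjacent hcubic h4 hk with h1 | h1
    · exact Or.inr (by rw [h1]; exact (by decide : ∀ i : Fin 5, i + 3 + 1 = i + 4) i)
    · exact Or.inl ((by decide : ∀ i k : Fin 5, i + 3 = k + 1 → k = i + 2) i k h1)
  have hsne : ∀ {c d : Fin 5}, c ≠ d → P.outer c ≠ P.vert d → P.spoke c ≠ P.spoke d := by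
    intro c d hcd hne heq
    have h1 : G.Inc (P.spoke c) (P.vert d) := heq ▸ P.inc_spoke_self d
    rcases inc_spoke.1 h1 with h2 | h2
    · exact hcd (hv h2).symm
    · exact hne h2.symm
  have hnr : ∀ c, P.spoke c ∉ Set.range P.rim := by
    rintro c ⟨k, hk⟩
    exact P.spoke_ne_rim _ _ hk.symm
  have hne : ∀ {a b : Fin 5}, a ≠ b → P.vert a ≠ P.vert b := fun hab => hv.ne_iff.2 hab
  -- Both ends of the chord collapse to the new vertex. The spokes `i` and `i + 1` are this one
  -- edge, so at most one spoke at the new vertex is not a loop.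
  have hloop : (P.replace (i + 2) (i + 3)).IsLoopAt (some (P.spoke i)) none := by
    refine replace_isLink_some.2 ⟨⟨hnr i, hsne ((by decide : ∀ i : Fin 5, i ≠ i + 2) i) ?_,
      hsne ((by decide : ∀ i : Fin 5, i ≠ i + 3) i) ?_⟩,
      _, _, P.spoke_isLink i, collapse_vert i, by rw [h, collapse_vert]⟩
    · rw [h]; exact hne ((by decide : ∀ i : Fin 5, i + 1 ≠ i + 2) i)
    · rw [h]; exact hne ((by decide : ∀ i : Fin 5, i + 1 ≠ i + 3) i)
  have hsome : ∀ e, (P.replace (i + 2) (i + 3)).Inc (some e) none →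
      some e = some (P.spoke (i + 4)) ∧ P.spoke (i + 4) ≠ P.spoke (i + 3) ∨
        (P.replace (i + 2) (i + 3)).IsLoopAt (some e) none := by
    intro e he
    obtain ⟨he, u, hu, hun⟩ := replace_inc_some.1 he
    obtain ⟨c, rfl⟩ := collapse_eq_none.1 hun
    have hec : e = P.spoke c := by
      have h1 : e ∈ G.incidenceSet (P.vert c) := hu
      rw [P.incidenceSet_vert_of_encard (encard_incidenceSet_vert hcubic c).1] at h1
      rcases h1 with h1 | h1 | h1
      · exact absurd ⟨_, h1.symm⟩ he.1
      · exact absurd ⟨_, h1.symm⟩ he.1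
      · exact h1
    rcases (by decide : ∀ i c : Fin 5, c = i ∨ c = i + 1 ∨ c = i + 2 ∨ c = i + 3 ∨ c = i + 4) i c
      with rfl | rfl | rfl | rfl | rfl
    · exact Or.inr (hec ▸ hloop)
    · exact Or.inr (hec ▸ hs ▸ hloop)
    · exact absurd hec he.2.1
    · exact absurd hec he.2.2
    · exact Or.inl ⟨congrArg some hec, hec ▸ he.2.2⟩
  -- If the spoke `i + 4` is a chord too, it equals the spoke `i + 3` and is deleted, and the new
  -- edge is the only non-loop at the new vertex. Otherwise the spoke `i + 4` is the only non-loop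
  -- there, as the new edge can reach the new vertex only as a loop.
  by_cases hr : P.outer (i + 4) ∈ Set.range P.vert
  · obtain ⟨k, hk⟩ := hr
    obtain rfl := out4 k hk.symm
    obtain ⟨hs34, h34⟩ := outer_eq_vert_symm hcubic hk.symm
    have h2 : P.outer (i + 2) ∉ Set.range P.vert := by
      rintro ⟨k, hk2⟩
      obtain rfl := out2 k hk2.symm
      have h3 := hv ((outer_eq_vert_symm hcubic hk2.symm).2.symm.trans h34)
      exact (by decide : ∀ i : Fin 5, i + 2 ≠ i + 4) i h3
    refine numCircuitDoubleCovers_eq_zero_of_loops (f := none) (x := none)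
      ⟨some (P.outer (i + 2)), by simp, ?_⟩ ?_
    · rw [replace_isLink_none, collapse_of_notMem h2, h34, collapse_vert]
      exact Sym2.eq_swap
    · intro e he
      cases e with
      | none => exact Or.inl rfl
      | some e =>
        rcases hsome e he with ⟨-, h1⟩ | h1
        · exact absurd hs34 h1
        · exact Or.inr h1
  · have hr' : ∀ k, P.outer (i + 4) ≠ P.vert k := fun k hk => hr ⟨k, hk.symm⟩
    refine numCircuitDoubleCovers_eq_zero_of_loops (f := some (P.spoke (i + 4))) (x := none)
      ⟨some (P.outer (i + 4)), by simp, ?_⟩ ?_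
    · exact replace_isLink_some.2 ⟨⟨hnr _, hsne ((by decide : ∀ i : Fin 5, i + 4 ≠ i + 2) i) (hr' _),
        hsne ((by decide : ∀ i : Fin 5, i + 4 ≠ i + 3) i) (hr' _)⟩,
        _, _, P.spoke_isLink (i + 4), collapse_vert _, collapse_of_notMem hr⟩
    · intro e he
      cases e with
      | some e => exact (hsome e he).imp And.left id
      | none =>
        right
        have hboth : P.outer (i + 2) = P.vert (i + 3) → P.outer (i + 3) = P.vert (i + 2) →
            (P.replace (i + 2) (i + 3)).IsLoopAt none none := by
          intro h2 h3
          rw [← isLink_self_iff, replace_isLink_none, h2, h3, collapse_vert, collapse_vert]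
        rcases replace_inc_none.1 he with h1 | h1
        · obtain ⟨k, hk⟩ := collapse_eq_none.1 h1.symm
          obtain rfl := out2 k hk.symm
          exact hboth hk.symm (outer_eq_vert_symm hcubic hk.symm).2
        · obtain ⟨k, hk⟩ := collapse_eq_none.1 h1.symm
          rcases out3 k hk.symm with rfl | rfl
          · exact hboth (outer_eq_vert_symm hcubic hk.symm).2 hk.symm
          · exact absurd (outer_eq_vert_symm hcubic hk.symm).2 (hr' _)

theorem spoke_ne_spoke (hout : ∀ i j, P.outer i ≠ P.vert j) {i j : Fin 5} (hij : i ≠ j) :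
    P.spoke i ≠ P.spoke j := by
  intro heq
  have h1 : G.Inc (P.spoke i) (P.vert j) := heq ▸ P.inc_spoke_self j
  rcases inc_spoke.1 h1 with h2 | h2
  · exact hij (P.vert_injective h2).symm
  · exact hout i j h2.symm

theorem isNonloopAt_replace {a b : Fin 5} {x : α} {f : β} (hx : x ∉ Set.range P.vert)
    (hf : G.IsNonloopAt f x) (ha : f ≠ P.spoke a) (hb : f ≠ P.spoke b) :
    (P.replace a b).IsNonloopAt (some f) (some x) := by
  obtain ⟨y, hy, hl⟩ := hf
  refine ⟨P.collapse y, fun h => hy (collapse_eq_some.1 h).1, replace_isLink_some.2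
    ⟨⟨?_, ha, hb⟩, x, y, hl, collapse_of_notMem hx, rfl⟩⟩
  rintro ⟨i, rfl⟩
  rcases inc_rim.1 hl.inc_left with rfl | rfl
  · exact hx ⟨_, rfl⟩
  · exact hx ⟨_, rfl⟩

/-- A loop of the graph survives in the replacements, which have no circuit double cover then. -/
theorem numCircuitDoubleCovers_replace_of_loop (hcubic : G.IsCubic)
    (hout : ∀ i j, P.outer i ≠ P.vert j) {e : β} {x : α} (he : G.IsLoopAt e x) :
    (P.replace 0 (0 + 1)).numCircuitDoubleCovers = 0 := by
  have hx : x ∉ Set.range P.vert := by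
    rintro ⟨i, rfl⟩
    have h1 : e ∈ G.loopSet (P.vert i) := he
    rw [(encard_incidenceSet_vert hcubic i).2] at h1
    exact h1
  obtain ⟨f, hf, hfe⟩ := exists_nonloop_of_degree_eq_three (hcubic x he.vertex_mem) he
  have hspoke : ∀ c, ¬ G.IsLoopAt (P.spoke c) x := by
    intro c hc
    have h1 := hc.eq_of_inc (P.inc_spoke_self c)
    exact hx ⟨c, h1.symm⟩
  have hsf : ∀ c, G.Inc (P.spoke c) x → P.spoke c = f := fun c hc =>
    (hfe _ hc).resolve_right (hspoke c)
  have hinc := incidenceSet_replace_some (a := 0) (b := 0 + 1) hout hx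
  refine numCircuitDoubleCovers_eq_zero_of_loops (f := P.replacedEdge 0 (0 + 1) f) (x := some x)
    ?_ ?_
  -- If `f` is one of the two replaced spokes, the new edge takes its place. It is no loop, since
  -- the other spoke would be a second non-loop edge at `x` if it ended there.
  · by_cases hs : f = P.spoke 0 ∨ f = P.spoke (0 + 1)
    · rw [replacedEdge_eq_none.2 hs]
      have hlink : ∀ c d : Fin 5, c ≠ d → f = P.spoke c → P.outer d ≠ P.outer c := by
        intro c d hcd hfc hdc
        have hxc : x = P.outer c := eq_outer_of_inc_spoke hx (hfc ▸ hf.inc)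
        have h1 := hsf d (inc_spoke.2 (Or.inr (by rw [hxc, hdc])))
        exact spoke_ne_spoke hout hcd (hfc.symm.trans h1.symm)
      rcases hs with hs | hs
      · have hxc : x = P.outer 0 := eq_outer_of_inc_spoke hx (hs ▸ hf.inc)
        refine ⟨some (P.outer (0 + 1)), fun h => ?_, ?_⟩
        · exact hlink 0 (0 + 1) (by decide) hs ((Option.some.inj h).trans hxc)
        · rw [replace_isLink_none, collapse_outer hout, collapse_outer hout, hxc]
      · have hxc : x = P.outer (0 + 1) := eq_outer_of_inc_spoke hx (hs ▸ hf.inc)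
        refine ⟨some (P.outer 0), fun h => ?_, ?_⟩
        · exact hlink (0 + 1) 0 (by decide) hs ((Option.some.inj h).trans hxc)
        · rw [replace_isLink_none, collapse_outer hout, collapse_outer hout, hxc]
          exact Sym2.eq_swap
    · rw [not_or] at hs
      rw [replacedEdge_eq_some.2 ⟨rfl, hs⟩]
      exact isNonloopAt_replace hx hf hs.1 hs.2
  · intro d hd
    have hd' : d ∈ (P.replace 0 (0 + 1)).incidenceSet (some x) := hd
    rw [hinc] at hd'
    obtain ⟨d', hd1, rfl⟩ := hd'
    rcases hfe d' hd1 with rfl | hl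
    · exact Or.inl rfl
    · right
      have hn : ∀ c, d' ≠ P.spoke c := fun c hc => hspoke c (hc ▸ hl)
      rw [replacedEdge_eq_some.2 ⟨rfl, hn _, hn _⟩]
      refine replace_isLink_some.2 ⟨⟨?_, hn _, hn _⟩, x, x, hl, collapse_of_notMem hx,
        collapse_of_notMem hx⟩
      rintro ⟨k, rfl⟩
      exact hx ⟨k, (hl.eq_of_inc (P.inc_rim_self k)).symm⟩

/-- If two consecutive spokes lead to the same vertex, then a replacement has a loop and no
circuit double cover. -/
theorem numCircuitDoubleCovers_replace_of_outer_eq (hG : G.IsLooplessCubic)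
    (hout : ∀ i j, P.outer i ≠ P.vert j) {i : Fin 5} (h : P.outer i = P.outer (i + 1)) :
    (P.replace i (i + 1)).numCircuitDoubleCovers = 0 := by
  have hx := outer_notMem hout i
  have hi : G.Inc (P.spoke i) (P.outer i) := inc_spoke.2 (Or.inr rfl)
  have hi' : G.Inc (P.spoke (i + 1)) (P.outer i) := inc_spoke.2 (Or.inr h)
  have hne : P.spoke i ≠ P.spoke (i + 1) :=
    spoke_ne_spoke hout ((by decide : ∀ i : Fin 5, i ≠ i + 1) i)
  obtain ⟨g, hg1, hg2, hinc⟩ := hG.exists_third ⟨P.outer i, P.spoke i, P.spoke (i + 1), hi, hi', hne⟩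
  have hg : G.Inc g (P.outer i) := by
    change g ∈ G.incidenceSet (P.outer i)
    rw [hinc]; simp
  have hgn : G.IsNonloopAt g (P.outer i) :=
    isNonloopAt_iff_inc_not_isLoopAt.2 ⟨hg, hG.not_isLoopAt _ _⟩
  refine numCircuitDoubleCovers_eq_zero_of_loops (isNonloopAt_replace hx hgn hg1 hg2) ?_
  intro d hd
  have hd' : d ∈ (P.replace i (i + 1)).incidenceSet (some (P.outer i)) := hd
  rw [incidenceSet_replace_some hout hx, hinc] at hd'
  have hloop : (P.replace i (i + 1)).IsLoopAt none (some (P.outer i)) := by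
    rw [← isLink_self_iff, replace_isLink_none, ← h, collapse_outer hout]
  obtain ⟨d', hd1, rfl⟩ := hd'
  rcases hd1 with rfl | rfl | rfl
  · exact Or.inr (replacedEdge_eq_none.2 (Or.inl rfl) ▸ hloop)
  · exact Or.inr (replacedEdge_eq_none.2 (Or.inr rfl) ▸ hloop)
  · exact Or.inl (replacedEdge_eq_some.2 ⟨rfl, hg1, hg2⟩)

/-- A 5-cycle is proper unless one of the five non-crossing replacements has no circuit double
cover. -/
theorem isProper_or_exists_eq_zero (hcubic : G.IsCubic) (h4 : ¬ G.HasCycleOfLength 4)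
    (P : G.FiveCycle) :
    P.IsProper ∨ ∃ i, (P.replace i (i + 1)).numCircuitDoubleCovers = 0 := by
  by_cases hchord : ∃ i j, P.outer i = P.vert j
  · obtain ⟨i, j, h⟩ := hchord
    right
    rcases chord_adjacent hcubic h4 h with rfl | rfl
    · exact ⟨_, numCircuitDoubleCovers_replace_of_chord hcubic h4 h⟩
    · exact ⟨_, numCircuitDoubleCovers_replace_of_chord hcubic h4 (outer_eq_vert_symm hcubic h).2⟩
  have hout : ∀ i j, P.outer i ≠ P.vert j := fun i j h => hchord ⟨i, j, h⟩
  by_cases hloop : ∃ e x, G.IsLoopAt e x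
  · obtain ⟨e, x, he⟩ := hloop
    exact Or.inr ⟨0, numCircuitDoubleCovers_replace_of_loop hcubic hout he⟩
  have hG : G.IsLooplessCubic := by
    refine ⟨fun e x h => hloop ⟨e, x, h⟩, fun x hx => ?_⟩
    have hd := hcubic x hx
    have hl : G.loopSet x = ∅ := by
      rw [Set.eq_empty_iff_forall_notMem]
      exact fun e he => hloop ⟨e, x, he⟩
    rwa [degree, hl, Set.encard_empty, add_zero] at hd
  by_cases hinj : ∃ i, P.outer i = P.outer (i + 1)
  · obtain ⟨i, hi⟩ := hinj
    exact Or.inr ⟨i, numCircuitDoubleCovers_replace_of_outer_eq hG hout hi⟩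
  refine Or.inl ⟨hG, fun i j h => ?_, hout⟩
  rcases fin_five_cases i j with rfl | rfl | rfl | rfl | rfl
  · rfl
  · exact absurd ⟨_, h⟩ hinj
  · exact absurd ⟨_, h.symm⟩ hinj
  · exact absurd h (outer_ne_outer_add_two h4 hout _)
  · exact absurd h.symm (outer_ne_outer_add_two h4 hout _)

end FiveCycle

end Graph

/-! ### The two inequalities. -/

theorem mem_spokePairs_or : ∀ a b : Fin 5, a ≠ b → (a, b) ∈ spokePairs ∨ (b, a) ∈ spokePairs := by
  decide

theorem theorem6p3 {α β : Type*} (G : Graph α β)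
    (hV : G.vertexSet.Finite) (hE : G.edgeSet.Finite) (hcubic : G.IsCubic)
    (hconn : G.CyclicallyEdgeConnected 4) (h4 : ¬ G.HasCycleOfLength 4) (P : G.FiveCycle) :
    (5 / 2 : ℝ) * (Finset.univ : Finset (Fin 5)).inf' Finset.univ_nonempty
        (fun i => ((P.replace i (i + 1)).numCircuitDoubleCovers : ℝ))
      ≤ (G.numCircuitDoubleCovers : ℝ) ∧
    (3.75 : ℝ) * spokePairs.inf' spokePairs_nonempty
        (fun p => ((P.replace p.1 p.2).numCircuitDoubleCovers : ℝ))
      ≤ (G.numCircuitDoubleCovers : ℝ) := by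
  set m₁ := (Finset.univ : Finset (Fin 5)).inf' Finset.univ_nonempty
        (fun i => ((P.replace i (i + 1)).numCircuitDoubleCovers : ℝ)) with hm₁
  set m₂ := spokePairs.inf' spokePairs_nonempty
        (fun p => ((P.replace p.1 p.2).numCircuitDoubleCovers : ℝ)) with hm₂
  have h1 : ∀ i : Fin 5, m₁ ≤ ((P.replace i (i + 1)).numCircuitDoubleCovers : ℝ) := fun i =>
    Finset.inf'_le _ (Finset.mem_univ i)
  have h2 : ∀ a b : Fin 5, a ≠ b → m₂ ≤ ((P.replace a b).numCircuitDoubleCovers : ℝ) := by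
    intro a b hab
    rcases mem_spokePairs_or a b hab with h | h
    · exact Finset.inf'_le (fun p : Fin 5 × Fin 5 =>
        ((P.replace p.1 p.2).numCircuitDoubleCovers : ℝ)) h
    · rw [P.replace_comm]
      exact Finset.inf'_le (fun p : Fin 5 × Fin 5 =>
        ((P.replace p.1 p.2).numCircuitDoubleCovers : ℝ)) h
  have hne1 : ∀ i : Fin 5, i ≠ i + 1 := by decide
  have hne2 : ∀ i : Fin 5, i ≠ i + 2 := by decide
  have hpos : (0 : ℝ) ≤ G.numCircuitDoubleCovers := Nat.cast_nonneg _
  rcases P.isProper_or_exists_eq_zero hcubic h4 with hP | ⟨i, hi⟩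
  -- For `m₁` the sum over the pairs `i, i + 2` is bounded below by zero: `2 * 5 * m₁ ≤ 4 ν(G)`. For
  -- `m₂` both sums count: `(2 * 5 + 5) * m₂ ≤ 4 ν(G)`.
  · have hsum : (2 : ℝ) * ∑ i : Fin 5, ((P.replace i (i + 1)).numCircuitDoubleCovers : ℝ) +
        ∑ i : Fin 5, ((P.replace i (i + 2)).numCircuitDoubleCovers : ℝ) ≤
          4 * G.numCircuitDoubleCovers := by
      exact_mod_cast hP.weighted_sum_le hV hE
    have hs1 : 5 * m₁ ≤ ∑ i : Fin 5, ((P.replace i (i + 1)).numCircuitDoubleCovers : ℝ) := by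
      simpa using Finset.card_nsmul_le_sum Finset.univ _ m₁ fun i _ => h1 i
    have hs2 : 5 * m₂ ≤ ∑ i : Fin 5, ((P.replace i (i + 1)).numCircuitDoubleCovers : ℝ) := by
      simpa using Finset.card_nsmul_le_sum Finset.univ _ m₂ fun i _ => h2 i (i + 1) (hne1 i)
    have hs3 : 5 * m₂ ≤ ∑ i : Fin 5, ((P.replace i (i + 2)).numCircuitDoubleCovers : ℝ) := by
      simpa using Finset.card_nsmul_le_sum Finset.univ _ m₂ fun i _ => h2 i (i + 2) (hne2 i)
    have hs0 : 0 ≤ ∑ i : Fin 5, ((P.replace i (i + 2)).numCircuitDoubleCovers : ℝ) :=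
      Finset.sum_nonneg fun i _ => Nat.cast_nonneg _
    constructor <;> linarith
  -- A replacement without circuit double cover makes both minima at most zero.
  · have e1 := h1 i
    have e2 := h2 i (i + 1) (hne1 i)
    rw [hi, Nat.cast_zero] at e1 e2
    constructor <;> linarith
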